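/- Let $n\in\{2,3\}$. Let $K$ be a real function on $\mathbb R^n\setminus\{0\}$ with $K\ge 0$, $K(-z)=K(z)$, $\int_{\mathbb R^n}K(z)\min\{1,|z|\}\,dz<\infty$ and $K\ge 1$ in $B_2\setminus\{0\}$, twice differentiable on $\mathbb R^n\setminus\{0\}$, such that $$\max\Bigl\{|z|\,|\partial_eK(z)|,\ |z|^2\sup_{|y-z|\le |z|/2}|\partial_{ee}K(y)|\Bigr\}\le K^*(z):=C_1\bigl(K(z)+\chi_{\{|z|<R_0\}}(z)\bigr)$$ for all $z\ne0$ and all unit vectors $e$, where $C_1>0$ and $R_0\ge2$ are constants. Put $L_K(A,D)=\int_A\int_D K(x-y)\,dy\,dx$, $P_K(A)=L_K(A,A^c)$ and $$P_{K,\Omega}(A)=L_K(A\cap\Omega,A^c\cap\Omega)+L_K(A\cap\Omega,A^c\setminus\Omega)+L_K(A\setminus\Omega,A^c\cap\Omega).$$ Let $R\ge4$ and let the measurable set $E\subset\mathbb R^n$ be a minimizer of the $K$-perimeter in $B_R$ (the ball of radius $R$ centred at $0$), that is, $P_{K,B_R}(E)<\infty$ and $P_{K,B_R}(E)\le P_{K,B_R}(F)$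 for every measurable $F$ with $F\setminus B_R=E\setminus B_R$. Then there are a constant $C>0$ depending only on $n$ and $R_0$, and a constant $C(n)>0$ depending only on $n$, such that, with $$\varepsilon=C\min\Bigl\{\sqrt{\frac{C_1P_K(B_R)}{R^2}},\ \frac1{\sqrt{\log R}}\sup_{\rho\in[1,R]}\sqrt{\frac{C_1P_K(B_\rho)}{\rho^2}}\Bigr\}\in(0,\infty),$$ after a rotation about the origin (i.e. with $E$ replaced by its image under an element of $SO(n)$) the following three properties hold. Points are written $x=(x',x_n)$ with $x'\in\mathbb R^{n-1}$. (F1) There is $t\in[-1,1]$ with $|(E\triangle\{x_n\le t\})\cap B_1|\le\varepsilon$. (F2) There are a measurable set $\mathcal B\subset B_1^{(n-1)}=\{x'\in\mathbb R^{n-1}:|x'|\le1\}$ with $|\mathcal B|\le\varepsilon$ and a measurable function $g:B_1^{(n-1)}\to[-1,1]$ such that, up to a Lebesgue null set, $$(E\cap B_1)\setminus(\mathcal B\times\mathbb R)=\{(y,x_n)\in B_1:\ x_n\le g(y),\ y\in B_1^{(n-1)}\setminus\mathcal B\}.$$ (F3) With $F^\varepsilon=\{(x',x_n/\varepsilon):(x',x_n)\in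 F\}$ and $\mathrm{Per}_\Omega(A)=\sup\{\int_A\operatorname{div}\phi\,dx:\ \phi\in C^1_c(\Omega;\mathbb R^n),\ |\phi|\le1\}$ the classical perimeter, $$\mathrm{Per}_{B_1^\varepsilon}(E^\varepsilon)\le C(n)\max\{1,\varepsilon\};$$ in particular $\mathrm{Per}_{B_1^\varepsilon}(E^\varepsilon)\le C(n)$ whenever $\varepsilon\le1$. -/

import Mathlib

open MeasureTheory Set
open scoped ENNReal

noncomputable section

/-! ### Nonlocal perimeters -/

/-- The interaction `L_K(A, B) = ∫_A ∫_B K(x - y) dy dx`, with values in `[0, ∞]`. -/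
def interaction {n : ℕ} (K : EuclideanSpace ℝ (Fin n) → ℝ)
    (A B : Set (EuclideanSpace ℝ (Fin n))) : ℝ≥0∞ :=
  ∫⁻ x in A, ∫⁻ y in B, ENNReal.ofReal (K (x - y))

/-- The `K`-perimeter in the whole space, `P_K(E) = L_K(E, Eᶜ)`. -/
def perK {n : ℕ} (K : EuclideanSpace ℝ (Fin n) → ℝ)
    (E : Set (EuclideanSpace ℝ (Fin n))) : ℝ≥0∞ :=
  interaction K E Eᶜ

/-- The `K`-perimeter `P_{K,Ω}(E)` of `E` relative to `Ω`. -/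
def perKIn {n : ℕ} (K : EuclideanSpace ℝ (Fin n) → ℝ)
    (Ω E : Set (EuclideanSpace ℝ (Fin n))) : ℝ≥0∞ :=
  interaction K (E ∩ Ω) (Eᶜ ∩ Ω) + interaction K (E ∩ Ω) (Eᶜ \ Ω)
    + interaction K (E \ Ω) (Eᶜ ∩ Ω)

/-- `E` is a minimizer of the `K`-perimeter in `Ω`: it is Lebesgue measurable, has finite
`K`-perimeter in `Ω`, and no Lebesgue measurable set that coincides with `E` outside `Ω` has
smaller `K`-perimeter in `Ω`. -/
structure IsMinimizer {n : ℕ} (K : EuclideanSpace ℝ (Fin n) → ℝ)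
    (Ω E : Set (EuclideanSpace ℝ (Fin n))) : Prop where
  measurable : NullMeasurableSet E volume
  finite : perKIn K Ω E ≠ ∞
  minimal : ∀ F : Set (EuclideanSpace ℝ (Fin n)), NullMeasurableSet F volume →
    F \ Ω = E \ Ω → perKIn K Ω E ≤ perKIn K Ω F

/-! ### Kernels -/

/-- The standing assumptions on a kernel `K` with derivative bound `Kstar`. The value of `K` at the
origin, where a kernel may be singular, is irrelevant. -/
structure IsKernel {n : ℕ} (K Kstar : EuclideanSpace ℝ (Fin n) → ℝ) : Prop where
  nonneg : ∀ z, z ≠ 0 → 0 ≤ K z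
  even : ∀ z, K (-z) = K z
  integrable : Integrable (fun z => K z * min 1 ‖z‖) volume
  one_le : ∀ z, z ≠ 0 → ‖z‖ < 2 → 1 ≤ K z
  differentiable : DifferentiableOn ℝ K {0}ᶜ
  differentiable_fderiv : DifferentiableOn ℝ (fderiv ℝ K) {0}ᶜ
  first_deriv_le : ∀ z, z ≠ 0 → ∀ e : EuclideanSpace ℝ (Fin n), ‖e‖ = 1 →
    ‖z‖ * |fderiv ℝ K z e| ≤ Kstar z
  second_deriv_le : ∀ z, z ≠ 0 → ∀ e : EuclideanSpace ℝ (Fin n), ‖e‖ = 1 →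
    ∀ y, ‖y - z‖ ≤ ‖z‖ / 2 → ‖z‖ ^ 2 * |fderiv ℝ (fderiv ℝ K) y e e| ≤ Kstar z

/-- The function `K^*(z) = C₁ (K(z) + χ_{|z| < R₀}(z))`. -/
def kernelStar {n : ℕ} (K : EuclideanSpace ℝ (Fin n) → ℝ) (C₁ R₀ : ℝ) :
    EuclideanSpace ℝ (Fin n) → ℝ :=
  fun z => C₁ * (K z + (Metric.ball (0 : EuclideanSpace ℝ (Fin n)) R₀).indicator (fun _ => 1) z)

/-- The quantity `√(C₁ P_K(B_ρ) / ρ²)`, with values in `[0, ∞]`. -/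
def energyDensityRoot {n : ℕ} (K : EuclideanSpace ℝ (Fin n) → ℝ) (C₁ ρ : ℝ) : ℝ≥0∞ :=
  (ENNReal.ofReal C₁ * perK K (Metric.ball 0 ρ) / ENNReal.ofReal (ρ ^ 2)) ^ (1 / 2 : ℝ)

/-- The quantity
`min { √(C₁ P_K(B_R)/R²), (log R)^{-1/2} sup_{1 ≤ ρ ≤ R} √(C₁ P_K(B_ρ)/ρ²) }`. -/
def flatnessRate {n : ℕ} (K : EuclideanSpace ℝ (Fin n) → ℝ) (C₁ R : ℝ) : ℝ≥0∞ :=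
  min (energyDensityRoot K C₁ R)
    (ENNReal.ofReal (1 / Real.sqrt (Real.log R)) * ⨆ ρ ∈ Icc (1 : ℝ) R, energyDensityRoot K C₁ ρ)

/-! ### Classical perimeter -/

/-- The divergence of a vector field. -/
def divergence {n : ℕ} (φ : EuclideanSpace ℝ (Fin n) → EuclideanSpace ℝ (Fin n))
    (x : EuclideanSpace ℝ (Fin n)) : ℝ :=
  ∑ i, fderiv ℝ φ x (EuclideanSpace.single i 1) i

/-- The classical perimeter of `E` in the open set `Ω`: the total variation in `Ω` of the
characteristic function of `E`. -/
def classicalPer {n : ℕ} (Ω E : Set (EuclideanSpace ℝ (Fin n))) : ℝ≥0∞ :=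
  ⨆ φ ∈ {φ : EuclideanSpace ℝ (Fin n) → EuclideanSpace ℝ (Fin n) |
      ContDiff ℝ 1 φ ∧ HasCompactSupport φ ∧ tsupport φ ⊆ Ω ∧ ∀ x, ‖φ x‖ ≤ 1},
    ENNReal.ofReal (∫ x in E, divergence φ x)

/-! ### The flatness properties

Points of `ℝ^(d+1)` are written `(x', x_n)` with `x' ∈ ℝ^d` and `x_n` the last coordinate. -/

/-- The horizontal part `x'`. -/
def horiz {d : ℕ} (x : EuclideanSpace ℝ (Fin (d + 1))) : EuclideanSpace ℝ (Fin d) :=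
  WithLp.toLp 2 fun i => x i.castSucc

/-- The vertical part `x_n`. -/
def vert {d : ℕ} (x : EuclideanSpace ℝ (Fin (d + 1))) : ℝ :=
  x (Fin.last d)

/-- The map `(x', x_n) ↦ (x', x_n / ε)`. -/
def stretch {d : ℕ} (ε : ℝ) (x : EuclideanSpace ℝ (Fin (d + 1))) :
    EuclideanSpace ℝ (Fin (d + 1)) :=
  WithLp.toLp 2 (Fin.snoc (fun i : Fin d => x i.castSucc) (x (Fin.last d) / ε) :
    Fin (d + 1) → ℝ)

/-- `E` is `ε`-close in `L¹(B₁)` to a horizontal half-space. -/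
def CloseToHalfSpace {d : ℕ} (E : Set (EuclideanSpace ℝ (Fin (d + 1)))) (ε : ℝ) : Prop :=
  ∃ t ∈ Icc (-1 : ℝ) 1,
    volume (symmDiff E {x | vert x ≤ t} ∩ Metric.ball 0 1) ≤ ENNReal.ofReal ε

/-- Outside a vertical cylinder over a set of measure at most `ε`, the set `E ∩ B₁` is (up to a
Lebesgue null set) a subgraph in the vertical direction. -/
def SubgraphOutsideSmallSet {d : ℕ} (E : Set (EuclideanSpace ℝ (Fin (d + 1)))) (ε : ℝ) : Prop :=
  ∃ (B : Set (EuclideanSpace ℝ (Fin d))) (g : EuclideanSpace ℝ (Fin d) → ℝ),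
    B ⊆ Metric.closedBall 0 1 ∧ MeasurableSet B ∧ volume B ≤ ENNReal.ofReal ε ∧
    Measurable g ∧ (∀ y, g y ∈ Icc (-1 : ℝ) 1) ∧
    ((E ∩ Metric.ball 0 1) \ {x | horiz x ∈ B} : Set (EuclideanSpace ℝ (Fin (d + 1))))
      =ᵐ[volume]
    ({x | x ∈ Metric.ball 0 1 ∧ vert x ≤ g (horiz x) ∧ horiz x ∈ Metric.closedBall 0 1 \ B} :
      Set (EuclideanSpace ℝ (Fin (d + 1))))

/-- The perimeter of the vertical rescaling `E^ε` in `B₁^ε` is at most `M`. -/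
def StretchedPerBound {d : ℕ} (E : Set (EuclideanSpace ℝ (Fin (d + 1)))) (ε M : ℝ) : Prop :=
  classicalPer (stretch ε '' Metric.ball 0 1) (stretch ε '' E) ≤ ENNReal.ofReal M

end

open MeasureTheory Set
open scoped ENNReal

noncomputable section

/-! The engine is a second variation argument with finite displacements. Let `φ` be a cutoff equal
to 1 on `B_2` and to 0 outside `B_R`, and let `F_t` be the image of `E` under `x ↦ x + t φ(x) v`.
When the energies of `F_t` and `F_{-t}` are pulled back to `E` and added, the terms of first order
in `t` cancel. The derivative bounds on `K` then leave `P(F_t) + P(F_{-t}) ≤ 2 P(E) + t² Q`, where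
`Q` is, up to a constant, the squared slope of `φ` integrated against `K^*` over the pairs that
define the energy (`IsCutoff.perturbed_energy_add_le`). Minimality against `F_{-t}`, `E ∪ F_t` and
`E ∩ F_t`, together with submodularity, bounds the interaction of `E \ F_t` with `F_t \ E` by `t² Q`
(`IsMinimizer.lintegral_diffPairs_le`). Near the unit ball the map is the translation by `t v`, and
`K ≥ 1` in `B_2`, so this interaction dominates the product of the measures of the upward jumps of
`E` along `t v` and along `-t v`. Hence one of the two is at most `δ t` with `δ² = Q`
(`IsMinimizer.oneSidedJumps`).

To bound `Q`, note that a minimizer has no more energy in `B_ρ` than `P_K(B_ρ)`, since `E \ B_ρ` is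
a competitor. The linear cutoff, of slope comparable to `1 / R`, gives the first term of the rate.
The logarithmic cutoff, of slope comparable to `1 / (ρ log R)`, gives the second after a sum over
about `log R` dyadic layers.

The geometric half concerns the directional variation `upVar E v`, the limit of dyadic jump
quotients. It is subadditive and positively homogeneous, and for every `v` it is at most `δ ‖v‖` at
`v` or at `-v`. On the connected unit sphere of any subspace of dimension at least two, the closed
sets where each alternative holds are antipodal and cover the sphere, so they meet. Iterating in
orthogonal complements gives `d` orthonormal directions with small variation for both signs
(`OneSidedJumps.exists_orthonormal`); these become horizontal. The last axis is oriented so that its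
upward variation is small, while the downward one exceeds it by at most the area of the unit sphere.

Flatness follows. A vertical column with variation below one is an initial segment by Lebesgue
density, and Chebyshev bounds the other columns (F2). Stretching divides the horizontal variations,
of order `δ`, by `ε` and leaves the vertical one unchanged (F3). A Poincaré inequality on horizontal
slices shows that most slices are nearly full or nearly empty, and vertical monotonicity puts the
full ones below the empty ones (F1). -/

/-- Euclidean space of dimension `n`. -/
abbrev Euc (n : ℕ) := EuclideanSpace ℝ (Fin n)

/-! ### Upward jumps of a characteristic function along a translation -/

/-- The set of the points of a set `B` at which the translation by `w` stays in `B` and jumps from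
the complement of `E` into `E`. -/
def jumpSet {G : Type*} [Add G] (B E : Set G) (w : G) : Set G :=
  {x | x ∈ B ∧ x + w ∈ B ∧ x ∉ E ∧ x + w ∈ E}

/-- The measure of the jump set in the ball of radius `r`. -/
def upJump {n : ℕ} (E : Set (Euc n)) (r : ℝ) (w : Euc n) : ℝ≥0∞ :=
  volume (jumpSet (Metric.ball 0 r) E w)

/-- The total positive variation of the characteristic function of `E` in the unit ball in the
direction `v`. -/
def upVar {n : ℕ} (E : Set (Euc n)) (v : Euc n) : ℝ≥0∞ :=
  ⨆ k : ℕ, 2 ^ k * upJump E 1 ((1 / 2 : ℝ) ^ k • v)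

lemma measurableSet_jumpSet {G : Type*} [Add G] [MeasurableSpace G] [MeasurableAdd G] {B E : Set G}
    (hB : MeasurableSet B) (hE : MeasurableSet E) (w : G) : MeasurableSet (jumpSet B E w) := by
  have h : Measurable fun x : G => x + w := measurable_id.add_const w
  exact hB.inter ((h hB).inter (hE.compl.inter (h hE)))

lemma upJump_le_volume {n : ℕ} (E : Set (Euc n)) (r : ℝ) (w : Euc n) :
    upJump E r w ≤ volume (Metric.ball (0 : Euc n) r) :=
  measure_mono fun _ hx => hx.1

lemma upJump_ne_top {n : ℕ} (E : Set (Euc n)) (r : ℝ) (w : Euc n) : upJump E r w ≠ ∞ :=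
  ((upJump_le_volume E r w).trans_lt measure_ball_lt_top).ne

/-- A jump along `v + w` is a jump along `v` or along `w`, provided the intermediate point lies in
the larger set. -/
lemma measure_jumpSet_add_le {G : Type*} [AddGroup G] [MeasurableSpace G] [MeasurableAdd G]
    (μ : Measure G) [μ.IsAddRightInvariant] {B B' : Set G} (hB : B ⊆ B') (E : Set G) (v w : G)
    (h : ∀ x ∈ B, x + (v + w) ∈ B → x + v ∈ B') :
    μ (jumpSet B E (v + w)) ≤ μ (jumpSet B' E v) + μ (jumpSet B' E w) := by
  have hsub : jumpSet B E (v + w) ⊆ jumpSet B' E v ∪ (fun x => x + v) ⁻¹' jumpSet B' E w := by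
    rintro x ⟨h1, h2, h3, h4⟩
    have h5 := h x h1 h2
    by_cases hx : x + v ∈ E
    · exact Or.inl ⟨hB h1, h5, h3, hx⟩
    · refine Or.inr ⟨h5, ?_, hx, ?_⟩
      · rw [add_assoc]; exact hB h2
      · rwa [add_assoc]
  refine (measure_mono hsub).trans ((measure_union_le _ _).trans ?_)
  rw [measure_preimage_add_right]

/-- Convexity puts the midpoint `x + w / 2` in `B`, so a jump along `w` already occurs along one of
the two halves. -/
lemma measure_jumpSet_le_two_mul_half {V : Type*} [NormedAddCommGroup V] [NormedSpace ℝ V]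
    [MeasurableSpace V] [MeasurableAdd V] (μ : Measure V) [μ.IsAddRightInvariant] {B : Set V}
    (hB : Convex ℝ B) (E : Set V) (w : V) :
    μ (jumpSet B E w) ≤ 2 * μ (jumpSet B E ((1 / 2 : ℝ) • w)) := by
  have hw : (1 / 2 : ℝ) • w + (1 / 2 : ℝ) • w = w := by rw [← add_smul]; norm_num
  have := measure_jumpSet_add_le μ (subset_refl B) E ((1 / 2 : ℝ) • w) ((1 / 2 : ℝ) • w) (by
    intro x hx hx'
    rw [hw] at hx'
    have := hB hx hx' (by norm_num : (0 : ℝ) ≤ 1 / 2) (by norm_num : (0 : ℝ) ≤ 1 / 2) (by norm_num)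
    convert this using 1
    rw [smul_add, ← add_assoc, ← add_smul]; norm_num)
  rwa [hw, ← two_mul] at this

lemma measure_jumpSet_le_two_pow {V : Type*} [NormedAddCommGroup V] [NormedSpace ℝ V]
    [MeasurableSpace V] [MeasurableAdd V] (μ : Measure V) [μ.IsAddRightInvariant] {B : Set V}
    (hB : Convex ℝ B) (E : Set V) (w : V) (k : ℕ) :
    μ (jumpSet B E w) ≤ 2 ^ k * μ (jumpSet B E ((1 / 2 : ℝ) ^ k • w)) := by
  induction k with
  | zero => simp
  | succ k ih =>
    refine ih.trans ?_
    rw [pow_succ, mul_assoc]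
    gcongr
    refine (measure_jumpSet_le_two_mul_half μ hB E _).trans_eq ?_
    rw [smul_smul, pow_succ, mul_comm (1 / 2 : ℝ)]

/-- Since the dyadic quotients increase, their supremum is a limit: it may be computed along any
subsequence of scales and exchanged with integrals. -/
lemma monotone_two_pow_mul_measure_jumpSet {V : Type*} [NormedAddCommGroup V] [NormedSpace ℝ V]
    [MeasurableSpace V] [MeasurableAdd V] (μ : Measure V) [μ.IsAddRightInvariant] {B : Set V}
    (hB : Convex ℝ B) (E : Set V) (w : V) :
    Monotone fun k : ℕ => 2 ^ k * μ (jumpSet B E ((1 / 2 : ℝ) ^ k • w)) := by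
  refine monotone_nat_of_le_succ fun k => ?_
  rw [pow_succ, mul_assoc]
  gcongr
  refine (measure_jumpSet_le_two_mul_half μ hB E _).trans_eq ?_
  rw [smul_smul, pow_succ, mul_comm (1 / 2 : ℝ)]

lemma upJump_add_le_of_mem {n : ℕ} (E : Set (Euc n)) (r s : ℝ) (hrs : r ≤ s) (v w : Euc n)
    (h : ∀ x ∈ Metric.ball (0 : Euc n) r, x + (v + w) ∈ Metric.ball (0 : Euc n) r →
      x + v ∈ Metric.ball (0 : Euc n) s) :
    upJump E r (v + w) ≤ upJump E s v + upJump E s w :=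
  measure_jumpSet_add_le volume (Metric.ball_subset_ball hrs) E v w h

lemma upJump_le_two_pow {n : ℕ} (E : Set (Euc n)) (r : ℝ) (w : Euc n) (k : ℕ) :
    upJump E r w ≤ 2 ^ k * upJump E r ((1 / 2 : ℝ) ^ k • w) :=
  measure_jumpSet_le_two_pow volume (convex_ball 0 r) E w k

lemma monotone_upVar_aux {n : ℕ} (E : Set (Euc n)) (v : Euc n) :
    Monotone fun k : ℕ => 2 ^ k * upJump E 1 ((1 / 2 : ℝ) ^ k • v) :=
  monotone_two_pow_mul_measure_jumpSet volume (convex_ball 0 1) E v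

lemma upJump_le_upVar {n : ℕ} (E : Set (Euc n)) (v : Euc n) : upJump E 1 v ≤ upVar E v := by
  refine le_trans ?_ (le_iSup _ 0)
  simp

/-- Exhaustion of the unit ball by smaller concentric balls. The lost margin is what keeps
intermediate points of a translation inside the unit ball in `upVar_add_le`. -/
lemma upJump_one_le {n : ℕ} (E : Set (Euc n)) (w : Euc n) (c : ℝ≥0∞)
    (h : ∀ r < 1, upJump E r w ≤ c) : upJump E 1 w ≤ c := by
  have hmono : Monotone fun k : ℕ =>
      jumpSet (Metric.ball (0 : Euc n) (1 - 1 / ((k : ℝ) + 1))) E w := by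
    intro k l hkl x hx
    have : (1 : ℝ) - 1 / ((k : ℝ) + 1) ≤ 1 - 1 / ((l : ℝ) + 1) := by
      have : (k : ℝ) ≤ l := by exact_mod_cast hkl
      gcongr
    exact ⟨Metric.ball_subset_ball this hx.1, Metric.ball_subset_ball this hx.2.1, hx.2.2⟩
  have hU : jumpSet (Metric.ball (0 : Euc n) 1) E w ⊆
      ⋃ k : ℕ, jumpSet (Metric.ball (0 : Euc n) (1 - 1 / ((k : ℝ) + 1))) E w := by
    rintro x ⟨h1, h2, h3⟩
    simp only [Metric.mem_ball, dist_zero_right] at h1 h2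
    obtain ⟨k, hk⟩ := exists_nat_one_div_lt (sub_pos.2 (max_lt h1 h2))
    refine mem_iUnion.2 ⟨k, ?_, ?_, h3⟩ <;> simp only [Metric.mem_ball, dist_zero_right]
    · linarith [le_max_left ‖x‖ ‖x + w‖]
    · linarith [le_max_right ‖x‖ ‖x + w‖]
  refine (measure_mono hU).trans ?_
  rw [hmono.measure_iUnion]
  refine iSup_le fun k => h _ ?_
  have : (0 : ℝ) < 1 / ((k : ℝ) + 1) := by positivity
  linarith

/-- A jump along `v + w` splits at the intermediate point `x + v`, which may leave the ball. After
shrinking the ball and refining the scale this cannot happen, and the factor `2 ^ j` lost in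
refining is absorbed by the normalisation of `upVar`. -/
lemma upVar_add_le {n : ℕ} (E : Set (Euc n)) (v w : Euc n) :
    upVar E (v + w) ≤ upVar E v + upVar E w := by
  refine iSup_le fun k => ?_
  have key : upJump E 1 ((1 / 2 : ℝ) ^ k • (v + w)) ≤
      (2 ^ k)⁻¹ * (upVar E v + upVar E w) := by
    refine upJump_one_le _ _ _ fun r hr => ?_
    -- At scale `2^{-j}` the vector `v` is shorter than the margin `1 - r`.
    obtain ⟨j, hj⟩ := exists_pow_lt_of_lt_one (show 0 < (1 - r) / (‖v‖ + 1) by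
      have := norm_nonneg v
      exact div_pos (by linarith) (by linarith)) (show (1 / 2 : ℝ) < 1 by norm_num)
    refine (upJump_le_two_pow E r _ j).trans ?_
    have hsm : (1 / 2 : ℝ) ^ j • (1 / 2 : ℝ) ^ k • (v + w) =
        (1 / 2 : ℝ) ^ (k + j) • v + (1 / 2 : ℝ) ^ (k + j) • w := by
      rw [smul_smul, ← smul_add, pow_add, mul_comm]
    rw [hsm]
    have hn := norm_nonneg v
    have hle : (1 / 2 : ℝ) ^ (k + j) * ‖v‖ ≤ 1 - r := by
      have h1 : (1 / 2 : ℝ) ^ (k + j) ≤ (1 / 2 : ℝ) ^ j :=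
        pow_le_pow_of_le_one (by norm_num) (by norm_num) (by omega)
      rw [lt_div_iff₀ (by linarith)] at hj
      have h2 : (0 : ℝ) < (1 / 2 : ℝ) ^ j := by positivity
      nlinarith
    have h1 := upJump_add_le_of_mem E r 1 hr.le ((1 / 2 : ℝ) ^ (k + j) • v)
      ((1 / 2 : ℝ) ^ (k + j) • w) (by
        intro x hx _
        simp only [Metric.mem_ball, dist_zero_right] at hx ⊢
        have h3 := norm_add_le x ((1 / 2 : ℝ) ^ (k + j) • v)
        rw [norm_smul, Real.norm_of_nonneg (by positivity)] at h3
        linarith)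
    have h2 : ∀ u : Euc n, 2 ^ j * upJump E 1 ((1 / 2 : ℝ) ^ (k + j) • u) ≤
        (2 ^ k)⁻¹ * upVar E u := by
      intro u
      rw [← ENNReal.mul_le_iff_le_inv (by simp) (by simp), ← mul_assoc, ← pow_add]
      exact le_iSup (fun k : ℕ => 2 ^ k * upJump E 1 ((1 / 2 : ℝ) ^ k • u)) (k + j)
    calc _ ≤ 2 ^ j * (upJump E 1 ((1 / 2 : ℝ) ^ (k + j) • v) +
          upJump E 1 ((1 / 2 : ℝ) ^ (k + j) • w)) := by gcongr
      _ ≤ _ := by rw [mul_add, mul_add]; exact add_le_add (h2 v) (h2 w)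
  rwa [← ENNReal.mul_le_iff_le_inv (by simp) (by simp)] at key

lemma upVar_half {n : ℕ} (E : Set (Euc n)) (v : Euc n) :
    upVar E ((1 / 2 : ℝ) • v) ≤ 2⁻¹ * upVar E v := by
  rw [← ENNReal.mul_le_iff_le_inv (by simp) (by simp), upVar, ENNReal.mul_iSup]
  refine iSup_le fun k => ?_
  refine le_trans (le_of_eq ?_)
    (le_iSup (fun k : ℕ => 2 ^ k * upJump E 1 ((1 / 2 : ℝ) ^ k • v)) (k + 1))
  rw [smul_smul, ← mul_assoc, pow_succ, pow_succ, mul_comm 2]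

lemma upVar_zero {n : ℕ} (E : Set (Euc n)) : upVar E 0 = 0 := by
  refine le_antisymm (iSup_le fun k => ?_) zero_le
  have : jumpSet (Metric.ball (0 : Euc n) 1) E ((1 / 2 : ℝ) ^ k • 0) = ∅ := by
    ext x; simp [jumpSet]
  rw [upJump, this]; simp

/-- The part of a ball that a translation moves out of the ball. -/
lemma volume_ball_shift_diff_le {n : ℕ} (ρ : ℝ) (hρ : 0 < ρ) (w : Euc n) :
    volume {x | x ∈ Metric.ball (0 : Euc n) ρ ∧ x + w ∉ Metric.ball (0 : Euc n) ρ} ≤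
      ENNReal.ofReal (n * (ρ ^ n * volume.real (Metric.ball (0 : Euc n) 1)) * (‖w‖ / ρ)) := by
  -- For long translations the bound already exceeds the volume of the whole ball, because `n ≥ 1`;
  -- in dimension zero this case is void.
  by_cases hw : ρ ≤ ‖w‖
  · rcases Nat.eq_zero_or_pos n with rfl | hn
    · have : w = 0 := Subsingleton.elim _ _
      rw [this] at hw; simp at hw; linarith
    refine (measure_mono (fun x hx => hx.1)).trans
      (show volume (Metric.ball (0 : Euc n) ρ) ≤ _ from ?_)
    rw [Measure.addHaar_ball_of_pos _ _ hρ,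
      ← ENNReal.ofReal_toReal (measure_ball_lt_top (μ := volume) (x := (0 : Euc n)) (r := 1)).ne,
      ← ENNReal.ofReal_mul (by positivity)]
    refine ENNReal.ofReal_le_ofReal ?_
    have h1 : (1 : ℝ) ≤ n := by exact_mod_cast hn
    have h2 : 1 ≤ ‖w‖ / ρ := by rwa [one_le_div hρ]
    rw [finrank_euclideanSpace, Fintype.card_fin]
    change ρ ^ n * volume.real (Metric.ball (0 : Euc n) 1) ≤ _
    set c := ρ ^ n * volume.real (Metric.ball (0 : Euc n) 1)
    have h3 : 0 ≤ c := by positivity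
    calc c = 1 * c * 1 := by ring
      _ ≤ _ := by gcongr
  · push Not at hw
    have hsub : {x | x ∈ Metric.ball (0 : Euc n) ρ ∧ x + w ∉ Metric.ball (0 : Euc n) ρ} ⊆
        Metric.ball 0 ρ \ Metric.ball 0 (ρ - ‖w‖) := by
      rintro x ⟨h1, h2⟩
      refine ⟨h1, fun h3 => h2 ?_⟩
      simp only [Metric.mem_ball, dist_zero_right] at h3 ⊢
      linarith [norm_add_le x w]
    refine (measure_mono hsub).trans ?_
    rw [measure_sdiff (Metric.ball_subset_ball (by linarith [norm_nonneg w]))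
      measurableSet_ball.nullMeasurableSet measure_ball_lt_top.ne,
      Measure.addHaar_ball_of_pos _ _ hρ, Measure.addHaar_ball_of_pos _ _ (sub_pos.2 hw),
      ← ENNReal.ofReal_toReal (measure_ball_lt_top (μ := volume) (x := (0 : Euc n)) (r := 1)).ne,
      ← ENNReal.ofReal_mul (by positivity), ← ENNReal.ofReal_mul (pow_nonneg (by linarith) _),
      ← ENNReal.ofReal_sub _ (mul_nonneg (pow_nonneg (by linarith) _) ENNReal.toReal_nonneg)]
    refine ENNReal.ofReal_le_ofReal ?_
    rw [finrank_euclideanSpace, Fintype.card_fin]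
    change ρ ^ n * volume.real (Metric.ball (0 : Euc n) 1) -
      (ρ - ‖w‖) ^ n * volume.real (Metric.ball (0 : Euc n) 1) ≤ _
    set c := volume.real (Metric.ball (0 : Euc n) 1)
    have hc : 0 ≤ c := measureReal_nonneg
    -- Bernoulli's inequality bounds the volume of the shell of thickness `‖w‖` linearly in `‖w‖`.
    have hb := one_add_mul_le_pow (a := -(‖w‖ / ρ)) (by
      have : ‖w‖ / ρ ≤ 1 := by rw [div_le_one hρ]; exact hw.le
      linarith) n
    have he : (ρ - ‖w‖) ^ n = ρ ^ n * (1 + -(‖w‖ / ρ)) ^ n := by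
      rw [← mul_pow]; congr 1; field_simp; ring
    rw [he]
    have hρn : 0 ≤ ρ ^ n * c := by positivity
    nlinarith

/-- The surface measure of the unit sphere. -/
def sphereConst (n : ℕ) : ℝ := n * volume.real (Metric.ball (0 : Euc n) 1)

lemma sphereConst_nonneg (n : ℕ) : 0 ≤ sphereConst n := by unfold sphereConst; positivity

/-- A discrete divergence theorem. By translation invariance, the points that arrive in `B ∩ E`
(upward jumps and pairs inside `E`) have at most the measure of `B ∩ E`, whose points jump down,
stay in `E`, or leave the ball. Cancelling the pairs inside `E` leaves upward jumps bounded by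
downward ones plus the flux through the sphere; downward jumps along `w` are upward jumps along
`-w`. -/
lemma upJump_le_upJump_neg_add {n : ℕ} {E : Set (Euc n)} (hE : MeasurableSet E) (w : Euc n) :
    upJump E 1 w ≤ upJump E 1 (-w) + ENNReal.ofReal (sphereConst n * ‖w‖) := by
  set B := Metric.ball (0 : Euc n) 1
  have hs : Measurable fun x : Euc n => x + w := measurable_id.add_const w
  set both : Set (Euc n) := {x | x ∈ B ∧ x + w ∈ B ∧ x ∈ E ∧ x + w ∈ E}
  set down : Set (Euc n) := {x | x ∈ B ∧ x + w ∈ B ∧ x ∈ E ∧ x + w ∉ E}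
  have hB : MeasurableSet B := measurableSet_ball
  have hboth : MeasurableSet both := hB.inter ((hs hB).inter (hE.inter (hs hE)))
  have hbt : volume both ≠ ∞ :=
    ((measure_mono fun x hx => hx.1).trans_lt (measure_ball_lt_top (x := (0 : Euc n)) (r := 1))).ne
  have h1 : upJump E 1 w + volume both ≤ volume (B ∩ E) := by
    rw [upJump, ← measure_union _ hboth]
    · rw [← measure_preimage_add_right volume w (B ∩ E)]
      refine measure_mono ?_
      rintro x (⟨_, h2, _, h4⟩ | ⟨_, h2, _, h4⟩) <;> exact ⟨h2, h4⟩
    · rw [Set.disjoint_left]; rintro x ⟨_, _, h3, _⟩ ⟨_, _, h4, _⟩; exact h3 h4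
  have h2 : volume (B ∩ E) ≤ (volume down + volume both) +
      volume {x | x ∈ B ∧ x + w ∉ B} := by
    refine (measure_mono ?_).trans ((measure_union_le _ _).trans
      (add_le_add_left (measure_union_le _ _) _))
    rintro x ⟨h1, h2⟩
    by_cases h3 : x + w ∈ B
    · by_cases h4 : x + w ∈ E
      · exact Or.inl (Or.inr ⟨h1, h3, h2, h4⟩)
      · exact Or.inl (Or.inl ⟨h1, h3, h2, h4⟩)
    · exact Or.inr ⟨h1, h3⟩
  have h3 : volume down ≤ upJump E 1 (-w) := by
    rw [upJump, ← measure_preimage_add_right volume w (jumpSet _ _ _)]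
    refine measure_mono ?_
    rintro x ⟨h1, h2, h3, h4⟩
    refine ⟨h2, ?_, h4, ?_⟩ <;> rwa [add_neg_cancel_right]
  have h4 := volume_ball_shift_diff_le 1 one_pos w
  have h5 : upJump E 1 w + volume both ≤
      (upJump E 1 (-w) + ENNReal.ofReal (sphereConst n * ‖w‖)) + volume both := by
    calc _ ≤ _ := h1.trans h2
      _ ≤ (upJump E 1 (-w) + volume both) + ENNReal.ofReal (sphereConst n * ‖w‖) := by
        gcongr
        simp only [one_pow, one_mul, div_one] at h4
        exact h4
      _ = _ := by ring
  exact (ENNReal.add_le_add_iff_right hbt).1 h5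

/-! ### Directional variations of sets that jump in one direction only -/

/-- For small translations, jumps along `w` or along `-w` have measure at most `δ ‖w‖`. -/
def OneSidedJumps {n : ℕ} (E : Set (Euc n)) (δ : ℝ) : Prop :=
  ∃ t₀ : ℝ, 0 < t₀ ∧ ∀ w : Euc n, ‖w‖ ≤ t₀ →
    upJump E 1 w ≤ ENNReal.ofReal (δ * ‖w‖) ∨ upJump E 1 (-w) ≤ ENNReal.ofReal (δ * ‖w‖)

lemma two_pow_mul_ofReal (k : ℕ) (c : ℝ) :
    (2 : ℝ≥0∞) ^ k * ENNReal.ofReal ((1 / 2 : ℝ) ^ k * c) = ENNReal.ofReal c := by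
  have : (2 : ℝ≥0∞) ^ k = ENNReal.ofReal (2 ^ k) := by
    rw [ENNReal.ofReal_pow (by norm_num)]; norm_num
  rw [this, ← ENNReal.ofReal_mul (by positivity), ← mul_assoc, ← mul_pow]
  norm_num

lemma upVar_le_of_frequently {n : ℕ} (E : Set (Euc n)) (v : Euc n) (c : ℝ)
    (h : ∃ᶠ k : ℕ in Filter.atTop,
      upJump E 1 ((1 / 2 : ℝ) ^ k • v) ≤ ENNReal.ofReal ((1 / 2 : ℝ) ^ k * c)) :
    upVar E v ≤ ENNReal.ofReal c := by
  refine iSup_le fun k => ?_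
  obtain ⟨l, hl, hl'⟩ := (Filter.frequently_atTop.1 h) k
  refine (monotone_upVar_aux E v hl).trans ?_
  rw [← two_pow_mul_ofReal l c]
  dsimp only
  gcongr

/-- The favourable sign may depend on the scale, but by pigeonhole one sign is favourable at
infinitely many dyadic scales. Monotonicity of the quotients makes that enough. -/
lemma OneSidedJumps.upVar {n : ℕ} {E : Set (Euc n)} {δ : ℝ} (h : OneSidedJumps E δ) (v : Euc n) :
    upVar E v ≤ ENNReal.ofReal (δ * ‖v‖) ∨ upVar E (-v) ≤ ENNReal.ofReal (δ * ‖v‖) := by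
  obtain ⟨t₀, ht₀, h⟩ := h
  have hlim : Filter.Tendsto (fun k : ℕ => (1 / 2 : ℝ) ^ k * ‖v‖) Filter.atTop (nhds 0) := by
    simpa using (tendsto_pow_atTop_nhds_zero_of_lt_one (by norm_num : (0 : ℝ) ≤ 1 / 2)
      (by norm_num)).mul_const ‖v‖
  have hev : ∀ᶠ k : ℕ in Filter.atTop,
      upJump E 1 ((1 / 2 : ℝ) ^ k • v) ≤ ENNReal.ofReal ((1 / 2 : ℝ) ^ k * (δ * ‖v‖)) ∨
      upJump E 1 ((1 / 2 : ℝ) ^ k • -v) ≤ ENNReal.ofReal ((1 / 2 : ℝ) ^ k * (δ * ‖v‖)) := by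
    filter_upwards [hlim.eventually (gt_mem_nhds ht₀)] with k hk
    have hn : ‖(1 / 2 : ℝ) ^ k • v‖ = (1 / 2 : ℝ) ^ k * ‖v‖ := by
      rw [norm_smul, Real.norm_of_nonneg (by positivity)]
    have := h ((1 / 2 : ℝ) ^ k • v) (by rw [hn]; exact hk.le)
    rw [hn, ← smul_neg] at this
    rwa [mul_left_comm]
  rcases Filter.frequently_or_distrib.1 hev.frequently with h1 | h1
  · exact Or.inl (upVar_le_of_frequently E v _ h1)
  · exact Or.inr (upVar_le_of_frequently E (-v) _ h1)

lemma upVar_le_upVar_neg_add {n : ℕ} {E : Set (Euc n)} (hE : MeasurableSet E) (v : Euc n) :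
    upVar E v ≤ upVar E (-v) + ENNReal.ofReal (sphereConst n * ‖v‖) := by
  refine iSup_le fun k => ?_
  have h1 := upJump_le_upJump_neg_add hE ((1 / 2 : ℝ) ^ k • v)
  rw [norm_smul, Real.norm_of_nonneg (by positivity), mul_left_comm] at h1
  calc _ ≤ 2 ^ k * (upJump E 1 (-((1 / 2 : ℝ) ^ k • v)) +
        ENNReal.ofReal ((1 / 2 : ℝ) ^ k * (sphereConst n * ‖v‖))) := by gcongr
    _ = 2 ^ k * upJump E 1 ((1 / 2 : ℝ) ^ k • -v) + ENNReal.ofReal (sphereConst n * ‖v‖) := by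
      rw [mul_add, two_pow_mul_ofReal, smul_neg]
    _ ≤ _ := by
      gcongr
      exact le_iSup (fun k : ℕ => 2 ^ k * upJump E 1 ((1 / 2 : ℝ) ^ k • -v)) k

/-- If the favourable sign is `-v`, the variation along `v` is larger by at most the flux through
the sphere. This linear bound in every direction yields finiteness and continuity. -/
lemma OneSidedJumps.upVar_le {n : ℕ} {E : Set (Euc n)} {δ : ℝ} (hE : MeasurableSet E) (hδ : 0 ≤ δ)
    (h : OneSidedJumps E δ) (v : Euc n) :
    _root_.upVar E v ≤ ENNReal.ofReal ((δ + sphereConst n) * ‖v‖) := by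
  have hs := sphereConst_nonneg n
  rw [add_mul, ENNReal.ofReal_add (by positivity) (by positivity)]
  rcases h.upVar v with h1 | h1
  · exact h1.trans le_self_add
  · exact (upVar_le_upVar_neg_add hE v).trans (by gcongr)

/-- The directional variation as a real number. -/
def upVarReal {n : ℕ} (E : Set (Euc n)) (v : Euc n) : ℝ := (upVar E v).toReal

/-- A subadditive function with a linear bound is Lipschitz. -/
lemma continuous_upVarReal {n : ℕ} {E : Set (Euc n)} {c : ℝ} (hc : 0 ≤ c)
    (h : ∀ v, upVar E v ≤ ENNReal.ofReal (c * ‖v‖)) : Continuous (upVarReal E) := by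
  have hfin : ∀ v, upVar E v ≠ ∞ := fun v => ((h v).trans_lt ENNReal.ofReal_lt_top).ne
  have hle : ∀ v, upVarReal E v ≤ c * ‖v‖ := fun v =>
    ENNReal.toReal_le_of_le_ofReal (by positivity) (h v)
  have hadd : ∀ v w, upVarReal E (v + w) ≤ upVarReal E v + upVarReal E w := fun v w => by
    rw [upVarReal, upVarReal, upVarReal, ← ENNReal.toReal_add (hfin v) (hfin w)]
    exact ENNReal.toReal_mono (ENNReal.add_ne_top.2 ⟨hfin v, hfin w⟩) (upVar_add_le E v w)
  have hlip : LipschitzWith c.toNNReal (upVarReal E) := by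
    refine LipschitzWith.of_le_add_mul _ fun x y => ?_
    rw [Real.coe_toNNReal _ hc, dist_eq_norm]
    have h1 := hadd y (x - y)
    rw [add_sub_cancel] at h1
    exact h1.trans (by linarith [hle (x - y)])
  exact hlip.continuous

lemma upVar_natCast_smul_le {n : ℕ} (E : Set (Euc n)) (v : Euc n) (j : ℕ) :
    upVar E ((j : ℝ) • v) ≤ j * upVar E v := by
  induction j with
  | zero => simp [upVar_zero]
  | succ j ih =>
    push_cast
    rw [add_smul, one_smul, add_mul, one_mul]
    exact (upVar_add_le E _ _).trans (by gcongr)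

lemma upVar_half_pow_smul_le {n : ℕ} (E : Set (Euc n)) (v : Euc n) (k : ℕ) :
    upVar E ((1 / 2 : ℝ) ^ k • v) ≤ (2 ^ k)⁻¹ * upVar E v := by
  induction k with
  | zero => simp
  | succ k ih =>
    rw [pow_succ', mul_smul]
    refine (upVar_half E _).trans ?_
    rw [pow_succ', ENNReal.mul_inv (by simp) (by simp), mul_assoc]
    gcongr

/-- Subadditivity and halving give the inequality for dyadic factors; continuity extends it to `a`,
the limit of `⌊a 2^k⌋ / 2^k`. -/
lemma upVar_smul_le {n : ℕ} {E : Set (Euc n)} {c : ℝ} (hc : 0 ≤ c)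
    (h : ∀ v, upVar E v ≤ ENNReal.ofReal (c * ‖v‖)) (v : Euc n) {a : ℝ} (ha : 0 ≤ a) :
    upVar E (a • v) ≤ ENNReal.ofReal a * upVar E v := by
  have hfin : ∀ v, upVar E v ≠ ∞ := fun v => ((h v).trans_lt ENNReal.ofReal_lt_top).ne
  have hcont := continuous_upVarReal hc h
  have hlim : Filter.Tendsto (fun k : ℕ => (⌊a * 2 ^ k⌋₊ : ℝ) * (1 / 2 : ℝ) ^ k) Filter.atTop
      (nhds a) := by
    have h1 : Filter.Tendsto (fun k : ℕ => (2 : ℝ) ^ k) Filter.atTop Filter.atTop :=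
      tendsto_pow_atTop_atTop_of_one_lt (by norm_num)
    refine ((tendsto_nat_floor_mul_div_atTop ha).comp h1).congr fun k => ?_
    simp [div_eq_mul_inv]
  have key : ∀ k : ℕ, upVarReal E (((⌊a * 2 ^ k⌋₊ : ℝ) * (1 / 2 : ℝ) ^ k) • v) ≤
      ((⌊a * 2 ^ k⌋₊ : ℝ) * (1 / 2 : ℝ) ^ k) * upVarReal E v := by
    intro k
    have h1 := (upVar_natCast_smul_le E ((1 / 2 : ℝ) ^ k • v) ⌊a * 2 ^ k⌋₊).trans
      (mul_le_mul_right (upVar_half_pow_smul_le E v k) _)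
    rw [smul_smul] at h1
    have h2 := ENNReal.toReal_mono (ENNReal.mul_ne_top (by simp)
      (ENNReal.mul_ne_top (by simp) (hfin v))) h1
    simpa [upVarReal, mul_assoc] using h2
  have h3 := le_of_tendsto_of_tendsto ((hcont.tendsto (a • v)).comp (hlim.smul_const v))
    (hlim.mul_const (upVarReal E v)) (Filter.Eventually.of_forall key)
  rw [← ENNReal.ofReal_toReal (hfin (a • v)), ← ENNReal.ofReal_toReal (hfin v),
    ← ENNReal.ofReal_mul ha]
  exact ENNReal.ofReal_le_ofReal h3

/-- In every subspace of dimension at least two there is a direction in which both directional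
variations are small. -/
lemma OneSidedJumps.exists_unit_mem {n : ℕ} {E : Set (Euc n)} {δ : ℝ} (hE : MeasurableSet E)
    (hδ : 0 ≤ δ) (h : OneSidedJumps E δ) (S : Submodule ℝ (Euc n))
    (hS : 1 < Module.finrank ℝ S) :
    ∃ v ∈ S, ‖v‖ = 1 ∧ _root_.upVar E v ≤ ENNReal.ofReal δ ∧
      _root_.upVar E (-v) ≤ ENNReal.ofReal δ := by
  have hcont := continuous_upVarReal (add_nonneg hδ (sphereConst_nonneg n)) (h.upVar_le hE hδ)
  have hfin : ∀ v, _root_.upVar E v ≠ ∞ := fun v =>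
    ((h.upVar_le hE hδ v).trans_lt ENNReal.ofReal_lt_top).ne
  have hconn : IsPreconnected (Metric.sphere (0 : S) 1) :=
    (isConnected_sphere (by rw [← Module.finrank_eq_rank]; exact_mod_cast hS) 0
      zero_le_one).isPreconnected
  have hne : (Metric.sphere (0 : S) 1).Nonempty :=
    (isConnected_sphere (by rw [← Module.finrank_eq_rank]; exact_mod_cast hS) 0
      zero_le_one).nonempty
  set P : Set S := {v | upVarReal E v ≤ δ}
  set N : Set S := {v | upVarReal E (-v) ≤ δ}
  have hP : IsClosed P := isClosed_le (hcont.comp continuous_subtype_val) continuous_const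
  have hN : IsClosed N :=
    isClosed_le (hcont.comp continuous_subtype_val.neg) continuous_const
  have hcov : Metric.sphere (0 : S) 1 ⊆ P ∪ N := by
    intro v hv
    have hv1 : ‖(v : Euc n)‖ = 1 := by simpa using hv
    rcases h.upVar (v : Euc n) with h1 | h1 <;> rw [hv1, mul_one] at h1
    · exact Or.inl (ENNReal.toReal_le_of_le_ofReal hδ h1)
    · exact Or.inr (ENNReal.toReal_le_of_le_ofReal hδ h1)
  have hsymm : ∀ v ∈ Metric.sphere (0 : S) 1, -v ∈ Metric.sphere (0 : S) 1 := fun v hv => by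
    simpa using hv
  have hPne : (Metric.sphere (0 : S) 1 ∩ P).Nonempty := by
    obtain ⟨v, hv⟩ := hne
    rcases hcov hv with h1 | h1
    · exact ⟨v, hv, h1⟩
    · exact ⟨-v, hsymm v hv, by simpa [P, N] using h1⟩
  have hNne : (Metric.sphere (0 : S) 1 ∩ N).Nonempty := by
    obtain ⟨v, hv, h1⟩ := hPne
    exact ⟨-v, hsymm v hv, by simpa [P, N] using h1⟩
  -- `P` and `N` are closed, cover the sphere and are exchanged by the antipodal map, so both meet
  -- it; connectedness, available in dimension at least two, forces a common point.
  obtain ⟨v, hv, h1, h2⟩ := isPreconnected_closed_iff.1 hconn P N hP hN hcov hPne hNne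
  refine ⟨v, v.2, by simpa using hv, ?_, ?_⟩
  · exact (ENNReal.le_ofReal_iff_toReal_le (hfin _) hδ).2 h1
  · exact (ENNReal.le_ofReal_iff_toReal_le (hfin _) hδ).2 h2

/-- A family of orthonormal directions in which both directional variations are small. -/
lemma OneSidedJumps.exists_orthonormal {d : ℕ} {E : Set (Euc (d + 1))} {δ : ℝ}
    (hE : MeasurableSet E) (hδ : 0 ≤ δ) (h : OneSidedJumps E δ) (k : ℕ) (hk : k ≤ d) :
    ∃ v : Fin k → Euc (d + 1), Orthonormal ℝ v ∧ ∀ i, _root_.upVar E (v i) ≤ ENNReal.ofReal δ ∧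
      _root_.upVar E (-v i) ≤ ENNReal.ofReal δ := by
  induction k with
  | zero => exact ⟨Fin.elim0, ⟨fun i => i.elim0, fun i => i.elim0⟩, fun i => i.elim0⟩
  | succ k ih =>
    obtain ⟨v, hv, hv'⟩ := ih (by omega)
    have hfr : Module.finrank ℝ (Submodule.span ℝ (range v)) = k := by
      rw [finrank_span_eq_card hv.linearIndependent, Fintype.card_fin]
    -- The complement of `k` directions has dimension `d + 1 - k`, which is at least two as long as
    -- `k + 1 ≤ d`. This is why only `d` directions are obtained.
    have hperp : 1 < Module.finrank ℝ (Submodule.span ℝ (range v))ᗮ := by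
      have := Submodule.finrank_add_finrank_orthogonal (Submodule.span ℝ (range v))
      rw [hfr, finrank_euclideanSpace, Fintype.card_fin] at this
      omega
    obtain ⟨u, hu, hu1, hu2⟩ := h.exists_unit_mem hE hδ _ hperp
    have hvu : ∀ i, inner ℝ (v i) u = 0 := fun i =>
      (Submodule.mem_orthogonal _ u).1 hu (v i) (Submodule.subset_span ⟨i, rfl⟩)
    refine ⟨Fin.snoc v u, ?_, fun i => ?_⟩
    · rw [orthonormal_iff_ite]
      have hv2 := orthonormal_iff_ite.1 hv
      intro i j
      refine Fin.lastCases ?_ (fun i => ?_) i <;> refine Fin.lastCases ?_ (fun j => ?_) j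
      · simp [hu1]
      · have : inner ℝ u (v j) = 0 := by rw [real_inner_comm]; exact hvu j
        simp [this, (Fin.castSucc_lt_last j).ne']
      · simp [hvu i, (Fin.castSucc_lt_last i).ne]
      · simpa using hv2 i j
    · refine Fin.lastCases ?_ (fun i => ?_) i
      · simpa using hu2
      · simpa using hv' i

/-! ### Rotations -/

lemma upVar_image {n : ℕ} (E : Set (Euc n)) (U : Euc n ≃ₗᵢ[ℝ] Euc n) (v : Euc n) :
    upVar (U '' E) v = upVar E (U.symm v) := by
  have hJ : ∀ w : Euc n, upJump (U '' E) 1 w = upJump E 1 (U.symm w) := by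
    intro w
    have : jumpSet (Metric.ball 0 1) (U '' E) w =
        U.symm ⁻¹' jumpSet (Metric.ball 0 1) E (U.symm w) := by
      have hmem : ∀ x, x ∈ U '' E ↔ U.symm x ∈ E := fun x => by
        rw [LinearIsometryEquiv.image_eq_preimage_symm]; rfl
      ext x
      have hball : ∀ y, y ∈ Metric.ball (0 : Euc n) 1 ↔ U.symm y ∈ Metric.ball (0 : Euc n) 1 :=
        fun y => by simp only [Metric.mem_ball, dist_zero_right, LinearIsometryEquiv.norm_map]
      change (_ ∧ _ ∧ _ ∧ _) ↔ (_ ∧ _ ∧ _ ∧ _)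
      rw [hmem, hmem, hball x, hball (x + w), map_add]
    rw [upJump, upJump, this]
    exact (U.symm.measurePreserving).measure_preimage_equiv
      (f := U.symm.toHomeomorph.toMeasurableEquiv) _
  simp only [upVar, hJ, map_smul]

/-! ### Determinants of isometries and of coordinate reflections -/

lemma LinearIsometryEquiv.abs_det_eq_one {n : ℕ} (U : Euc n ≃ₗᵢ[ℝ] Euc n) :
    |LinearMap.det (U.toLinearEquiv : Euc n →ₗ[ℝ] Euc n)| = 1 := by
  have h1 := Measure.addHaar_image_linearMap (volume : Measure (Euc n))
    (U.toLinearEquiv : Euc n →ₗ[ℝ] Euc n) (Metric.ball 0 1)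
  have h2 : (U.toLinearEquiv : Euc n →ₗ[ℝ] Euc n) '' Metric.ball 0 1 = Metric.ball 0 1 := by
    have := LinearIsometryEquiv.image_ball U 0 1
    rwa [map_zero] at this
  rw [h2] at h1
  have hpos : volume (Metric.ball (0 : Euc n) 1) ≠ 0 :=
    (Metric.measure_ball_pos volume _ one_pos).ne'
  have h3 : ENNReal.ofReal |LinearMap.det (U.toLinearEquiv : Euc n →ₗ[ℝ] Euc n)| = 1 := by
    rw [← ENNReal.mul_left_inj hpos measure_ball_lt_top.ne, ← h1, one_mul]
  simpa using h3

/-- The reflection that changes the sign of the `i`-th coordinate. -/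
def coordReflection {n : ℕ} (i : Fin n) : Euc n ≃ₗᵢ[ℝ] Euc n :=
  (Submodule.span ℝ {(EuclideanSpace.single i (1 : ℝ) : Euc n)})ᗮ.reflection

lemma coordReflection_self {n : ℕ} (i : Fin n) :
    coordReflection i (EuclideanSpace.single i 1) = -EuclideanSpace.single i 1 :=
  Submodule.reflection_orthogonalComplement_singleton_eq_neg _

lemma coordReflection_of_ne {n : ℕ} {i j : Fin n} (h : j ≠ i) :
    coordReflection i (EuclideanSpace.single j 1) = EuclideanSpace.single j 1 := by
  refine Submodule.reflection_mem_subspace_eq_self ?_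
  rw [Submodule.mem_orthogonal_singleton_iff_inner_right]
  simp [EuclideanSpace.inner_single_left, h.symm]

lemma coordReflection_symm {n : ℕ} (i : Fin n) : (coordReflection i).symm = coordReflection i :=
  Submodule.reflection_symm

lemma det_coordReflection {n : ℕ} (i : Fin n) :
    LinearMap.det ((coordReflection i).toLinearEquiv : Euc n →ₗ[ℝ] Euc n) = -1 := by
  have h1 := Submodule.det_reflection
    (K := (Submodule.span ℝ {(EuclideanSpace.single i (1 : ℝ) : Euc n)})ᗮ)
  have h2 : Module.finrank ℝ (Submodule.span ℝ {(EuclideanSpace.single i (1 : ℝ) : Euc n)})ᗮᗮ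
      = 1 := by
    rw [Submodule.orthogonal_orthogonal]
    exact finrank_span_singleton (by simp)
  rw [h2, pow_one] at h1
  exact h1

/-- After a rotation, a set whose jumps are one-sided has small directional variations, except in
the downward vertical direction. -/
lemma OneSidedJumps.exists_rotation {d : ℕ} (hd : 0 < d) {E : Set (Euc (d + 1))} {δ : ℝ}
    (hE : MeasurableSet E) (hδ : 0 ≤ δ) (h : OneSidedJumps E δ) :
    ∃ U : Euc (d + 1) ≃ₗᵢ[ℝ] Euc (d + 1),
      LinearMap.det (U.toLinearEquiv : Euc (d + 1) →ₗ[ℝ] Euc (d + 1)) = 1 ∧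
      (∀ i : Fin d,
        _root_.upVar (U '' E) (EuclideanSpace.single i.castSucc 1) ≤ ENNReal.ofReal δ ∧
        _root_.upVar (U '' E) (-EuclideanSpace.single i.castSucc 1) ≤ ENNReal.ofReal δ) ∧
      _root_.upVar (U '' E) (EuclideanSpace.single (Fin.last d) 1) ≤ ENNReal.ofReal δ := by
  obtain ⟨v, hv, hv'⟩ := h.exists_orthonormal hE hδ d le_rfl
  simp only [upVar_image]
  have hs : Orthonormal ℝ (({i | i ≠ Fin.last d} : Set (Fin (d + 1))).domRestrict
      (Fin.snoc v 0 : Fin (d + 1) → Euc (d + 1))) := by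
    have h1 : (({i | i ≠ Fin.last d} : Set (Fin (d + 1))).domRestrict
        (Fin.snoc v 0 : Fin (d + 1) → Euc (d + 1))) = v ∘ fun i => i.1.castPred i.2 := by
      ext1 ⟨i, hi⟩
      obtain ⟨j, rfl⟩ := Fin.exists_castSucc_eq.2 hi
      simp
    rw [h1]
    refine hv.comp _ fun i j hij => Subtype.ext ?_
    simpa using hij
  obtain ⟨b, hb⟩ := hs.exists_orthonormalBasis_extension_of_card_eq
    (by rw [finrank_euclideanSpace])
  have hb' : ∀ i : Fin d, b i.castSucc = v i := fun i => by
    rw [hb _ (Fin.castSucc_lt_last i).ne]; simp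
  obtain ⟨U₁, hU₁, hU₁'⟩ : ∃ U : Euc (d + 1) ≃ₗᵢ[ℝ] Euc (d + 1),
      (∀ i : Fin d, _root_.upVar E (U.symm (EuclideanSpace.single i.castSucc 1)) ≤
          ENNReal.ofReal δ ∧
        _root_.upVar E (U.symm (-EuclideanSpace.single i.castSucc 1)) ≤ ENNReal.ofReal δ) ∧
      _root_.upVar E (U.symm (EuclideanSpace.single (Fin.last d) 1)) ≤ ENNReal.ofReal δ := by
    have h0 : ∀ i : Fin d, b.repr.symm (EuclideanSpace.single i.castSucc 1) = v i := fun i => by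
      rw [b.repr_symm_single, hb']
    have hl := h.upVar (b (Fin.last d))
    rw [b.norm_eq_one, mul_one] at hl
    -- Along the last axis only one sign is known to be good; if it is the downward one, the axis is
    -- flipped.
    rcases hl with hl | hl
    · refine ⟨b.repr, fun i => ?_, ?_⟩
      · rw [map_neg, h0]; exact hv' i
      · rwa [b.repr_symm_single]
    · refine ⟨b.repr.trans (coordReflection (Fin.last d)), fun i => ?_, ?_⟩
      · simp only [LinearIsometryEquiv.symm_trans, LinearIsometryEquiv.trans_apply, map_neg,
          coordReflection_symm, coordReflection_of_ne (Fin.castSucc_lt_last i).ne, h0]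
        exact hv' i
      · simp only [LinearIsometryEquiv.symm_trans, LinearIsometryEquiv.trans_apply,
          coordReflection_symm, coordReflection_self, map_neg, b.repr_symm_single]
        exact hl
  rcases (abs_eq zero_le_one).1 (LinearIsometryEquiv.abs_det_eq_one U₁) with hdet | hdet
  · exact ⟨U₁, hdet, hU₁, hU₁'⟩
  -- The orientation is repaired by reflecting a horizontal coordinate, which exists because `d >
  -- 0`. The horizontal bounds hold for both signs, so they survive.
  · set i₀ : Fin (d + 1) := (⟨0, hd⟩ : Fin d).castSucc
    refine ⟨U₁.trans (coordReflection i₀), ?_, fun i => ?_, ?_⟩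
    · have : ((U₁.trans (coordReflection i₀)).toLinearEquiv : Euc (d + 1) →ₗ[ℝ] Euc (d + 1)) =
          ((coordReflection i₀).toLinearEquiv : Euc (d + 1) →ₗ[ℝ] Euc (d + 1)) ∘ₗ
          (U₁.toLinearEquiv : Euc (d + 1) →ₗ[ℝ] Euc (d + 1)) := rfl
      rw [this, LinearMap.det_comp, det_coordReflection, hdet]
      norm_num
    · simp only [LinearIsometryEquiv.symm_trans, LinearIsometryEquiv.trans_apply, map_neg,
        coordReflection_symm]
      have hi := hU₁ i
      rw [map_neg] at hi
      by_cases hi0 : i.castSucc = i₀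
      · rw [hi0, coordReflection_self, map_neg, neg_neg]
        rw [hi0] at hi
        exact hi.symm
      · rw [coordReflection_of_ne hi0]
        exact hi
    · simp only [LinearIsometryEquiv.symm_trans, LinearIsometryEquiv.trans_apply,
        coordReflection_symm]
      rw [coordReflection_of_ne (Fin.castSucc_lt_last _).ne']
      exact hU₁'

/-! ### Sets with few upward jumps on the line -/

/-- Along `x, x + τ, x + 2τ, …` the first term that lies in `A` is reached by an elementary jump of
length `τ`. As `x` ranges over a window of length `τ`, the elementary jumps with different indices
occupy disjoint windows, so their measures add up to at most that of the full jump set. -/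
lemma volume_jumpSet_mul_inter_Ico_le {I A : Set ℝ} (hI : Convex ℝ I) (hIm : MeasurableSet I)
    (hA : MeasurableSet A) (τ : ℝ) (hτ : 0 < τ) (a : ℝ) (k : ℕ) :
    volume (jumpSet I A (k * τ) ∩ Ico a (a + τ)) ≤ volume (jumpSet I A τ) := by
  set T : ℕ → Set ℝ := fun j => jumpSet I A τ ∩ Ico (a + j * τ) (a + (j + 1) * τ)
  have hsub : jumpSet I A (k * τ) ∩ Ico a (a + τ) ⊆
      ⋃ j ∈ Finset.range k, (fun x => x + j * τ) ⁻¹' T j := by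
    rintro x ⟨⟨hx, hxk, hxA, hxkA⟩, hxa, hxτ⟩
    have hmem : ∀ j ≤ k, x + j * τ ∈ I := fun j hj => by
      have hjk : (j : ℝ) * τ ≤ k * τ := by gcongr
      exact hI.ordConnected.out hx hxk ⟨by nlinarith [(Nat.cast_nonneg j : (0 : ℝ) ≤ j)],
        by linarith⟩
    have hex : ∃ j : ℕ, x + j * τ ∈ A := ⟨k, hxkA⟩
    classical
    have hspec := Nat.find_spec hex
    have hmin := fun j => Nat.find_min hex (m := j)
    have hle := Nat.find_min' hex hxkA
    set m := Nat.find hex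
    have hm0 : m ≠ 0 := by
      intro h0
      rw [h0] at hspec
      simp at hspec
      exact hxA hspec
    obtain ⟨j, hj⟩ := Nat.exists_eq_succ_of_ne_zero hm0
    have e1 : x + (j : ℝ) * τ + τ = x + (m : ℝ) * τ := by rw [hj]; push_cast; ring
    refine mem_iUnion₂.2 ⟨j, Finset.mem_range.2 (by omega), ⟨⟨hmem j (by omega), ?_, hmin j (by omega),
      ?_⟩, ?_, ?_⟩⟩
    · rw [e1]; exact hmem m hle
    · rw [e1]; exact hspec
    · dsimp only; linarith
    · dsimp only; linarith
  have hTm : ∀ j, MeasurableSet (T j) := fun j => (measurableSet_jumpSet hIm hA τ).inter measurableSet_Ico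
  calc _ ≤ ∑ j ∈ Finset.range k, volume ((fun x => x + j * τ) ⁻¹' T j) :=
        (measure_mono hsub).trans (measure_biUnion_finset_le _ _)
    _ = ∑ j ∈ Finset.range k, volume (T j) := by
        refine Finset.sum_congr rfl fun j _ => ?_
        rw [measure_preimage_add_right]
    _ = volume (⋃ j ∈ Finset.range k, T j) := by
        rw [measure_biUnion_finset _ fun j _ => hTm j]
        intro i _ j _ hij
        refine Set.disjoint_left.2 ?_
        rintro x ⟨_, h1, h2⟩ ⟨_, h3, h4⟩
        rcases lt_or_gt_of_ne hij with h | h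
        · have : (i : ℝ) + 1 ≤ j := by exact_mod_cast h
          nlinarith
        · have : (j : ℝ) + 1 ≤ i := by exact_mod_cast h
          nlinarith
    _ ≤ _ := measure_mono (iUnion₂_subset fun j _ => inter_subset_left)

/-- Lebesgue density: almost every point of `P` is a density point of `P`. -/
lemma eventually_volume_closedBall_sdiff_le (P : Set ℝ) (hP : MeasurableSet P) (hP0 : volume P ≠ 0)
    {η : ℝ} (hη : 0 < η) : ∃ x ∈ P, ∀ᶠ r in nhdsWithin (0 : ℝ) (Ioi 0),
      volume (Metric.closedBall x r \ P) ≤ ENNReal.ofReal (η * r) := by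
  have h2 := Besicovitch.ae_tendsto_measure_inter_div_of_measurableSet (volume : Measure ℝ) hP.compl
  have hne : (volume.restrict P) ≠ 0 := by rwa [Ne, Measure.restrict_eq_zero]
  have : (ae (volume.restrict P)).NeBot := ae_neBot.2 hne
  obtain ⟨x, hx, hxP⟩ := ((ae_restrict_of_ae h2).and (ae_restrict_mem hP)).exists
  refine ⟨x, hxP, ?_⟩
  have hx0 : (Pᶜ).indicator (1 : ℝ → ℝ≥0∞) x = 0 := by simp [hxP]
  rw [hx0] at hx
  have hpos : (0 : ℝ≥0∞) < ENNReal.ofReal (η / 2) := by simpa using hη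
  filter_upwards [hx.eventually (gt_mem_nhds hpos), self_mem_nhdsWithin] with r hr hr0
  rw [Real.volume_closedBall] at hr
  have hr0' : (0 : ℝ) < r := hr0
  rw [ENNReal.div_lt_iff (Or.inl (by simpa using hr0')) (Or.inl ENNReal.ofReal_ne_top),
    ← ENNReal.ofReal_mul (by positivity)] at hr
  have he : Metric.closedBall x r \ P = Pᶜ ∩ Metric.closedBall x r := by
    ext; simp [and_comm]
  rw [he]
  refine hr.le.trans_eq ?_
  congr 1; ring

/-- A subset of an interval whose upward jumps have total variation less than one is, up to null
sets, an initial segment. -/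
lemma null_or_null_of_volume_jumpSet_le {I A : Set ℝ} (hI : Convex ℝ I) (hIm : MeasurableSet I)
    (hA : MeasurableSet A) {N : ℝ} (hN0 : 0 ≤ N) (hN : N < 1) (hjump : ∀ m : ℕ,
      volume (jumpSet I A ((1 / 2 : ℝ) ^ m)) ≤ ENNReal.ofReal (N * (1 / 2 : ℝ) ^ m)) (c : ℝ) :
    volume (I ∩ Aᶜ ∩ Iio c) = 0 ∨ volume (I ∩ A ∩ Ioi c) = 0 := by
  by_contra! hcon
  obtain ⟨hP, hS⟩ := hcon
  set P := I ∩ Aᶜ ∩ Iio c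
  set S := I ∩ A ∩ Ioi c
  have hPm : MeasurableSet P := (hIm.inter hA.compl).inter measurableSet_Iio
  have hSm : MeasurableSet S := (hIm.inter hA).inter measurableSet_Ioi
  -- Near density points `x₀` of `P` and `y₀` of `S`, most `x` in a window of length `τ` lie in `P`
  -- with `x + k τ` in `S`, hence jump upward. The window is thus covered by sets of total measure
  -- `(N + 2η) τ`, and `N + 2η = (1 + N) / 2 < 1`.
  have hη : 0 < (1 - N) / 4 := by linarith
  obtain ⟨x₀, hxP, hx₀⟩ := eventually_volume_closedBall_sdiff_le P hPm hP hη
  obtain ⟨y₀, hyS, hy₀⟩ := eventually_volume_closedBall_sdiff_le S hSm hS hη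
  have hlim : Filter.Tendsto (fun m : ℕ => (1 / 2 : ℝ) ^ m) Filter.atTop
      (nhdsWithin (0 : ℝ) (Ioi 0)) := by
    refine tendsto_nhdsWithin_iff.2 ⟨tendsto_pow_atTop_nhds_zero_of_lt_one (by norm_num)
      (by norm_num), Filter.Eventually.of_forall fun m => ?_⟩
    simp
  obtain ⟨m, hmx, hmy⟩ := (hlim.eventually (hx₀.and hy₀)).exists
  have hjump := hjump m
  set τ := (1 / 2 : ℝ) ^ m
  have hτ : 0 < τ := by positivity
  have hxy : x₀ ≤ y₀ := (lt_trans hxP.2 hyS.2).le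
  -- Rounding down keeps `x + k τ` within `τ` of `y₀` for every `x` in `[x₀, x₀ + τ)`.
  set k := ⌊(y₀ - x₀) / τ⌋₊
  have hk1 : k * τ ≤ y₀ - x₀ :=
    (le_div_iff₀ hτ).1 (Nat.floor_le (div_nonneg (sub_nonneg.2 hxy) hτ.le))
  have hk2 : y₀ - x₀ < (k + 1) * τ := (div_lt_iff₀ hτ).1 (Nat.lt_floor_add_one _)
  have hcov : Ico x₀ (x₀ + τ) ⊆ (jumpSet I A (k * τ) ∩ Ico x₀ (x₀ + τ)) ∪
      ((Metric.closedBall x₀ τ \ P) ∪ (fun x => x + k * τ) ⁻¹' (Metric.closedBall y₀ τ \ S)) := by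
    intro x hx
    by_cases h1 : x ∈ P
    · by_cases h2 : x + k * τ ∈ S
      · exact Or.inl ⟨⟨h1.1.1, h2.1.1, h1.1.2, h2.1.2⟩, hx⟩
      · refine Or.inr (Or.inr ⟨?_, h2⟩)
        rw [Real.closedBall_eq_Icc]
        constructor <;> linarith [hx.1, hx.2]
    · refine Or.inr (Or.inl ⟨?_, h1⟩)
      rw [Real.closedBall_eq_Icc]
      constructor <;> linarith [hx.1, hx.2]
  have h1 := (measure_mono hcov).trans ((measure_union_le _ _).trans (add_le_add
    (volume_jumpSet_mul_inter_Ico_le hI hIm hA τ hτ x₀ k) (measure_union_le _ _)))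
  rw [measure_preimage_add_right, Real.volume_Ico] at h1
  have h2 := h1.trans (add_le_add hjump (add_le_add hmx hmy))
  rw [← ENNReal.ofReal_add (by positivity) (by positivity),
    ← ENNReal.ofReal_add (by positivity) (by positivity),
    ENNReal.ofReal_le_ofReal_iff (by positivity)] at h2
  nlinarith

/-- A subset of a bounded interval whose upward jumps have total variation less than one is, up
to null sets, the initial segment with the same measure. -/
lemma ae_mem_iff_le_of_volume_jumpSet_le {A : Set ℝ} (hA : MeasurableSet A) {h : ℝ} (hh : 0 ≤ h)
    {N : ℝ} (hN0 : 0 ≤ N) (hN : N < 1) (hjump : ∀ m : ℕ,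
      volume (jumpSet (Ioo (-h) h) A ((1 / 2 : ℝ) ^ m)) ≤ ENNReal.ofReal (N * (1 / 2 : ℝ) ^ m)) :
    ∀ᵐ s : ℝ, s ∈ Ioo (-h) h → (s ∈ A ↔ s ≤ -h + volume.real (Ioo (-h) h ∩ A)) := by
  set I := Ioo (-h) h
  set g := -h + volume.real (I ∩ A)
  have hIA : volume (I ∩ A) ≠ ∞ := (measure_mono inter_subset_left).trans_lt
    (by rw [Real.volume_Ioo]; exact ENNReal.ofReal_lt_top) |>.ne
  have hgl : -h ≤ g := by
    have : 0 ≤ volume.real (I ∩ A) := measureReal_nonneg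
    linarith
  have hgh : g ≤ h := by
    have h1 : volume.real (I ∩ A) ≤ volume.real I := measureReal_mono inter_subset_left
      (by rw [Real.volume_Ioo]; exact ENNReal.ofReal_ne_top)
    rw [Real.volume_real_Ioo_of_le (by linarith)] at h1
    linarith
  have hvol : volume (I ∩ A) = ENNReal.ofReal (g + h) := by
    rw [← ENNReal.ofReal_toReal hIA]
    congr 1
    change volume.real (I ∩ A) = g + h
    simp only [g]; ring
  have hvol2 : volume (I ∩ Iio g) = ENNReal.ofReal (g + h) := by
    have : I ∩ Iio g = Ioo (-h) g := by
      ext x; simp only [I, mem_inter_iff, mem_Ioo, mem_Iio]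
      exact ⟨fun hx => ⟨hx.1.1, hx.2⟩, fun hx => ⟨⟨hx.1, by linarith [hx.2]⟩, hx.2⟩⟩
    rw [this, Real.volume_Ioo]; congr 1; ring
  have hfin : volume (I ∩ A ∩ Iio g) ≠ ∞ := ((measure_mono inter_subset_left).trans_lt
    (lt_top_iff_ne_top.2 hIA)).ne
  -- The height `g` is chosen so that `I ∩ A` and `I ∩ Iio g` have equal measure. Hence the part of
  -- `A` above `g` and the part of the complement below `g` have the same measure, and the dichotomy
  -- makes both null.
  have hnull : volume (I ∩ Aᶜ ∩ Iio g) = 0 ∧ volume (I ∩ A ∩ Ioi g) = 0 := by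
    have e1 : volume (I ∩ A) = volume (I ∩ A ∩ Iio g) + volume (I ∩ A ∩ Ioi g) := by
      rw [← measure_inter_add_sdiff (I ∩ A) (measurableSet_Iio (a := g))]
      congr 1
      refine measure_congr ?_
      have : (I ∩ A) \ Iio g = I ∩ A ∩ Ici g := by ext; simp
      rw [this]
      exact (Filter.EventuallyEq.refl _ _).inter Ioi_ae_eq_Ici.symm
    have e2 : volume (I ∩ Iio g) = volume (I ∩ A ∩ Iio g) + volume (I ∩ Aᶜ ∩ Iio g) := by
      rw [← measure_inter_add_sdiff (I ∩ Iio g) hA]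
      congr 2 <;> ext x <;> simp only [mem_inter_iff, mem_sdiff, mem_compl_iff] <;> tauto
    have e3 : volume (I ∩ A ∩ Ioi g) = volume (I ∩ Aᶜ ∩ Iio g) := by
      have e4 : volume (I ∩ A ∩ Iio g) + volume (I ∩ A ∩ Ioi g) =
        volume (I ∩ A ∩ Iio g) + volume (I ∩ Aᶜ ∩ Iio g) := by rw [← e1, ← e2, hvol, hvol2]
      exact (ENNReal.add_right_inj hfin).1 e4
    rcases null_or_null_of_volume_jumpSet_le (convex_Ioo _ _) measurableSet_Ioo hA hN0 hN hjump g
      with h1 | h1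
    · exact ⟨h1, e3.trans h1⟩
    · exact ⟨e3.symm.trans h1, h1⟩
  have hpt : ∀ᵐ s : ℝ, s ≠ g := by simp [ae_iff]
  filter_upwards [measure_eq_zero_iff_ae_notMem.1 hnull.1,
    measure_eq_zero_iff_ae_notMem.1 hnull.2, hpt] with s h1 h2 h3 hs
  constructor
  · intro hsA
    by_contra! hlt
    exact h2 ⟨⟨hs, hsA⟩, hlt⟩
  · intro hle
    by_contra hsA
    exact h1 ⟨⟨hs, hsA⟩, lt_of_le_of_ne hle h3⟩

/-! ### Horizontal and vertical coordinates -/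

/-- The point with horizontal part `y` and vertical part `s`. -/
def join {d : ℕ} (y : Euc d) (s : ℝ) : Euc (d + 1) :=
  WithLp.toLp 2 (Fin.snoc (fun i => y i) s : Fin (d + 1) → ℝ)

/-- The splitting of a point into its horizontal and vertical parts. -/
def splitEquiv (d : ℕ) : Euc (d + 1) ≃ᵐ Euc d × ℝ :=
  (((MeasurableEquiv.toLp 2 (Fin (d + 1) → ℝ)).symm.trans
    (MeasurableEquiv.piFinSuccAbove (fun _ => ℝ) (Fin.last d))).trans
    ((MeasurableEquiv.refl ℝ).prodCongr (MeasurableEquiv.toLp 2 (Fin d → ℝ)))).trans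
    MeasurableEquiv.prodComm

lemma splitEquiv_apply {d : ℕ} (x : Euc (d + 1)) : splitEquiv d x = (horiz x, vert x) := by
  refine Prod.ext ?_ rfl
  ext i
  change x ((Fin.last d).succAbove i) = x i.castSucc
  rw [Fin.succAbove_last]

@[simp] lemma horiz_join {d : ℕ} (y : Euc d) (s : ℝ) : horiz (join y s) = y := by
  ext i; simp [horiz, join]

@[simp] lemma vert_join {d : ℕ} (y : Euc d) (s : ℝ) : vert (join y s) = s := by
  simp [vert, join]

lemma splitEquiv_symm_apply {d : ℕ} (y : Euc d) (s : ℝ) : (splitEquiv d).symm (y, s) = join y s := by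
  rw [MeasurableEquiv.symm_apply_eq, splitEquiv_apply]; simp

@[simp] lemma join_horiz_vert {d : ℕ} (x : Euc (d + 1)) : join (horiz x) (vert x) = x := by
  rw [← splitEquiv_symm_apply, ← splitEquiv_apply, MeasurableEquiv.symm_apply_apply]

lemma measurable_join {d : ℕ} : Measurable fun p : Euc d × ℝ => join p.1 p.2 := by
  have : (fun p : Euc d × ℝ => join p.1 p.2) = (splitEquiv d).symm := by
    ext1 p; rw [← splitEquiv_symm_apply]
  rw [this]; exact (splitEquiv d).symm.measurable

lemma volume_preserving_splitEquiv (d : ℕ) : MeasurePreserving (splitEquiv d) := by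
  have h1 := (PiLp.volume_preserving_ofLp (Fin (d + 1)))
  have h2 := volume_preserving_piFinSuccAbove (fun _ : Fin (d + 1) => ℝ) (Fin.last d)
  have h3 := (MeasurePreserving.id (volume : Measure ℝ)).prod (PiLp.volume_preserving_toLp (Fin d))
  have h4 := Measure.measurePreserving_swap (μ := (volume : Measure ℝ))
    (ν := (volume : Measure (Euc d)))
  exact h4.comp (h3.comp (h2.comp h1))

lemma volume_preserving_join (d : ℕ) :
    MeasurePreserving (fun p : Euc d × ℝ => join p.1 p.2) := by
  have : (fun p : Euc d × ℝ => join p.1 p.2) = (splitEquiv d).symm := by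
    ext1 p; rw [← splitEquiv_symm_apply]
  rw [this]; exact (volume_preserving_splitEquiv d).symm

lemma volume_eq_lintegral_column {d : ℕ} {A : Set (Euc (d + 1))} (hA : MeasurableSet A) :
    volume A = ∫⁻ y : Euc d, volume {s | join y s ∈ A} := by
  rw [← (volume_preserving_join d).measure_preimage hA.nullMeasurableSet]
  exact Measure.prod_apply (measurable_join hA)

lemma volume_eq_lintegral_slice {d : ℕ} {A : Set (Euc (d + 1))} (hA : MeasurableSet A) :
    volume A = ∫⁻ s : ℝ, volume {y : Euc d | join y s ∈ A} := by
  rw [← (volume_preserving_join d).measure_preimage hA.nullMeasurableSet]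
  exact Measure.prod_apply_symm (measurable_join hA)

lemma norm_sq_join {d : ℕ} (y : Euc d) (s : ℝ) : ‖join y s‖ ^ 2 = ‖y‖ ^ 2 + s ^ 2 := by
  rw [EuclideanSpace.norm_sq_eq, EuclideanSpace.norm_sq_eq, Fin.sum_univ_castSucc]
  simp [join]

lemma join_mem_ball_iff {d : ℕ} (y : Euc d) (s : ℝ) :
    join y s ∈ Metric.ball (0 : Euc (d + 1)) 1 ↔ ‖y‖ ^ 2 + s ^ 2 < 1 := by
  rw [Metric.mem_ball, dist_zero_right, ← norm_sq_join]
  constructor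
  · intro h; nlinarith [norm_nonneg (join y s)]
  · intro h; nlinarith [norm_nonneg (join y s)]

/-- Half the length of the vertical chord of the unit ball above the point `y`. -/
def chord {V : Type*} [Norm V] (y : V) : ℝ := √(1 - ‖y‖ ^ 2)

lemma chord_nonneg {V : Type*} [Norm V] (y : V) : 0 ≤ chord y := Real.sqrt_nonneg _

lemma chord_le_one {V : Type*} [Norm V] (y : V) : chord y ≤ 1 :=
  Real.sqrt_le_one.2 (by nlinarith [sq_nonneg ‖y‖])

/-- No restriction on `y` is needed: outside the unit ball the real square root takes the value 0
and both conditions fail. -/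
lemma join_mem_ball_iff_mem_Ioo {d : ℕ} (y : Euc d) (s : ℝ) :
    join y s ∈ Metric.ball (0 : Euc (d + 1)) 1 ↔ s ∈ Ioo (-chord y) (chord y) := by
  rw [join_mem_ball_iff, mem_Ioo, ← abs_lt, chord, Real.lt_sqrt (abs_nonneg s), sq_abs]
  constructor <;> intro h <;> linarith

lemma join_mem_ball_iff_mem_ball {d : ℕ} (y : Euc d) (s : ℝ) :
    join y s ∈ Metric.ball (0 : Euc (d + 1)) 1 ↔ y ∈ Metric.ball (0 : Euc d) (chord s) := by
  rw [join_mem_ball_iff, Metric.mem_ball, dist_zero_right, chord, Real.lt_sqrt (norm_nonneg y),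
    Real.norm_eq_abs, sq_abs]
  constructor <;> intro h <;> linarith

lemma join_add_join {d : ℕ} (y z : Euc d) (s t : ℝ) :
    join y s + join z t = join (y + z) (s + t) := by
  ext i
  refine Fin.lastCases ?_ (fun i => ?_) i <;> simp [join]

lemma smul_join {d : ℕ} (a : ℝ) (y : Euc d) (s : ℝ) : a • join y s = join (a • y) (a * s) := by
  ext i
  refine Fin.lastCases ?_ (fun i => ?_) i <;> simp [join]

lemma single_last_eq_join (d : ℕ) :
    (EuclideanSpace.single (Fin.last d) 1 : Euc (d + 1)) = join 0 1 := by
  ext i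
  refine Fin.lastCases ?_ (fun i => ?_) i
  · simp [join]
  · simp [join, (Fin.castSucc_lt_last i).ne]

/-! ### Vertical columns -/

/-- The column of `E` above the point `y`. -/
def column {d : ℕ} (E : Set (Euc (d + 1))) (y : Euc d) : Set ℝ := {s | join y s ∈ E}

/-- The upward variation of `E` along the vertical chord of the unit ball above `y`. -/
def columnVar {d : ℕ} (E : Set (Euc (d + 1))) (y : Euc d) : ℝ≥0∞ :=
  ⨆ k : ℕ, 2 ^ k * volume (jumpSet (Ioo (-chord y) (chord y)) (column E y) ((1 / 2 : ℝ) ^ k))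

/-- The columns that are not initial segments. -/
def badColumns {d : ℕ} (E : Set (Euc (d + 1))) : Set (Euc d) := {y | 1 ≤ columnVar E y}

/-- The height of the column of `E ∩ B₁` above `y`. -/
def columnHeight {d : ℕ} (E : Set (Euc (d + 1))) (y : Euc d) : ℝ :=
  -chord y + volume.real (Ioo (-chord y) (chord y) ∩ column E y)

lemma jumpSet_column {d : ℕ} (E : Set (Euc (d + 1))) (y : Euc d) (t : ℝ) :
    jumpSet (Ioo (-chord y) (chord y)) (column E y) t =
      {s | join y s ∈ jumpSet (Metric.ball 0 1) E (t • join 0 1)} := by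
  ext s
  change (_ ∧ _ ∧ _ ∧ _) ↔ (_ ∧ _ ∧ _ ∧ _)
  rw [smul_join, join_add_join, smul_zero, add_zero, mul_one, join_mem_ball_iff_mem_Ioo,
    join_mem_ball_iff_mem_Ioo]
  rfl

lemma measurable_volume_column {d : ℕ} {A : Set (Euc (d + 1))} (hA : MeasurableSet A) :
    Measurable fun y : Euc d => volume {s | join y s ∈ A} :=
  measurable_measure_prodMk_left (measurable_join hA)

lemma measurable_columnVar {d : ℕ} {E : Set (Euc (d + 1))} (hE : MeasurableSet E) :
    Measurable (columnVar E) := by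
  refine Measurable.iSup fun k => Measurable.const_mul ?_ _
  simp only [jumpSet_column]
  exact measurable_volume_column (measurableSet_jumpSet measurableSet_ball hE _)

/-- Tonelli at each dyadic scale; monotone convergence exchanges the supremum with the integral
because the quotients increase. -/
lemma lintegral_columnVar {d : ℕ} {E : Set (Euc (d + 1))} (hE : MeasurableSet E) :
    ∫⁻ y, columnVar E y = upVar E (EuclideanSpace.single (Fin.last d) 1) := by
  have hm : ∀ t : ℝ, Measurable fun y : Euc d =>
      volume (jumpSet (Ioo (-chord y) (chord y)) (column E y) t) := fun t => by
    simp only [jumpSet_column]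
    exact measurable_volume_column (measurableSet_jumpSet measurableSet_ball hE _)
  unfold columnVar
  rw [lintegral_iSup (fun k => (hm _).const_mul _)]
  · unfold upVar
    congr 1; ext1 k
    rw [lintegral_const_mul _ (hm _), upJump, single_last_eq_join,
      volume_eq_lintegral_column (measurableSet_jumpSet measurableSet_ball hE _)]
    simp only [jumpSet_column]
  · intro k l hkl y
    have := monotone_two_pow_mul_measure_jumpSet volume
      (convex_Ioo (-chord y) (chord y)) (column E y) (1 : ℝ) hkl
    simpa only [smul_eq_mul, mul_one] using this

lemma measurableSet_badColumns {d : ℕ} {E : Set (Euc (d + 1))} (hE : MeasurableSet E) :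
    MeasurableSet (badColumns E) :=
  measurableSet_le measurable_const (measurable_columnVar hE)

/-- Chebyshev's inequality at level 1, the threshold at which the one-dimensional rigidity fails. -/
lemma volume_badColumns_le {d : ℕ} {E : Set (Euc (d + 1))} (hE : MeasurableSet E) :
    volume (badColumns E) ≤ upVar E (EuclideanSpace.single (Fin.last d) 1) := by
  rw [← lintegral_columnVar hE]
  have := mul_meas_ge_le_lintegral (μ := volume) (measurable_columnVar hE) 1
  rwa [one_mul] at this

lemma badColumns_subset {d : ℕ} (E : Set (Euc (d + 1))) :
    badColumns E ⊆ Metric.closedBall 0 1 := by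
  intro y hy
  by_contra hy'
  have h1 : 1 < ‖y‖ := by simpa using hy'
  have h2 : chord y = 0 := Real.sqrt_eq_zero_of_nonpos (by nlinarith)
  have h3 : columnVar E y = 0 := by
    simp [columnVar, h2, jumpSet]
  change 1 ≤ columnVar E y at hy
  rw [h3] at hy
  simp at hy

lemma measurableSet_column {d : ℕ} {E : Set (Euc (d + 1))} (hE : MeasurableSet E) (y : Euc d) :
    MeasurableSet (column E y) :=
  (measurable_join.comp measurable_prodMk_left) hE

lemma ae_mem_column_iff {d : ℕ} {E : Set (Euc (d + 1))} (hE : MeasurableSet E) {y : Euc d}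
    (hy : y ∉ badColumns E) :
    ∀ᵐ s : ℝ, join y s ∈ Metric.ball (0 : Euc (d + 1)) 1 →
      (join y s ∈ E ↔ s ≤ columnHeight E y) := by
  have hlt : columnVar E y < 1 := not_le.1 hy
  have hne : columnVar E y ≠ ∞ := (hlt.trans ENNReal.one_lt_top).ne
  have := ae_mem_iff_le_of_volume_jumpSet_le (measurableSet_column hE y) (chord_nonneg y)
    ENNReal.toReal_nonneg ((ENNReal.toReal_lt_of_lt_ofReal (by simpa using hlt)) :
      (columnVar E y).toReal < 1) fun m => by
      have h1 : 2 ^ m * volume (jumpSet (Ioo (-chord y) (chord y)) (column E y) ((1 / 2 : ℝ) ^ m))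
          ≤ 2 ^ m * ENNReal.ofReal ((1 / 2 : ℝ) ^ m * (columnVar E y).toReal) := by
        rw [two_pow_mul_ofReal, ENNReal.ofReal_toReal hne]
        exact le_iSup (fun k : ℕ => 2 ^ k * volume
          (jumpSet (Ioo (-chord y) (chord y)) (column E y) ((1 / 2 : ℝ) ^ k))) m
      rw [mul_comm]
      exact (ENNReal.mul_le_mul_iff_right (by simp) (by simp)).1 h1
  filter_upwards [this] with s hs hball
  exact hs ((join_mem_ball_iff_mem_Ioo y s).1 hball)

lemma measurable_columnHeight {d : ℕ} {E : Set (Euc (d + 1))} (hE : MeasurableSet E) :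
    Measurable (columnHeight E) := by
  have hc : Measurable fun y : Euc d => chord y := by
    unfold chord
    exact (measurable_const.sub (measurable_norm.pow_const 2)).sqrt
  refine hc.neg.add (Measurable.ennreal_toReal ?_)
  have : (fun y : Euc d => volume (Ioo (-chord y) (chord y) ∩ column E y)) =
      fun y => volume {s | join y s ∈ Metric.ball 0 1 ∩ E} := by
    ext1 y; congr 1; ext s
    rw [mem_inter_iff, ← join_mem_ball_iff_mem_Ioo]; rfl
  rw [this]
  exact measurable_volume_column (measurableSet_ball.inter hE)

lemma columnHeight_mem_Icc {d : ℕ} (E : Set (Euc (d + 1))) (y : Euc d) :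
    columnHeight E y ∈ Icc (-1 : ℝ) 1 := by
  have h1 : volume.real (Ioo (-chord y) (chord y) ∩ column E y) ≤ 2 * chord y := by
    refine (measureReal_mono inter_subset_left (by simp)).trans_eq ?_
    rw [Real.volume_real_Ioo_of_le (by linarith [chord_nonneg y])]; ring
  have h2 : 0 ≤ volume.real (Ioo (-chord y) (chord y) ∩ column E y) := measureReal_nonneg
  constructor <;> unfold columnHeight <;> linarith [chord_le_one y]

lemma ae_of_ae_column {d : ℕ} {p : Euc (d + 1) → Prop} (hp : MeasurableSet {x | p x})
    (h : ∀ᵐ y : Euc d, ∀ᵐ s : ℝ, p (join y s)) : ∀ᵐ x, p x := by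
  rw [ae_iff, show {x | ¬p x} = {x | p x}ᶜ from rfl, volume_eq_lintegral_column hp.compl,
    lintegral_eq_zero_iff (measurable_volume_column hp.compl)]
  filter_upwards [h] with y hy
  exact ae_iff.1 hy

lemma ae_mem_iff_vert_le {d : ℕ} {E : Set (Euc (d + 1))} (hE : MeasurableSet E) :
    ∀ᵐ x : Euc (d + 1), horiz x ∉ badColumns E → x ∈ Metric.ball (0 : Euc (d + 1)) 1 →
      (x ∈ E ↔ vert x ≤ columnHeight E (horiz x)) := by
  have hh : Measurable (fun x : Euc (d + 1) => (horiz x, vert x)) := by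
    have := (splitEquiv d).measurable
    simpa only [funext splitEquiv_apply] using this
  have hle : MeasurableSet {x : Euc (d + 1) | vert x ≤ columnHeight E (horiz x)} :=
    measurableSet_le (measurable_snd.comp hh) ((measurable_columnHeight hE).comp
      (measurable_fst.comp hh))
  refine ae_of_ae_column ?_ (Filter.Eventually.of_forall fun y => ?_)
  · have h1 : MeasurableSet {x : Euc (d + 1) | horiz x ∈ badColumns E} :=
      (measurable_fst.comp hh) (measurableSet_badColumns hE)
    exact (h1.compl.imp (measurableSet_ball.imp (hE.iff hle)))
  · by_cases hy : y ∈ badColumns E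
    · simp [hy]
    · filter_upwards [ae_mem_column_iff hE hy] with s hs _ hball
      simpa using hs hball

lemma subgraphOutsideSmallSet_of_upVar_le {d : ℕ} {E : Set (Euc (d + 1))} (hE : MeasurableSet E)
    {ε : ℝ} (h : upVar E (EuclideanSpace.single (Fin.last d) 1) ≤ ENNReal.ofReal ε) :
    SubgraphOutsideSmallSet E ε := by
  refine ⟨badColumns E, columnHeight E, badColumns_subset E, measurableSet_badColumns hE,
    (volume_badColumns_le hE).trans h, measurable_columnHeight hE, columnHeight_mem_Icc E, ?_⟩
  filter_upwards [ae_mem_iff_vert_le hE] with x hx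
  refine propext ?_
  change ((x ∈ E ∧ x ∈ Metric.ball 0 1) ∧ horiz x ∉ badColumns E) ↔
    (x ∈ Metric.ball 0 1 ∧ vert x ≤ columnHeight E (horiz x) ∧
      horiz x ∈ Metric.closedBall 0 1 ∧ horiz x ∉ badColumns E)
  have hcl : x ∈ Metric.ball (0 : Euc (d + 1)) 1 → horiz x ∈ Metric.closedBall (0 : Euc d) 1 := by
    intro hb
    rw [← join_horiz_vert x, join_mem_ball_iff] at hb
    rw [mem_closedBall_zero_iff]
    nlinarith [norm_nonneg (horiz x), sq_nonneg (vert x)]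
  tauto

/-! ### The perimeter of the stretched set -/

lemma exists_pos_add_mem_of_tsupport_subset {n : ℕ} {ψ : Euc n → ℝ} (hc : HasCompactSupport ψ)
    (hs : tsupport ψ ⊆ Metric.ball 0 1) :
    ∃ r > 0, ∀ y, ψ y ≠ 0 → ∀ w : Euc n, ‖w‖ < r → y + w ∈ Metric.ball (0 : Euc n) 1 := by
  obtain ⟨r, hr, h⟩ := hc.isCompact.exists_thickening_subset_open Metric.isOpen_ball hs
  refine ⟨r, hr, fun y hy w hw => h ?_⟩
  refine Metric.mem_thickening_iff.2 ⟨y, subset_tsupport ψ hy, ?_⟩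
  simpa [dist_eq_norm] using hw

/-- Moving the translation from `ψ` to the indicator of `E` gives an integrand bounded by 1 that
vanishes unless exactly one of `y` and `y - w` lies in `E`. Such points form the jump set along `-w`
and a translate of the one along `w`. -/
lemma abs_setIntegral_shift_sub_le {n : ℕ} {E : Set (Euc n)} (hE : MeasurableSet E)
    {ψ : Euc n → ℝ} (hψ : Continuous ψ) (hc : HasCompactSupport ψ) (hle : ∀ x, |ψ x| ≤ 1)
    (w : Euc n) (hw : ∀ y, ψ y ≠ 0 → y - w ∈ Metric.ball (0 : Euc n) 1)
    (hball : ∀ y, ψ y ≠ 0 → y ∈ Metric.ball (0 : Euc n) 1) :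
    ENNReal.ofReal |∫ x in E, (ψ (x + w) - ψ x)| ≤ upJump E 1 w + upJump E 1 (-w) := by
  have hint : Integrable ψ := hψ.integrable_of_hasCompactSupport hc
  set e : Euc n → ℝ := E.indicator 1
  set F : Euc n → ℝ := fun y => e (y - w) * ψ y - e y * ψ y
  have he : ∀ f : Euc n → ℝ, E.indicator f = fun x => e x * f x := fun f => by
    ext x; by_cases hx : x ∈ E <;> simp [e, hx]
  have hi1 : Integrable fun x => e x * ψ (x + w) := by
    rw [← he]; exact (hint.comp_add_right w).indicator hE
  have hi2 : Integrable fun x => e x * ψ x := by rw [← he]; exact hint.indicator hE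
  have hF : ∫ x in E, (ψ (x + w) - ψ x) = ∫ y, F y := by
    rw [← integral_indicator hE, he]
    have h1 : ∫ x, e x * ψ (x + w) = ∫ y, e (y - w) * ψ y := by
      rw [← integral_add_right_eq_self (fun y => e (y - w) * ψ y) w]
      simp
    have hi3 : Integrable fun y => e (y - w) * ψ y := by
      have := hi1.comp_sub_right w
      simpa using this
    simp only [mul_sub, F]
    rw [integral_sub hi1 hi2, integral_sub hi3 hi2, h1]
  set J : Set (Euc n) := jumpSet (Metric.ball 0 1) E (-w) ∪
    (fun x => x + (-w)) ⁻¹' jumpSet (Metric.ball 0 1) E w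
  have hJ0 : ∀ y, y ∉ J → F y = 0 := by
    intro y hy
    by_cases hψy : ψ y = 0
    · simp [F, hψy]
    · have h1 := hw y hψy
      have h2 := hball y hψy
      by_cases h3 : y ∈ E <;> by_cases h4 : y - w ∈ E
      · simp [F, e, h3, h4]
      · refine absurd (Or.inr ?_) hy
        change (_ ∧ _ ∧ _ ∧ _)
        simp only [← sub_eq_add_neg, sub_add_cancel]
        exact ⟨h1, h2, h4, h3⟩
      · refine absurd (Or.inl ?_) hy
        change (_ ∧ _ ∧ _ ∧ _)
        rw [← sub_eq_add_neg]
        exact ⟨h2, h1, h3, h4⟩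
      · simp [F, e, h3, h4]
  have hJle : volume J ≤ upJump E 1 w + upJump E 1 (-w) := by
    refine (measure_union_le _ _).trans ?_
    rw [measure_preimage_add_right, add_comm]
    rfl
  have hJtop : volume J < ∞ := hJle.trans_lt
    (ENNReal.add_lt_top.2 ⟨(upJump_ne_top _ _ _).lt_top, (upJump_ne_top _ _ _).lt_top⟩)
  rw [hF, ← setIntegral_eq_integral_of_forall_compl_eq_zero (s := J) (fun y hy => hJ0 y hy)]
  have hb : ∀ y ∈ J, ‖F y‖ ≤ 1 := by
    intro y _
    have h1 : F y = (e (y - w) - e y) * ψ y := by simp only [F]; ring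
    have h2 : |e (y - w) - e y| ≤ 1 := by
      by_cases h3 : y ∈ E <;> by_cases h4 : y - w ∈ E <;> simp [e, h3, h4]
    rw [h1, norm_mul]
    exact mul_le_one₀ h2 (norm_nonneg _) (hle y)
  have h1 := norm_setIntegral_le_of_norm_le_const hJtop hb
  rw [one_mul, Real.norm_eq_abs] at h1
  refine le_trans ?_ hJle
  exact ENNReal.ofReal_le_of_le_toReal h1

/-- The directional derivative is a limit of dyadic difference quotients, each controlled by the
jumps at that scale. The support stays at a positive distance from the sphere, so small translations
of it remain in the ball. -/
lemma setIntegral_fderiv_le {n : ℕ} {E : Set (Euc n)} (hE : MeasurableSet E)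
    {ψ : Euc n → ℝ} (hψ : ContDiff ℝ 1 ψ) (hc : HasCompactSupport ψ)
    (hs : tsupport ψ ⊆ Metric.ball 0 1) (hle : ∀ x, |ψ x| ≤ 1) (v : Euc n) :
    ENNReal.ofReal (∫ x in E, fderiv ℝ ψ x v) ≤ upVar E v + upVar E (-v) := by
  obtain ⟨r, hr, hadd⟩ := exists_pos_add_mem_of_tsupport_subset hc hs
  obtain ⟨L, hL⟩ := hψ.lipschitzWith_of_hasCompactSupport hc one_ne_zero
  have hpow : Filter.Tendsto (fun k : ℕ => (1 / 2 : ℝ) ^ k) Filter.atTop (nhds 0) :=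
    tendsto_pow_atTop_nhds_zero_of_lt_one (by norm_num) (by norm_num)
  have hlim : Filter.Tendsto
      (fun k : ℕ => ∫ x in E, 2 ^ k * (ψ (x + (1 / 2 : ℝ) ^ k • v) - ψ x)) Filter.atTop
      (nhds (∫ x in E, fderiv ℝ ψ x v)) := by
    -- The quotients are bounded by the Lipschitz constant times `‖v‖`, and a point outside the ball
    -- of radius `1 + ‖v‖` cannot be moved into the support.
    refine tendsto_integral_of_dominated_convergence
      ((Metric.closedBall (0 : Euc n) (1 + ‖v‖)).indicator fun _ => L * ‖v‖) ?_ ?_ ?_ ?_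
    · intro k
      have : Continuous fun x => 2 ^ k * (ψ (x + (1 / 2 : ℝ) ^ k • v) - ψ x) := by
        have := hψ.continuous
        fun_prop
      exact this.aestronglyMeasurable
    · refine Integrable.restrict ?_
      rw [integrable_indicator_iff measurableSet_closedBall]
      exact integrableOn_const measure_closedBall_lt_top.ne
    · intro k
      refine Filter.Eventually.of_forall fun x => ?_
      by_cases hx : x ∈ Metric.closedBall (0 : Euc n) (1 + ‖v‖)
      · rw [indicator_of_mem hx, norm_mul, Real.norm_of_nonneg (by positivity)]
        have h1 := hL.dist_le_mul (x + (1 / 2 : ℝ) ^ k • v) x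
        rw [dist_eq_norm, dist_eq_norm, add_sub_cancel_left, norm_smul,
          Real.norm_of_nonneg (show (0 : ℝ) ≤ (1 / 2) ^ k by positivity)] at h1
        calc _ ≤ (2 : ℝ) ^ k * (L * ((1 / 2 : ℝ) ^ k * ‖v‖)) := by gcongr
          _ = (2 * (1 / 2) : ℝ) ^ k * (L * ‖v‖) := by rw [mul_pow]; ring
          _ = _ := by norm_num
      · have hx' : 1 + ‖v‖ < ‖x‖ := by simpa using hx
        have hzero : ∀ y, ψ y ≠ 0 → ‖y‖ < 1 := fun y hy => by
          simpa using hs (subset_tsupport ψ hy)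
        have h1 : ψ x = 0 := by
          by_contra hne
          linarith [hzero x hne, norm_nonneg v]
        have h2 : ψ (x + (1 / 2 : ℝ) ^ k • v) = 0 := by
          by_contra hne
          have h3 := hzero _ hne
          have h4 := norm_le_add_norm_add x ((1 / 2 : ℝ) ^ k • v)
          have h5 : ‖(1 / 2 : ℝ) ^ k • v‖ ≤ ‖v‖ := by
            rw [norm_smul, Real.norm_of_nonneg (by positivity)]
            exact mul_le_of_le_one_left (norm_nonneg v)
              (pow_le_one₀ (by norm_num) (by norm_num))
          linarith
        rw [h1, h2]; simp [hx]
    · refine Filter.Eventually.of_forall fun x => ?_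
      have h1 := (hψ.differentiable one_ne_zero x).hasFDerivAt.lim v (c := fun k : ℕ => (2 : ℝ) ^ k)
        (l := Filter.atTop) (tendsto_norm_atTop_atTop.comp
          (tendsto_pow_atTop_atTop_of_one_lt (by norm_num : (1 : ℝ) < 2)))
      simpa using h1
  have hev : ∀ᶠ k : ℕ in Filter.atTop,
      ENNReal.ofReal (∫ x in E, 2 ^ k * (ψ (x + (1 / 2 : ℝ) ^ k • v) - ψ x)) ≤
        upVar E v + upVar E (-v) := by
    have h0 : Filter.Tendsto (fun k : ℕ => (1 / 2 : ℝ) ^ k * ‖v‖) Filter.atTop (nhds 0) := by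
      simpa using hpow.mul_const ‖v‖
    filter_upwards [h0.eventually (gt_mem_nhds hr)] with k hk
    have hn : ‖(1 / 2 : ℝ) ^ k • v‖ < r := by
      rwa [norm_smul, Real.norm_of_nonneg (by positivity)]
    have h1 := abs_setIntegral_shift_sub_le hE hψ.continuous hc hle ((1 / 2 : ℝ) ^ k • v)
      (fun y hy => by rw [sub_eq_add_neg]; exact hadd y hy _ (by rwa [norm_neg]))
      (fun y hy => hs (subset_tsupport ψ hy))
    rw [integral_const_mul, ENNReal.ofReal_mul (by positivity),
      ENNReal.ofReal_pow (by norm_num), ENNReal.ofReal_ofNat]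
    calc _ ≤ 2 ^ k * (upJump E 1 ((1 / 2 : ℝ) ^ k • v) + upJump E 1 (-((1 / 2 : ℝ) ^ k • v))) := by
          gcongr
          exact (ENNReal.ofReal_le_ofReal (le_abs_self _)).trans h1
      _ ≤ _ := by
          rw [mul_add, ← smul_neg]
          exact add_le_add (le_iSup (fun k : ℕ => 2 ^ k * upJump E 1 ((1 / 2 : ℝ) ^ k • v)) k)
            (le_iSup (fun k : ℕ => 2 ^ k * upJump E 1 ((1 / 2 : ℝ) ^ k • -v)) k)
  exact le_of_tendsto ((ENNReal.continuous_ofReal.tendsto _).comp hlim) hev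

/-! ### The stretching as a change of variables -/

/-- The vertical stretching as a continuous linear map. -/
def stretchCLM (d : ℕ) (ε : ℝ) : Euc (d + 1) →L[ℝ] Euc (d + 1) :=
  LinearMap.toContinuousLinearMap
    { toFun := stretch ε
      map_add' := fun x y => by
        ext i
        refine Fin.lastCases ?_ (fun i => ?_) i <;> simp [stretch, add_div]
      map_smul' := fun a x => by
        ext i
        refine Fin.lastCases ?_ (fun i => ?_) i <;> simp [stretch, mul_div_assoc] }

lemma stretchCLM_apply {d : ℕ} (ε : ℝ) (x : Euc (d + 1)) : stretchCLM d ε x = stretch ε x := rfl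

lemma stretch_single_castSucc {d : ℕ} (ε : ℝ) (i : Fin d) :
    stretch ε (EuclideanSpace.single i.castSucc 1 : Euc (d + 1)) =
      EuclideanSpace.single i.castSucc 1 := by
  ext j
  refine Fin.lastCases ?_ (fun j => ?_) j <;>
    simp [stretch, (Fin.castSucc_lt_last i).ne']

lemma stretch_single_last {d : ℕ} (ε : ℝ) :
    stretch ε (EuclideanSpace.single (Fin.last d) 1 : Euc (d + 1)) =
      ε⁻¹ • EuclideanSpace.single (Fin.last d) 1 := by
  ext j
  refine Fin.lastCases ?_ (fun j => ?_) j <;>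
    simp [stretch, (Fin.castSucc_lt_last _).ne]

lemma det_stretchCLM (d : ℕ) (ε : ℝ) : (stretchCLM d ε).det = ε⁻¹ := by
  set b := (EuclideanSpace.basisFun (Fin (d + 1)) ℝ).toBasis
  have h : LinearMap.toMatrix b b (stretchCLM d ε : Euc (d + 1) →ₗ[ℝ] Euc (d + 1)) =
      Matrix.diagonal (Fin.snoc (fun _ => 1) ε⁻¹ : Fin (d + 1) → ℝ) := by
    ext i j
    rw [LinearMap.toMatrix_apply]
    refine Fin.lastCases ?_ (fun j => ?_) j
    · refine Fin.lastCases ?_ (fun i => ?_) i <;>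
        simp [b, stretchCLM_apply, stretch_single_last, (Fin.castSucc_lt_last _).ne]
    · refine Fin.lastCases ?_ (fun i => ?_) i <;>
        simp [b, stretchCLM_apply, stretch_single_castSucc, Matrix.diagonal_apply,
          (Fin.castSucc_lt_last _).ne']
  rw [ContinuousLinearMap.det, ← LinearMap.det_toMatrix b, h, Matrix.det_diagonal,
    Fin.prod_univ_castSucc]
  simp

lemma stretch_injective {d : ℕ} {ε : ℝ} (hε : ε ≠ 0) :
    Function.Injective (stretch ε : Euc (d + 1) → Euc (d + 1)) := by
  intro x y h
  ext i
  have hi : ∀ j, stretch ε x j = stretch ε y j := fun j => by rw [h]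
  refine Fin.lastCases ?_ (fun j => ?_) i
  · have := hi (Fin.last d)
    simp only [stretch, Fin.snoc_last] at this
    exact (div_left_inj' hε).1 this
  · simpa [stretch] using hi j.castSucc

/-- Pulling a test field back through the stretching costs the Jacobian `ε⁻¹`, while the vertical
derivative gains a factor `ε`. The flux is therefore at most `ε⁻¹ (2 d δ) + (2 δ + c)`: only the
horizontal variations, which are of order `δ ≤ ε`, are divided by `ε`. -/
lemma stretchedPerBound_of_upVar_le {d : ℕ} {E : Set (Euc (d + 1))} (hE : MeasurableSet E)
    {δ ε c : ℝ} (hδ : 0 ≤ δ) (hε : 0 < ε) (hδε : δ ≤ ε) (hc : 0 ≤ c)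
    (h : ∀ i : Fin d, upVar E (EuclideanSpace.single i.castSucc 1) ≤ ENNReal.ofReal δ ∧
      upVar E (-EuclideanSpace.single i.castSucc 1) ≤ ENNReal.ofReal δ)
    (h1 : upVar E (EuclideanSpace.single (Fin.last d) 1) ≤ ENNReal.ofReal δ)
    (h2 : upVar E (-EuclideanSpace.single (Fin.last d) 1) ≤ ENNReal.ofReal (δ + c)) :
    StretchedPerBound E ε ((2 * d + 2 + c) * max 1 ε) := by
  refine iSup₂_le fun φ hφ => ?_
  obtain ⟨hφ1, hφc, hφs, hφle⟩ := hφ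
  set S := stretchCLM d ε
  have hSinj : Function.Injective S := stretch_injective hε.ne'
  have hScl : Topology.IsClosedEmbedding S :=
    LinearMap.isClosedEmbedding_of_injective (f := (S : Euc (d + 1) →ₗ[ℝ] Euc (d + 1)))
      (LinearMap.ker_eq_bot.2 hSinj)
  set ψ : Fin (d + 1) → Euc (d + 1) → ℝ := fun i x => φ (S x) i
  have hψ1 : ∀ i, ContDiff ℝ 1 (ψ i) := fun i =>
    (contDiff_euclidean.1 (hφ1.comp S.contDiff)) i
  have hψt : ∀ i, tsupport (ψ i) ⊆ S ⁻¹' tsupport φ := fun i => by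
    refine closure_minimal ?_ ((isClosed_tsupport φ).preimage S.continuous)
    intro x hx
    refine subset_tsupport φ ?_
    intro h0
    exact hx (by simp only [ψ, h0]; rfl)
  have hψc : ∀ i, HasCompactSupport (ψ i) := fun i =>
    (hScl.isCompact_preimage hφc.isCompact).of_isClosed_subset (isClosed_tsupport _) (hψt i)
  have hψs : ∀ i, tsupport (ψ i) ⊆ Metric.ball 0 1 := fun i x hx => by
    obtain ⟨y, hy, hxy⟩ := hφs (hψt i hx)
    rwa [← hSinj hxy]
  have hψle : ∀ i x, |ψ i x| ≤ 1 := fun i x =>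
    (PiLp.norm_apply_le (φ (S x)) i).trans (hφle _)
  have hder : ∀ i x v, fderiv ℝ (ψ i) x v = fderiv ℝ φ (S x) (S v) i := by
    intro i x v
    have h1 : HasFDerivAt φ (fderiv ℝ φ (S x)) (S x) :=
      (hφ1.differentiable one_ne_zero _).hasFDerivAt
    have h2 := h1.comp x S.hasFDerivAt
    have h3 := ((EuclideanSpace.proj i : Euc (d + 1) →L[ℝ] ℝ).hasFDerivAt).comp x h2
    rw [show ψ i = (EuclideanSpace.proj i : Euc (d + 1) →L[ℝ] ℝ) ∘ φ ∘ S from rfl, h3.fderiv]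
    rfl
  have hint : ∀ i, IntegrableOn (fun x => fderiv ℝ (ψ i) x (EuclideanSpace.single i 1)) E :=
    fun i => by
      refine Integrable.integrableOn ?_
      refine Continuous.integrable_of_hasCompactSupport ?_ ?_
      · exact ((hψ1 i).continuous_fderiv one_ne_zero).clm_apply continuous_const
      · exact (hψc i).fderiv_apply ℝ _
  have hdiv : ∀ x, divergence φ (S x) =
      (∑ i : Fin d, fderiv ℝ (ψ i.castSucc) x (EuclideanSpace.single i.castSucc 1)) +
        ε * fderiv ℝ (ψ (Fin.last d)) x (EuclideanSpace.single (Fin.last d) 1) := by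
    intro x
    rw [divergence, Fin.sum_univ_castSucc]
    congr 1
    · refine Finset.sum_congr rfl fun i _ => ?_
      rw [hder, show S (EuclideanSpace.single i.castSucc 1) = _ from stretch_single_castSucc ε i]
    · rw [hder, show S (EuclideanSpace.single (Fin.last d) 1) = _ from stretch_single_last ε, map_smul, PiLp.smul_apply, smul_eq_mul,
        mul_inv_cancel_left₀ hε.ne']
  have hchange : ∫ y in stretch ε '' E, divergence φ y = ε⁻¹ *
      ((∑ i : Fin d, ∫ x in E, fderiv ℝ (ψ i.castSucc) x (EuclideanSpace.single i.castSucc 1)) +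
        ε * ∫ x in E, fderiv ℝ (ψ (Fin.last d)) x (EuclideanSpace.single (Fin.last d) 1)) := by
    have := integral_image_eq_integral_abs_det_fderiv_smul volume hE
      (f := S) (f' := fun _ => S) (fun x _ => S.hasFDerivAt.hasFDerivWithinAt) hSinj.injOn
      (divergence φ)
    rw [show stretch ε '' E = S '' E from rfl, this]
    simp only [S, det_stretchCLM, abs_of_pos (inv_pos.2 hε), smul_eq_mul]
    rw [integral_const_mul]
    congr 1
    simp only [S] at hdiv
    simp only [hdiv]
    rw [integral_add (integrable_finsetSum _ fun i _ => hint _) ((hint _).const_mul _),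
      integral_finsetSum _ fun i _ => hint _, integral_const_mul]
  have hI : ∀ i : Fin d,
      ∫ x in E, fderiv ℝ (ψ i.castSucc) x (EuclideanSpace.single i.castSucc 1) ≤ 2 * δ := by
    intro i
    have := (setIntegral_fderiv_le hE (hψ1 i.castSucc) (hψc _) (hψs _) (hψle _)
      (EuclideanSpace.single i.castSucc 1)).trans (add_le_add (h i).1 (h i).2)
    rw [← ENNReal.ofReal_add hδ hδ, ENNReal.ofReal_le_ofReal_iff (by positivity)] at this
    linarith
  have hL : ∫ x in E, fderiv ℝ (ψ (Fin.last d)) x (EuclideanSpace.single (Fin.last d) 1) ≤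
      2 * δ + c := by
    have := (setIntegral_fderiv_le hE (hψ1 (Fin.last d)) (hψc _) (hψs _) (hψle _)
      (EuclideanSpace.single (Fin.last d) 1)).trans (add_le_add h1 h2)
    rw [← ENNReal.ofReal_add hδ (by positivity), ENNReal.ofReal_le_ofReal_iff (by positivity)]
      at this
    linarith
  refine ENNReal.ofReal_le_ofReal ?_
  rw [hchange, inv_mul_le_iff₀ hε]
  have hsum : (∑ i : Fin d, ∫ x in E, fderiv ℝ (ψ i.castSucc) x
      (EuclideanSpace.single i.castSucc 1)) ≤ d * (2 * δ) := by
    refine (Finset.sum_le_sum fun i _ => hI i).trans_eq ?_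
    simp
  have hd0 : (0 : ℝ) ≤ d := Nat.cast_nonneg d
  have hm1 : 1 ≤ max 1 ε := le_max_left _ _
  have hm2 : ε ≤ max 1 ε := le_max_right _ _
  have e1 : d * (2 * δ) ≤ ε * (2 * d * max 1 ε) := by
    calc d * (2 * δ) ≤ d * (2 * ε) := by gcongr
      _ = ε * (2 * d * 1) := by ring
      _ ≤ _ := by gcongr
  have e2 : ε * (2 * δ + c) ≤ ε * ((2 + c) * max 1 ε) := by
    refine mul_le_mul_of_nonneg_left ?_ hε.le
    nlinarith
  calc _ ≤ d * (2 * δ) + ε * (2 * δ + c) := by gcongr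
    _ ≤ ε * (2 * d * max 1 ε) + ε * ((2 + c) * max 1 ε) := add_le_add e1 e2
    _ = _ := by ring

/-! ### Horizontal slices -/

/-- The slice of `E` at height `s`. -/
def slice {d : ℕ} (E : Set (Euc (d + 1))) (s : ℝ) : Set (Euc d) := {y | join y s ∈ E}

lemma upVar_sum_le {n : ℕ} (E : Set (Euc n)) {ι : Type*} (t : Finset ι) (v : ι → Euc n) :
    upVar E (∑ i ∈ t, v i) ≤ ∑ i ∈ t, upVar E (v i) := by
  classical
  induction t using Finset.induction_on with
  | empty => simp [upVar_zero]
  | insert i t hi ih =>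
    rw [Finset.sum_insert hi, Finset.sum_insert hi]
    exact (upVar_add_le E _ _).trans (by gcongr)

/-- Expansion in horizontal basis vectors. Control of both signs of each vector handles coefficients
of either sign; the factor `d` comes from the crude bound `|w i| ≤ ‖w‖`. -/
lemma upVar_join_zero_le {d : ℕ} {E : Set (Euc (d + 1))} {c δ : ℝ} (hc : 0 ≤ c)
    (hfin : ∀ v, upVar E v ≤ ENNReal.ofReal (c * ‖v‖)) (hδ : 0 ≤ δ)
    (h : ∀ i : Fin d, upVar E (EuclideanSpace.single i.castSucc 1) ≤ ENNReal.ofReal δ ∧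
      upVar E (-EuclideanSpace.single i.castSucc 1) ≤ ENNReal.ofReal δ) (w : Euc d) :
    upVar E (join w 0) ≤ ENNReal.ofReal (d * δ * ‖w‖) := by
  have hsum : join w 0 = ∑ i : Fin d, w i • (EuclideanSpace.single i.castSucc 1 : Euc (d + 1)) := by
    ext j
    refine Fin.lastCases ?_ (fun j => ?_) j
    · simp [join, (Fin.castSucc_lt_last _).ne']
    · simp [join, Pi.single_apply]
  have hi : ∀ i : Fin d, upVar E (w i • (EuclideanSpace.single i.castSucc 1 : Euc (d + 1))) ≤
      ENNReal.ofReal (δ * ‖w‖) := by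
    intro i
    have hwi : |w i| ≤ ‖w‖ := PiLp.norm_apply_le w i
    have key : upVar E (w i • (EuclideanSpace.single i.castSucc 1 : Euc (d + 1))) ≤
        ENNReal.ofReal |w i| * ENNReal.ofReal δ := by
      rcases le_total 0 (w i) with h0 | h0
      · rw [abs_of_nonneg h0]
        exact (upVar_smul_le hc hfin _ h0).trans (by gcongr; exact (h i).1)
      · rw [abs_of_nonpos h0, ← neg_neg (w i), neg_smul, ← smul_neg, neg_neg]
        exact (upVar_smul_le hc hfin _ (neg_nonneg.2 h0)).trans (by gcongr; exact (h i).2)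
    refine key.trans ?_
    rw [← ENNReal.ofReal_mul (abs_nonneg _), mul_comm δ]
    exact ENNReal.ofReal_le_ofReal (by gcongr)
  rw [hsum]
  refine (upVar_sum_le E _ _).trans ((Finset.sum_le_sum fun i _ => hi i).trans_eq ?_)
  rw [Finset.sum_const, Finset.card_univ, Fintype.card_fin, nsmul_eq_mul, mul_assoc,
    ENNReal.ofReal_mul (Nat.cast_nonneg d), ENNReal.ofReal_natCast]

lemma measurable_volume_slice {d : ℕ} {A : Set (Euc (d + 1))} (hA : MeasurableSet A) :
    Measurable fun s : ℝ => volume {y : Euc d | join y s ∈ A} :=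
  measurable_measure_prodMk_right (measurable_join hA)

lemma measurableSet_slice {d : ℕ} {E : Set (Euc (d + 1))} (hE : MeasurableSet E) (s : ℝ) :
    MeasurableSet (slice E s) :=
  (measurable_join.comp measurable_prodMk_right) hE

lemma upJump_slice {d : ℕ} (E : Set (Euc (d + 1))) (s : ℝ) (w : Euc d) :
    upJump (slice E s) (chord s) w =
      volume {y | join y s ∈ jumpSet (Metric.ball 0 1) E (join w 0)} := by
  unfold upJump
  congr 1
  ext y
  change (_ ∧ _ ∧ _ ∧ _) ↔ (_ ∧ _ ∧ _ ∧ _)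
  rw [join_add_join, add_zero, join_mem_ball_iff_mem_ball, join_mem_ball_iff_mem_ball]
  rfl

lemma lintegral_upJump_slice {d : ℕ} {E : Set (Euc (d + 1))} (hE : MeasurableSet E) (w : Euc d) :
    ∫⁻ s, upJump (slice E s) (chord s) w = upJump E 1 (join w 0) := by
  simp only [upJump_slice]
  rw [upJump, volume_eq_lintegral_slice (measurableSet_jumpSet measurableSet_ball hE _)]

lemma measurable_upJump_slice {d : ℕ} {E : Set (Euc (d + 1))} (hE : MeasurableSet E) :
    Measurable fun p : ℝ × Euc d => upJump (slice E p.1) (chord p.1) p.2 := by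
  simp only [upJump_slice]
  have h1 : Measurable fun q : (ℝ × Euc d) × Euc d => join q.2 q.1.1 :=
    measurable_join.comp (measurable_snd.prodMk (measurable_fst.comp measurable_fst))
  have h2 : Measurable fun q : (ℝ × Euc d) × Euc d => join q.2 q.1.1 + join q.1.2 0 :=
    h1.add (measurable_join.comp ((measurable_snd.comp measurable_fst).prodMk measurable_const))
  have h3 : MeasurableSet {q : (ℝ × Euc d) × Euc d |
      join q.2 q.1.1 ∈ jumpSet (Metric.ball 0 1) E (join q.1.2 0)} :=
    (h1 measurableSet_ball).inter ((h2 measurableSet_ball).inter ((h1 hE.compl).inter (h2 hE)))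
  exact measurable_measure_prodMk_left h3

/-! ### Jumps integrated over all translations -/

lemma measurable_upJump {n : ℕ} {A : Set (Euc n)} (hA : MeasurableSet A) (r : ℝ) :
    Measurable fun w => upJump A r w := by
  have h1 : Measurable fun q : Euc n × Euc n => q.2 := measurable_snd
  have h2 : Measurable fun q : Euc n × Euc n => q.2 + q.1 := measurable_snd.add measurable_fst
  have h3 : MeasurableSet {q : Euc n × Euc n | q.2 ∈ jumpSet (Metric.ball 0 r) A q.1} :=
    (h1 measurableSet_ball).inter ((h2 measurableSet_ball).inter ((h1 hA.compl).inter (h2 hA)))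
  exact measurable_measure_prodMk_left h3

/-- The product of the volumes of a set and of its complement in a ball is the integral of the jumps
over all translations. -/
lemma volume_mul_volume_eq_lintegral_upJump {n : ℕ} {A : Set (Euc n)} (hA : MeasurableSet A)
    (r : ℝ) :
    volume (Metric.ball 0 r ∩ A) * volume (Metric.ball 0 r \ A) = ∫⁻ w, upJump A r w := by
  set S := Metric.ball (0 : Euc n) r ∩ A
  set T := Metric.ball (0 : Euc n) r \ A
  have hS : MeasurableSet S := measurableSet_ball.inter hA
  have hT : MeasurableSet T := measurableSet_ball.diff hA
  have h1 : ∀ w, upJump A r w = ∫⁻ x, T.indicator 1 x * S.indicator 1 (x + w) := by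
    intro w
    rw [upJump, ← lintegral_indicator_one (measurableSet_jumpSet measurableSet_ball hA w)]
    refine lintegral_congr fun x => ?_
    by_cases hx : x ∈ T <;> by_cases hxw : x + w ∈ S
    · rw [indicator_of_mem hx, indicator_of_mem hxw, indicator_of_mem]
      · simp
      · exact ⟨hx.1, hxw.1, hx.2, hxw.2⟩
    · rw [indicator_of_notMem hxw, indicator_of_notMem, mul_zero]
      exact fun h => hxw ⟨h.2.1, h.2.2.2⟩
    all_goals
      rw [indicator_of_notMem hx, indicator_of_notMem, zero_mul]
      exact fun h => hx ⟨h.1, h.2.2.1⟩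
  have hmS : Measurable (S.indicator (1 : Euc n → ℝ≥0∞)) := measurable_one.indicator hS
  have hmT : Measurable (T.indicator (1 : Euc n → ℝ≥0∞)) := measurable_one.indicator hT
  simp only [h1]
  rw [lintegral_lintegral_swap]
  · have h2 : ∀ x, ∫⁻ w, T.indicator 1 x * S.indicator (1 : Euc n → ℝ≥0∞) (x + w) =
        T.indicator 1 x * volume S := by
      intro x
      have hmx : Measurable fun w => S.indicator (1 : Euc n → ℝ≥0∞) (x + w) :=
        hmS.comp (measurable_const_add x)
      rw [lintegral_const_mul _ hmx,
        lintegral_add_left_eq_self (fun w => S.indicator (1 : Euc n → ℝ≥0∞) w) x,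
        lintegral_indicator_one hS]
    simp only [h2]
    rw [lintegral_mul_const _ hmT, lintegral_indicator_one hT, mul_comm]
  · exact ((hmT.comp measurable_snd).mul
      (hmS.comp (measurable_snd.add measurable_fst))).aemeasurable

lemma upJump_eq_zero {n : ℕ} (A : Set (Euc n)) {r : ℝ} {w : Euc n} (h : 2 * r ≤ ‖w‖) :
    upJump A r w = 0 := by
  have : jumpSet (Metric.ball 0 r) A w = ∅ := by
    ext x
    simp only [mem_empty_iff_false, iff_false]
    rintro ⟨h1, h2, -⟩
    simp only [Metric.mem_ball, dist_zero_right] at h1 h2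
    have := norm_sub_le (x + w) x
    rw [add_sub_cancel_left] at this
    linarith
  rw [upJump, this, measure_empty]

/-- Jumps vanish for `‖w‖ ≥ 2 r`, and the others are halved `k` times until they are shorter than
`ρ`. Halving costs `2^k`, the substitution `w ↦ 2^{-k} w` costs `2^{k n}`, and the least admissible
power satisfies `2^k ≤ 4 r / ρ`. -/
lemma lintegral_upJump_le {n : ℕ} {A : Set (Euc n)} (hA : MeasurableSet A) {r ρ : ℝ} (hρ : 0 < ρ)
    (hρr : ρ ≤ 2 * r) :
    ∫⁻ w, upJump A r w ≤
      ENNReal.ofReal ((4 * r / ρ) ^ (n + 1)) * ∫⁻ w in Metric.ball 0 ρ, upJump A r w := by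
  obtain ⟨m, hm1, hm2⟩ := exists_nat_pow_near (show 1 ≤ 2 * r / ρ by rwa [one_le_div hρ])
    (show (1 : ℝ) < 2 by norm_num)
  set k := m + 1
  have hk1 : (2 : ℝ) ^ k ≤ 4 * r / ρ := by
    rw [pow_succ]
    calc (2 : ℝ) ^ m * 2 ≤ 2 * r / ρ * 2 := by gcongr
      _ = 4 * r / ρ := by ring
  have hk2 : 2 * r < 2 ^ k * ρ := (div_lt_iff₀ hρ).1 hm2
  have h1 : ∫⁻ w, upJump A r w ≤ ∫⁻ w, 2 ^ k * (Metric.ball (0 : Euc n) ρ).indicator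
      (fun w => upJump A r w) ((1 / 2 : ℝ) ^ k • w) := by
    refine lintegral_mono fun w => ?_
    dsimp only
    by_cases hw : 2 * r ≤ ‖w‖
    · rw [upJump_eq_zero A hw]; exact zero_le
    · rw [indicator_of_mem]
      · exact upJump_le_two_pow A r w k
      · rw [mem_ball_zero_iff, norm_smul, Real.norm_of_nonneg (by positivity), one_div, inv_pow,
          inv_mul_lt_iff₀ (by positivity)]
        linarith
  refine h1.trans ?_
  have hm := (measurable_upJump hA r).indicator (measurableSet_ball (x := (0 : Euc n)) (ε := ρ))
  have hmk : Measurable fun w : Euc n => (Metric.ball (0 : Euc n) ρ).indicator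
      (fun w => upJump A r w) ((1 / 2 : ℝ) ^ k • w) := hm.comp (measurable_const_smul _)
  rw [lintegral_const_mul _ hmk]
  have h2 : ∫⁻ w, (Metric.ball (0 : Euc n) ρ).indicator (fun w => upJump A r w)
      ((1 / 2 : ℝ) ^ k • w) = 2 ^ (k * n) * ∫⁻ w in Metric.ball 0 ρ, upJump A r w := by
    rw [← lintegral_indicator measurableSet_ball,
      ← lintegral_map hm (measurable_const_smul _), Measure.map_addHaar_smul _ (by positivity),
      lintegral_smul_measure, finrank_euclideanSpace, Fintype.card_fin]
    congr 1
    rw [abs_of_nonneg (by positivity), one_div, inv_pow, inv_pow, inv_inv, ← pow_mul,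
      ENNReal.ofReal_pow (by norm_num), ENNReal.ofReal_ofNat]
  rw [h2, ← mul_assoc, ← pow_add]
  gcongr
  have h3 : (2 : ℝ≥0∞) ^ (k + k * n) = ENNReal.ofReal ((2 ^ k) ^ (n + 1)) := by
    rw [← pow_mul, ENNReal.ofReal_pow (by norm_num), ENNReal.ofReal_ofNat]
    congr 1; ring
  rw [h3]
  exact ENNReal.ofReal_le_ofReal (by gcongr)

/-! ### Poincaré inequality on the slices -/

/-- The measure of the part of the slice of the unit ball at height `s` that lies in `E`. -/
def sliceIn {d : ℕ} (E : Set (Euc (d + 1))) (s : ℝ) : ℝ≥0∞ :=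
  volume (Metric.ball 0 (chord s) ∩ slice E s)

/-- The measure of the part of the slice of the unit ball at height `s` that lies outside `E`. -/
def sliceOut {d : ℕ} (E : Set (Euc (d + 1))) (s : ℝ) : ℝ≥0∞ :=
  volume (Metric.ball 0 (chord s) \ slice E s)

/-- The measure of the slice of the unit ball at height `s`. -/
def sliceVol (d : ℕ) (s : ℝ) : ℝ≥0∞ := volume (Metric.ball (0 : Euc d) (chord s))

/-- The volume of the unit ball. -/
def ballConst (n : ℕ) : ℝ := volume.real (Metric.ball (0 : Euc n) 1)

lemma ballConst_pos (n : ℕ) : 0 < ballConst n :=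
  ENNReal.toReal_pos (Metric.measure_ball_pos volume _ one_pos).ne' measure_ball_lt_top.ne

lemma volume_ball_eq {n : ℕ} (x : Euc n) {r : ℝ} (hr : 0 < r) :
    volume (Metric.ball x r) = ENNReal.ofReal (r ^ n * ballConst n) := by
  rw [Measure.addHaar_ball_of_pos _ _ hr, finrank_euclideanSpace, Fintype.card_fin,
    ENNReal.ofReal_mul (by positivity), ballConst, measureReal_def,
    ENNReal.ofReal_toReal measure_ball_lt_top.ne]

lemma sliceIn_add_sliceOut {d : ℕ} {E : Set (Euc (d + 1))} (hE : MeasurableSet E) (s : ℝ) :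
    sliceIn E s + sliceOut E s = sliceVol d s :=
  measure_inter_add_sdiff _ (measurableSet_slice hE s)

lemma measurable_chord : Measurable fun s : ℝ => chord s := by
  unfold chord
  exact (measurable_const.sub (measurable_norm.pow_const 2)).sqrt

lemma measurable_sliceIn {d : ℕ} {E : Set (Euc (d + 1))} (hE : MeasurableSet E) :
    Measurable (sliceIn E) := by
  have : sliceIn E = fun s => volume {y | join y s ∈ Metric.ball 0 1 ∩ E} := by
    ext1 s
    rw [sliceIn]
    congr 1; ext y
    rw [mem_inter_iff, ← join_mem_ball_iff_mem_ball]; rfl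
  rw [this]
  exact measurable_volume_slice (measurableSet_ball.inter hE)

lemma measurable_sliceOut {d : ℕ} {E : Set (Euc (d + 1))} (hE : MeasurableSet E) :
    Measurable (sliceOut E) := by
  have : sliceOut E = fun s => volume {y | join y s ∈ Metric.ball 0 1 \ E} := by
    ext1 s
    rw [sliceOut]
    congr 1; ext y
    rw [mem_sdiff, ← join_mem_ball_iff_mem_ball]; rfl
  rw [this]
  exact measurable_volume_slice (measurableSet_ball.diff hE)

/-- A nonlocal relative isoperimetric inequality. It rests on `min a b * (a + b) ≤ 2 a b`, where `a
b` is the integral of the jumps over all translations and `a + b` is the volume of the slice.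
Dividing by that volume leaves one spare power of the radius, which is at most 1. -/
lemma min_sliceIn_sliceOut_le {d : ℕ} {E : Set (Euc (d + 1))} (hE : MeasurableSet E) {ρ s : ℝ}
    (hρ : 0 < ρ) (hs : ρ ≤ 2 * chord s) :
    min (sliceIn E s) (sliceOut E s) ≤ ENNReal.ofReal (2 * 4 ^ (d + 1) / (ballConst d * ρ ^ (d + 1)))
      * ∫⁻ w in Metric.ball 0 ρ, upJump (slice E s) (chord s) w := by
  have hr : 0 < chord s := by linarith
  have hω := ballConst_pos d
  set r := chord s
  set M := ∫⁻ w in Metric.ball 0 ρ, upJump (slice E s) r w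
  set a := sliceIn E s
  set b := sliceOut E s
  have h1 : min a b * sliceVol d s ≤ 2 * (a * b) := by
    rw [← sliceIn_add_sliceOut hE, mul_add, two_mul]
    refine add_le_add ?_ ?_
    · rw [mul_comm a b]; gcongr; exact min_le_right _ _
    · gcongr; exact min_le_left _ _
  have h2 : a * b ≤ ENNReal.ofReal ((4 * r / ρ) ^ (d + 1)) * M := by
    rw [show a * b = _ from volume_mul_volume_eq_lintegral_upJump (measurableSet_slice hE s) r]
    exact lintegral_upJump_le (measurableSet_slice hE s) hρ hs
  have h3 : sliceVol d s = ENNReal.ofReal (r ^ d * ballConst d) := volume_ball_eq 0 hr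
  have hV0 : sliceVol d s ≠ 0 := by rw [h3]; simpa using by positivity
  have hVt : sliceVol d s ≠ ∞ := by rw [h3]; exact ENNReal.ofReal_ne_top
  rw [← ENNReal.mul_le_mul_iff_left hV0 hVt]
  refine h1.trans ?_
  calc 2 * (a * b) ≤ 2 * (ENNReal.ofReal ((4 * r / ρ) ^ (d + 1)) * M) := by gcongr
    _ = ENNReal.ofReal (2 * (4 * r / ρ) ^ (d + 1)) * M := by
      rw [ENNReal.ofReal_mul zero_le_two, ENNReal.ofReal_ofNat, mul_assoc]
    _ ≤ ENNReal.ofReal (2 * 4 ^ (d + 1) / (ballConst d * ρ ^ (d + 1)) * (r ^ d * ballConst d)) *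
        M := by
      refine mul_le_mul' (ENNReal.ofReal_le_ofReal ?_) le_rfl
      have e1 : 2 * 4 ^ (d + 1) / (ballConst d * ρ ^ (d + 1)) * (r ^ d * ballConst d) =
        2 * (4 ^ (d + 1) * (r ^ d * 1) / ρ ^ (d + 1)) := by field_simp
      have e2 : (4 * r / ρ) ^ (d + 1) = 4 ^ (d + 1) * (r ^ d * r) / ρ ^ (d + 1) := by
        rw [div_pow, mul_pow, pow_succ r]
      rw [e1, e2]
      gcongr
      exact chord_le_one s
    _ = _ := by
      rw [ENNReal.ofReal_mul (by positivity), ← h3]; ring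

/-- Horizontal variations control the deviation of the slices from being full or empty. -/
lemma lintegral_min_slice_le {d : ℕ} {E : Set (Euc (d + 1))} (hE : MeasurableSet E) {δ : ℝ}
    (hδ : 0 ≤ δ) (h : ∀ w : Euc d, upVar E (join w 0) ≤ ENNReal.ofReal (d * δ * ‖w‖)) {ρ : ℝ}
    (hρ : 0 < ρ) :
    ∫⁻ s in {s | ρ ≤ 2 * chord s}, min (sliceIn E s) (sliceOut E s) ≤
      ENNReal.ofReal (2 * 4 ^ (d + 1) * d * δ) := by
  have hω := ballConst_pos d
  set c := 2 * 4 ^ (d + 1) / (ballConst d * ρ ^ (d + 1))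
  have hZ : MeasurableSet {s : ℝ | ρ ≤ 2 * chord s} :=
    measurableSet_le measurable_const (measurable_chord.const_mul 2)
  have hm := measurable_upJump_slice hE
  have hm1 : Measurable fun s => ∫⁻ w in Metric.ball 0 ρ, upJump (slice E s) (chord s) w :=
    hm.lintegral_prod_right'
  calc _ ≤ ∫⁻ s in {s | ρ ≤ 2 * chord s}, ENNReal.ofReal c *
        ∫⁻ w in Metric.ball 0 ρ, upJump (slice E s) (chord s) w :=
        setLIntegral_mono (hm1.const_mul _) fun s hs => min_sliceIn_sliceOut_le hE hρ hs
    _ ≤ ∫⁻ s, ENNReal.ofReal c * ∫⁻ w in Metric.ball 0 ρ, upJump (slice E s) (chord s) w :=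
        setLIntegral_le_lintegral _ _
    _ = ENNReal.ofReal c * ∫⁻ w in Metric.ball 0 ρ, upJump E 1 (join w 0) := by
        rw [lintegral_const_mul _ hm1, lintegral_lintegral_swap hm.aemeasurable]
        simp only [lintegral_upJump_slice hE]
    _ ≤ ENNReal.ofReal c * ∫⁻ w in Metric.ball (0 : Euc d) ρ, ENNReal.ofReal (d * δ * ρ) := by
        gcongr 1
        refine setLIntegral_mono measurable_const fun w hw => ?_
        refine (upJump_le_upVar E _).trans ((h w).trans (ENNReal.ofReal_le_ofReal ?_))
        gcongr
        exact (mem_ball_zero_iff.1 hw).le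
    -- The powers of `ρ` cancel, so the bound is uniform in `ρ`; this allows `ρ` to be chosen later
    -- in terms of `δ`.
    _ = _ := by
        rw [setLIntegral_const, volume_ball_eq 0 hρ, ← ENNReal.ofReal_mul (by positivity),
          ← ENNReal.ofReal_mul (by positivity)]
        congr 1
        simp only [c]
        field_simp
        ring

/-! ### Closeness to a half-space -/

lemma chord_sq {s : ℝ} (hs : |s| ≤ 1) : chord s ^ 2 = 1 - s ^ 2 := by
  rw [chord, Real.norm_eq_abs, sq_abs, Real.sq_sqrt]
  have := (sq_le_one_iff_abs_le_one s).2 hs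
  linarith

lemma abs_lt_one_of_chord_pos {s : ℝ} (hs : 0 < chord s) : |s| < 1 := by
  rw [chord, Real.sqrt_pos, Real.norm_eq_abs] at hs
  nlinarith [abs_nonneg s]

lemma min_chord_le {s t x : ℝ} (h1 : s ≤ x) (h2 : x ≤ t) :
    min (chord s) (chord t) ≤ chord x := by
  have hx : |x| ≤ max |s| |t| := by
    rcases le_total 0 x with h | h
    · exact le_max_of_le_right (by rw [abs_of_nonneg h]; exact h2.trans (le_abs_self t))
    · refine le_max_of_le_left ?_
      rw [abs_of_nonpos h]; linarith [neg_abs_le s]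
  have hm : ∀ u : ℝ, |x| ≤ |u| → chord u ≤ chord x := fun u hu => by
    refine Real.sqrt_le_sqrt ?_
    rw [Real.norm_eq_abs, Real.norm_eq_abs]
    nlinarith [abs_nonneg x]
  rcases le_max_iff.1 hx with h | h
  · exact min_le_of_left_le (hm s h)
  · exact min_le_of_right_le (hm t h)

/-- A height at which the vertical monotonicity of `E` holds for almost all good columns. -/
def GoodHeight {d : ℕ} (E : Set (Euc (d + 1))) (s : ℝ) : Prop :=
  ∀ᵐ y : Euc d, y ∉ badColumns E → join y s ∈ Metric.ball (0 : Euc (d + 1)) 1 →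
    (join y s ∈ E ↔ s ≤ columnHeight E y)

lemma ae_goodHeight {d : ℕ} {E : Set (Euc (d + 1))} (hE : MeasurableSet E) :
    ∀ᵐ s : ℝ, GoodHeight E s := by
  have h1 := (volume_preserving_join d).quasiMeasurePreserving.ae (ae_mem_iff_vert_le hE)
  have h2 := (Measure.measurePreserving_swap (μ := (volume : Measure ℝ))
    (ν := (volume : Measure (Euc d)))).quasiMeasurePreserving.ae h1
  have h3 := Measure.ae_ae_of_ae_prod h2
  filter_upwards [h3] with s hs
  filter_upwards [hs] with y hy
  simpa using hy

/-- An almost empty slice cannot lie below an almost full slice of comparable size. -/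
lemma volume_ball_le_of_empty_of_full {d : ℕ} {E : Set (Euc (d + 1))} {s t r : ℝ} (hst : s ≤ t)
    (hs : GoodHeight E s) (ht : GoodHeight E t) (hrs : r ≤ chord s) (hrt : r ≤ chord t) :
    volume (Metric.ball (0 : Euc d) r) ≤ sliceIn E s + sliceOut E t + volume (badColumns E) := by
  have hsub : (Metric.ball (0 : Euc d) r : Set (Euc d)) ≤ᵐ[volume]
      (((Metric.ball 0 (chord s) ∩ slice E s) ∪ (Metric.ball 0 (chord t) \ slice E t)) ∪
        badColumns E : Set (Euc d)) := by
    filter_upwards [hs, ht] with y h1 h2 hy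
    by_cases h3 : y ∈ badColumns E
    · exact Or.inr h3
    · refine Or.inl ?_
      have hys : y ∈ Metric.ball (0 : Euc d) (chord s) := Metric.ball_subset_ball hrs hy
      have hyt : y ∈ Metric.ball (0 : Euc d) (chord t) := Metric.ball_subset_ball hrt hy
      by_cases h4 : y ∈ slice E t
      · refine Or.inl ⟨hys, ?_⟩
        have h5 := (h2 h3 ((join_mem_ball_iff_mem_ball y t).2 hyt)).1 h4
        exact (h1 h3 ((join_mem_ball_iff_mem_ball y s).2 hys)).2 (hst.trans h5)
      · exact Or.inr ⟨hyt, h4⟩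
  exact (measure_mono_ae hsub).trans
    ((measure_union_le _ _).trans (add_le_add_left (measure_union_le _ _) _))

/-- The slice of `E` at height `s` is almost empty. -/
def EmptySlice {d : ℕ} (E : Set (Euc (d + 1))) (s : ℝ) : Prop :=
  2 ^ (d + 2) * sliceIn E s ≤ sliceVol d s

/-- The slice of `E` at height `s` is almost full. -/
def FullSlice {d : ℕ} (E : Set (Euc (d + 1))) (s : ℝ) : Prop :=
  2 ^ (d + 2) * sliceOut E s ≤ sliceVol d s

lemma sliceVol_le_of_not {d : ℕ} {E : Set (Euc (d + 1))} {s : ℝ} (h1 : ¬EmptySlice E s)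
    (h2 : ¬FullSlice E s) : sliceVol d s ≤ 2 ^ (d + 2) * min (sliceIn E s) (sliceOut E s) := by
  rcases min_choice (sliceIn E s) (sliceOut E s) with h | h <;> rw [h]
  · exact (not_le.1 h1).le
  · exact (not_le.1 h2).le

/-- Let `r` be the smaller radius. Both slices have radius at most `2 r`, so the threshold
`2^{-(d+2)}` leaves exceptional parts of at most a quarter of the `r`-ball each. By monotonicity the
bad columns must cover the remaining half, which `hδ` excludes. -/
lemma comparable_empty_full {d : ℕ} {E : Set (Euc (d + 1))} {δ r₀ : ℝ} (hr₀ : 0 < r₀)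
    (hbad : volume (badColumns E) ≤ ENNReal.ofReal δ)
    (hδ : 2 * δ < ballConst d * r₀ ^ d) {s t : ℝ} (hst : s ≤ t)
    (hs : GoodHeight E s) (ht : GoodHeight E t) (hsE : EmptySlice E s) (htF : FullSlice E t)
    (hrs : r₀ < chord s) (hrt : r₀ < chord t) (h1 : chord s ≤ 2 * chord t)
    (h2 : chord t ≤ 2 * chord s) : False := by
  set r := min (chord s) (chord t)
  have hr : r₀ < r := lt_min hrs hrt
  have hr0 : 0 < r := hr₀.trans hr
  have hω := ballConst_pos d
  have hs2 : chord s ≤ 2 * r := by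
    rcases min_choice (chord s) (chord t) with h | h <;> simp only [r, h] <;>
      linarith [hr₀.trans hrs]
  have ht2 : chord t ≤ 2 * r := by
    rcases min_choice (chord s) (chord t) with h | h <;> simp only [r, h] <;>
      linarith [hr₀.trans hrt]
  have key : ∀ (u : ℝ) (m : ℝ≥0∞), 0 < chord u → chord u ≤ 2 * r →
      2 ^ (d + 2) * m ≤ sliceVol d u → m ≤ ENNReal.ofReal (r ^ d * ballConst d / 4) := by
    intro u m hu0 hu hm
    have h3 : sliceVol d u ≤ 2 ^ (d + 2) * ENNReal.ofReal (r ^ d * ballConst d / 4) := by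
      rw [show sliceVol d u = _ from volume_ball_eq 0 hu0]
      have : (2 : ℝ≥0∞) ^ (d + 2) = ENNReal.ofReal (2 ^ (d + 2)) := by
        rw [ENNReal.ofReal_pow (by norm_num), ENNReal.ofReal_ofNat]
      rw [this, ← ENNReal.ofReal_mul (by positivity)]
      refine ENNReal.ofReal_le_ofReal ?_
      calc chord u ^ d * ballConst d ≤ (2 * r) ^ d * ballConst d := by gcongr
        _ = _ := by rw [mul_pow]; ring
    exact (ENNReal.mul_le_mul_iff_right (by simp) (by simp)).1 (hm.trans h3)
  have h4 := volume_ball_le_of_empty_of_full hst hs ht (min_le_left _ _ : r ≤ _)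
    (min_le_right _ _ : r ≤ _)
  -- No sign is assumed for `δ`, and `ENNReal.ofReal` truncates it at 0.
  have hδ0 : volume (badColumns E) ≤ ENNReal.ofReal (max δ 0) :=
    hbad.trans (ENNReal.ofReal_le_ofReal (le_max_left _ _))
  rw [volume_ball_eq 0 hr0] at h4
  have h5 := h4.trans (add_le_add (add_le_add (key s _ (hr₀.trans hrs) hs2 hsE)
    (key t _ (hr₀.trans hrt) ht2 htF)) hδ0)
  rw [← ENNReal.ofReal_add (by positivity) (by positivity),
    ← ENNReal.ofReal_add (by positivity) (le_max_right _ _),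
    ENNReal.ofReal_le_ofReal_iff (by positivity)] at h5
  have h6 : r₀ ^ d ≤ r ^ d := by gcongr
  have h7 : 2 * max δ 0 < ballConst d * r₀ ^ d := by
    rcases max_choice δ 0 with h | h <;> rw [h]
    · exact hδ
    · rw [mul_zero]; positivity
  nlinarith

/-- The square of the chord is `1 - x²`, which changes by at most three eighths of its value at `m`
on this interval. The two factors multiply to 2, the ratio admitted in `comparable_empty_full`. -/
lemma chord_comparable {m x : ℝ} (hm : 0 < chord m) (hx : |x - m| ≤ chord m ^ 2 / 8) :
    chord m ≤ 3 / 2 * chord x ∧ chord x ≤ 4 / 3 * chord m := by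
  have hm1 := abs_lt_one_of_chord_pos hm
  have hmsq := chord_sq hm1.le
  have hr1 := chord_le_one m
  have hbound : |x ^ 2 - m ^ 2| ≤ 3 * (chord m ^ 2 / 8) := by
    have e : x ^ 2 - m ^ 2 = (x - m) * ((x - m) + 2 * m) := by ring
    rw [e, abs_mul]
    have h1 : |(x - m) + 2 * m| ≤ 3 := by
      refine (abs_add_le _ _).trans ?_
      rw [abs_mul, abs_two]
      nlinarith [abs_nonneg m]
    nlinarith [abs_nonneg (x - m)]
  rw [abs_le] at hbound
  have hx1 : |x| ≤ 1 := (sq_le_one_iff_abs_le_one x).1 (by nlinarith)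
  have hxsq := chord_sq hx1
  have hx0 := chord_nonneg x
  constructor
  · exact abs_le_of_sq_le_sq' (by nlinarith) (by positivity) |>.2
  · exact abs_le_of_sq_le_sq' (by nlinarith) (by positivity) |>.2

/-- No almost empty slice lies below an almost full slice, except near the poles. -/
lemma not_empty_below_full {d : ℕ} {E : Set (Euc (d + 1))} (hE : MeasurableSet E) {δ A r₀ : ℝ}
    (hr₀ : 0 < r₀) (hbad : volume (badColumns E) ≤ ENNReal.ofReal δ)
    (hδ : 2 * δ < ballConst d * r₀ ^ d) (hA0 : 0 ≤ A)
    (hmin : ∫⁻ s in {s | r₀ ≤ 2 * chord s}, min (sliceIn E s) (sliceOut E s) ≤ ENNReal.ofReal A)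
    (hA : 2 ^ (2 * d + 5) * A < ballConst d * r₀ ^ (d + 2)) {s t : ℝ} (hst : s ≤ t)
    (hs : GoodHeight E s) (ht : GoodHeight E t) (hsE : EmptySlice E s) (htF : FullSlice E t)
    (hrs : r₀ < chord s) (hrt : r₀ < chord t) : False := by
  have hω := ballConst_pos d
  -- Just above the supremum `m` of the almost empty heights, slices are not almost empty; nor are
  -- they almost full, because an almost empty slice of comparable size lies just below. An interval
  -- of undecided slices of length `chord m ^ 2 / 8` is more than the integral bound allows.
  set X : Set ℝ := {x | x ∈ Icc s t ∧ GoodHeight E x ∧ EmptySlice E x}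
  have hsX : s ∈ X := ⟨⟨le_rfl, hst⟩, hs, hsE⟩
  have hXb : BddAbove X := ⟨t, fun x hx => hx.1.2⟩
  set m := sSup X
  have hsm : s ≤ m := le_csSup hXb hsX
  have hmt : m ≤ t := csSup_le ⟨s, hsX⟩ fun x hx => hx.1.2
  have hchord : ∀ x ∈ Icc s t, r₀ < chord x := fun x hx =>
    (lt_min hrs hrt).trans_le (min_chord_le hx.1 hx.2)
  have hrm : r₀ < chord m := hchord m ⟨hsm, hmt⟩
  have hrm0 : 0 < chord m := hr₀.trans hrm
  set l := chord m ^ 2 / 8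
  have hl : 0 < l := by positivity
  obtain ⟨p, hp, hpm⟩ := exists_lt_of_lt_csSup ⟨s, hsX⟩ (show m - l < m by linarith)
  have hpm' : p ≤ m := le_csSup hXb hp
  have hpw : |p - m| ≤ l := abs_le.2 ⟨by linarith, by linarith⟩
  -- near `m` there are no almost full slices above `p`
  have hnofull : ∀ x ∈ Icc s t, p ≤ x → |x - m| ≤ l → GoodHeight E x → ¬FullSlice E x := by
    intro x hx hpx hxm hgx hfx
    obtain ⟨h1, h2⟩ := chord_comparable hrm0 hpw
    obtain ⟨h3, h4⟩ := chord_comparable hrm0 hxm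
    exact comparable_empty_full hr₀ hbad hδ hpx hp.2.1 hgx hp.2.2 hfx (hchord p hp.1)
      (hchord x hx) (by linarith) (by linarith)
  -- Otherwise `t`, whose slice is almost full, would itself lie in the window around `m`.
  have hmlt : m + l < t := by
    by_contra! hle
    exact hnofull t ⟨hst, le_rfl⟩ (hpm'.trans hmt) (abs_le.2 ⟨by linarith, by linarith⟩) ht htF
  have hwin : ∀ x ∈ Ioo m (m + l), x ∈ Icc s t ∧ |x - m| ≤ l := fun x hx =>
    ⟨⟨hsm.trans hx.1.le, (hx.2.trans hmlt).le⟩, abs_le.2 ⟨by linarith [hx.1], by linarith [hx.2]⟩⟩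
  have hsub : Ioo m (m + l) ⊆ {s | r₀ ≤ 2 * chord s} := fun x hx => by
    have := hchord x (hwin x hx).1
    change r₀ ≤ 2 * chord x
    linarith
  have hae : ∀ᵐ x : ℝ, x ∈ Ioo m (m + l) →
      ENNReal.ofReal ((chord m / 2) ^ d * ballConst d) ≤
        2 ^ (d + 2) * min (sliceIn E x) (sliceOut E x) := by
    filter_upwards [ae_goodHeight hE] with x hx hxw
    obtain ⟨hx1, hx2⟩ := hwin x hxw
    have hne : ¬EmptySlice E x := fun hem =>
      absurd (le_csSup hXb (show x ∈ X from ⟨hx1, hx, hem⟩)) (not_le.2 hxw.1)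
    have hnf := hnofull x hx1 (hpm'.trans hxw.1.le) hx2 hx
    refine le_trans ?_ (sliceVol_le_of_not hne hnf)
    obtain ⟨h3, -⟩ := chord_comparable hrm0 hx2
    have hx0 : 0 < chord x := hr₀.trans (hchord x hx1)
    rw [show sliceVol d x = _ from volume_ball_eq 0 hx0]
    refine ENNReal.ofReal_le_ofReal ?_
    gcongr
    linarith
  have hmm : Measurable fun x => min (sliceIn E x) (sliceOut E x) :=
    (measurable_sliceIn hE).min (measurable_sliceOut hE)
  have hint : ENNReal.ofReal ((chord m / 2) ^ d * ballConst d) * ENNReal.ofReal l ≤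
      2 ^ (d + 2) * ENNReal.ofReal A := by
    calc _ = ∫⁻ _ in Ioo m (m + l), ENNReal.ofReal ((chord m / 2) ^ d * ballConst d) := by
          rw [setLIntegral_const, Real.volume_Ioo]; congr 2; ring
      _ ≤ ∫⁻ x in Ioo m (m + l), 2 ^ (d + 2) * min (sliceIn E x) (sliceOut E x) :=
          setLIntegral_mono_ae (hmm.const_mul _).aemeasurable hae
      _ = 2 ^ (d + 2) * ∫⁻ x in Ioo m (m + l), min (sliceIn E x) (sliceOut E x) :=
          lintegral_const_mul _ hmm
      _ ≤ _ := by
          gcongr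
          exact (lintegral_mono_set hsub).trans hmin
  have h2 : (2 : ℝ≥0∞) ^ (d + 2) = ENNReal.ofReal (2 ^ (d + 2)) := by
    rw [ENNReal.ofReal_pow (by norm_num), ENNReal.ofReal_ofNat]
  rw [h2, ← ENNReal.ofReal_mul (by positivity), ← ENNReal.ofReal_mul (by positivity),
    ENNReal.ofReal_le_ofReal_iff (by positivity)] at hint
  have h3 : ballConst d * r₀ ^ (d + 2) ≤ ballConst d * chord m ^ (d + 2) := by gcongr
  have h4 : (chord m / 2) ^ d * ballConst d * l = ballConst d * chord m ^ (d + 2) / 2 ^ (d + 3) := by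
    simp only [l]; rw [div_pow]; field_simp; ring
  rw [h4, div_le_iff₀ (by positivity)] at hint
  have h5 : (2 : ℝ) ^ (d + 2) * A * 2 ^ (d + 3) = 2 ^ (2 * d + 5) * A := by
    rw [show 2 * d + 5 = (d + 2) + (d + 3) by ring, pow_add]; ring
  linarith

/-- The volume of the region near the poles. -/
lemma lintegral_sliceVol_polar_le (d : ℕ) {r₀ : ℝ} (hr₀ : 0 < r₀) :
    ∫⁻ s in {s | chord s ≤ r₀}, sliceVol d s ≤
      ENNReal.ofReal (2 * ballConst d * r₀ ^ (d + 2)) := by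
  have hω := ballConst_pos d
  set T : Set ℝ := Icc (-1) (-1 + r₀ ^ 2) ∪ Icc (1 - r₀ ^ 2) 1
  have hT : MeasurableSet T := measurableSet_Icc.union measurableSet_Icc
  have hZ : MeasurableSet {s : ℝ | chord s ≤ r₀} :=
    measurableSet_le measurable_chord measurable_const
  have hle : ∀ s ∈ {s : ℝ | chord s ≤ r₀}, sliceVol d s ≤
      T.indicator (fun _ => ENNReal.ofReal (r₀ ^ d * ballConst d)) s := by
    intro s hs
    change chord s ≤ r₀ at hs
    rcases (chord_nonneg s).eq_or_lt with h0 | h0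
    · rw [sliceVol, ← h0]; simp
    · have h1 := abs_lt_one_of_chord_pos h0
      have h2 := chord_sq h1.le
      -- Polar caps with chord at most `r₀` have height at most `r₀²`, since `1 - |s| ≤ 1 - s²`.
      have h3 : 1 - |s| ≤ r₀ ^ 2 := by
        have h5 : chord s ^ 2 ≤ r₀ ^ 2 := by gcongr
        have h6 : s ^ 2 ≤ |s| := by rw [← sq_abs]; nlinarith [abs_nonneg s]
        linarith
      have hsT : s ∈ T := by
        rcases le_total 0 s with h4 | h4
        · rw [abs_of_nonneg h4] at h1 h3
          exact Or.inr ⟨by linarith, by linarith⟩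
        · rw [abs_of_nonpos h4] at h1 h3
          exact Or.inl ⟨by linarith, by linarith⟩
      rw [indicator_of_mem hsT, show sliceVol d s = _ from volume_ball_eq 0 h0]
      refine ENNReal.ofReal_le_ofReal ?_
      gcongr
  calc _ ≤ ∫⁻ s in {s | chord s ≤ r₀},
        T.indicator (fun _ => ENNReal.ofReal (r₀ ^ d * ballConst d)) s :=
        setLIntegral_mono' hZ hle
    _ ≤ ∫⁻ s, T.indicator (fun _ => ENNReal.ofReal (r₀ ^ d * ballConst d)) s :=
        setLIntegral_le_lintegral _ _
    _ = ENNReal.ofReal (r₀ ^ d * ballConst d) * volume T := lintegral_indicator_const hT _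
    _ ≤ ENNReal.ofReal (r₀ ^ d * ballConst d) * ENNReal.ofReal (2 * r₀ ^ 2) := by
        gcongr
        refine (measure_union_le _ _).trans ?_
        rw [Real.volume_Icc, Real.volume_Icc, ← ENNReal.ofReal_add (by ring_nf; positivity)
          (by ring_nf; positivity)]
        exact ENNReal.ofReal_le_ofReal (by linarith)
    _ = _ := by
        rw [← ENNReal.ofReal_mul (by positivity)]
        congr 1; ring

/-- The constant in the estimate for the distance to a half-space. -/
def halfSpaceConst (d : ℕ) : ℝ :=
  (1 + 2 ^ (d + 2)) * (2 * 4 ^ (d + 1) * d) + 2 * (2 ^ (2 * d + 6) * (2 * 4 ^ (d + 1) * d))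

/-- At the transition height `t` the almost full slices end. Away from the poles, a decided slice
differs from the half-space by the smaller of its two portions and an undecided one by a multiple of
it; both are controlled by the Poincaré estimate. The polar region is controlled by its volume. -/
lemma closeToHalfSpace_of_upVar_le {d : ℕ} (hd : 0 < d) {E : Set (Euc (d + 1))}
    (hE : MeasurableSet E) {δ : ℝ} (hδ : 0 < δ)
    (hhor : ∀ w : Euc d, upVar E (join w 0) ≤ ENNReal.ofReal (d * δ * ‖w‖))
    (hvert : upVar E (EuclideanSpace.single (Fin.last d) 1) ≤ ENNReal.ofReal δ) :
    CloseToHalfSpace E (halfSpaceConst d * δ) := by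
  have hω := ballConst_pos d
  have hd1 : (1 : ℝ) ≤ d := by exact_mod_cast hd
  have hbad := (volume_badColumns_le hE).trans hvert
  set A := 2 * 4 ^ (d + 1) * d * δ
  have hA0 : 0 < A := by positivity
  -- The polar radius is defined by `ballConst d * r₀ ^ (d + 2) = 2 ^ (2 * d + 6) * A`: twice the
  -- threshold needed in `not_empty_below_full`, yet still a multiple of `δ`, so that the polar
  -- volume is of order `δ` too.
  set q := 2 ^ (2 * d + 6) * A / ballConst d
  have hq : 0 < q := by positivity
  set r₀ : ℝ := q ^ ((1 : ℝ) / ((d + 2 : ℕ) : ℝ))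
  have hr₀ : 0 < r₀ := Real.rpow_pos_of_pos hq _
  have hr₀q : r₀ ^ (d + 2) = q := by
    simp only [r₀]
    rw [one_div, Real.rpow_inv_natCast_pow hq.le (by omega)]
  have hωq : ballConst d * q = 2 ^ (2 * d + 6) * A := by simp only [q]; field_simp
  have hmin := lintegral_min_slice_le hE hδ.le hhor hr₀
  have hA : 2 ^ (2 * d + 5) * A < ballConst d * r₀ ^ (d + 2) := by
    rw [hr₀q, hωq, pow_succ 2 (2 * d + 5)]
    have : 0 < 2 ^ (2 * d + 5) * A := by positivity
    linarith
  -- If `r₀ ≥ 1`, the polar region is everything and the ordering of slices is not needed.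
  have hδr : r₀ < 1 → 2 * δ < ballConst d * r₀ ^ d := by
    intro h1
    have h2 : r₀ ^ (d + 2) ≤ r₀ ^ d := pow_le_pow_of_le_one hr₀.le h1.le (by omega)
    have h3 : (1 : ℝ) ≤ 2 ^ (2 * d + 5) := one_le_pow₀ (by norm_num)
    have h4 : (4 : ℝ) ≤ 4 ^ (d + 1) := by
      calc (4 : ℝ) = 4 ^ 1 := by norm_num
        _ ≤ _ := pow_le_pow_right₀ (by norm_num) (by omega)
    have h5 : 2 * δ ≤ A := by
      have : (1 : ℝ) ≤ 4 ^ (d + 1) * d := by nlinarith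
      calc 2 * δ = 2 * 1 * δ := by ring
        _ ≤ 2 * (4 ^ (d + 1) * d) * δ := by gcongr
        _ = A := by simp only [A]; ring
    have h6 : A ≤ 2 ^ (2 * d + 5) * A := le_mul_of_one_le_left hA0.le h3
    have h7 : ballConst d * r₀ ^ (d + 2) ≤ ballConst d * r₀ ^ d := by gcongr
    linarith
  have hnot : ∀ s t : ℝ, s ≤ t → GoodHeight E s → GoodHeight E t → EmptySlice E s →
      FullSlice E t → r₀ < chord s → r₀ < chord t → False := fun s t hst hs ht hsE htF hrs hrt =>
    not_empty_below_full hE hr₀ hbad (hδr (hrs.trans_le (chord_le_one s))) hA0.le hmin hA hst hs ht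
      hsE htF hrs hrt
  -- The extra point `-1` keeps the set nonempty and gives `t = -1` when no slice is almost full.
  set X : Set ℝ := insert (-1) {x | GoodHeight E x ∧ FullSlice E x ∧ r₀ < chord x}
  have hXIcc : ∀ x ∈ X, -1 ≤ x ∧ x ≤ 1 := by
    rintro x (rfl | hx)
    · norm_num
    · exact abs_le.1 (abs_lt_one_of_chord_pos (hr₀.trans hx.2.2)).le
  have hXb : BddAbove X := ⟨1, fun x hx => (hXIcc x hx).2⟩
  have hXn : X.Nonempty := ⟨-1, mem_insert _ _⟩
  set t := sSup X
  have ht1 : -1 ≤ t := le_csSup hXb (mem_insert _ _)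
  have ht2 : t ≤ 1 := csSup_le hXn fun x hx => (hXIcc x hx).2
  refine ⟨t, ⟨ht1, ht2⟩, ?_⟩
  set mn : ℝ → ℝ≥0∞ := fun s => min (sliceIn E s) (sliceOut E s)
  have hmnm : Measurable mn := (measurable_sliceIn hE).min (measurable_sliceOut hE)
  set Z : Set ℝ := {s | r₀ ≤ 2 * chord s}
  have hZ : MeasurableSet Z := measurableSet_le measurable_const (measurable_chord.const_mul 2)
  set Y : Set ℝ := {s | chord s ≤ r₀}
  have hY : MeasurableSet Y := measurableSet_le measurable_chord measurable_const
  have hvertm : Measurable (vert : Euc (d + 1) → ℝ) := by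
    have := measurable_snd.comp (splitEquiv d).measurable
    simpa only [Function.comp_def, splitEquiv_apply] using this
  have hSm : MeasurableSet (symmDiff E {x | vert x ≤ t} ∩ Metric.ball 0 1) :=
    (hE.symmDiff (measurableSet_le hvertm measurable_const)).inter measurableSet_ball
  rw [volume_eq_lintegral_slice hSm]
  have hslice : ∀ s : ℝ, (t < s → volume {y : Euc d | join y s ∈
        symmDiff E {x | vert x ≤ t} ∩ Metric.ball 0 1} ≤ sliceIn E s) ∧
      (s < t → volume {y : Euc d | join y s ∈
        symmDiff E {x | vert x ≤ t} ∩ Metric.ball 0 1} ≤ sliceOut E s) := by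
    intro s
    constructor <;> intro hst <;> refine measure_mono ?_ <;> rintro y ⟨hy1, hy2⟩ <;>
      rw [join_mem_ball_iff_mem_ball] at hy2 <;> refine ⟨hy2, ?_⟩ <;>
      rcases hy1 with ⟨h1, h2⟩ | ⟨h1, h2⟩
    · exact h1
    · have : vert (join y s) ≤ t := h1
      rw [vert_join] at this
      linarith
    · exact absurd (by rw [mem_ofPred_eq, vert_join]; exact hst.le) h2
    · exact h2
  have hpt : ∀ᵐ s : ℝ, s ≠ t := by simp [ae_iff]
  have hpw : ∀ᵐ s : ℝ, volume {y : Euc d | join y s ∈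
        symmDiff E {x | vert x ≤ t} ∩ Metric.ball 0 1} ≤
      Z.indicator (fun s => (1 + 2 ^ (d + 2)) * mn s) s + Y.indicator (sliceVol d) s := by
    filter_upwards [ae_goodHeight hE, hpt] with s hs hst
    have hle : volume {y : Euc d | join y s ∈
        symmDiff E {x | vert x ≤ t} ∩ Metric.ball 0 1} ≤ sliceVol d s :=
      measure_mono fun y hy => (join_mem_ball_iff_mem_ball y s).1 hy.2
    rcases le_or_gt (chord s) r₀ with hc | hc
    · rw [indicator_of_mem (s := Y) hc]
      exact hle.trans le_add_self
    · have hsZ : s ∈ Z := by change r₀ ≤ 2 * chord s; linarith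
      rw [indicator_of_mem hsZ]
      refine le_add_of_le_left ?_
      by_cases hU : ¬EmptySlice E s ∧ ¬FullSlice E s
      · refine hle.trans ((sliceVol_le_of_not hU.1 hU.2).trans ?_)
        gcongr
        exact le_add_self
      · refine le_trans ?_ (le_mul_of_one_le_left zero_le le_self_add)
        have hcases : EmptySlice E s ∨ FullSlice E s := by tauto
        have hcomp : ∀ a b : ℝ≥0∞, a + b = sliceVol d s → 2 ^ (d + 2) * a ≤ sliceVol d s →
            a ≤ b := by
          intro a b hab ha
          by_contra! hlt
          have hatop : a ≠ ∞ := by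
            refine ne_top_of_le_ne_top ?_ (le_self_add (a := a) (b := b))
            rw [hab]; exact measure_ball_lt_top.ne
          have h1 : a + b < 2 * a := by
            rw [two_mul]; exact ENNReal.add_lt_add_left hatop hlt
          have h2 : 2 * a ≤ 2 ^ (d + 2) * a := by
            gcongr
            calc (2 : ℝ≥0∞) = 2 ^ 1 := by norm_num
              _ ≤ _ := pow_le_pow_right₀ (by norm_num) (by omega)
          rw [hab] at h1
          exact absurd (h1.trans_le h2) (not_lt.2 ha)
        rcases lt_or_gt_of_ne hst with hlt | hgt
        · have hfull : FullSlice E s := by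
            refine hcases.resolve_left fun hem => ?_
            obtain ⟨x, hxX, hsx⟩ := exists_lt_of_lt_csSup hXn hlt
            rcases hxX with rfl | hx
            · linarith [(abs_lt.1 (abs_lt_one_of_chord_pos (hr₀.trans hc))).1]
            · exact hnot s x hsx.le hs hx.1 hem hx.2.1 hc hx.2.2
          refine ((hslice s).2 hlt).trans (le_min ?_ le_rfl)
          exact hcomp _ _ (by rw [add_comm]; exact sliceIn_add_sliceOut hE s) hfull
        · have hempty : EmptySlice E s := by
            refine hcases.resolve_right fun hf => ?_
            have : s ≤ t := le_csSup hXb (Or.inr ⟨hs, hf, hc⟩)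
            linarith
          refine ((hslice s).1 hgt).trans (le_min le_rfl ?_)
          exact hcomp _ _ (sliceIn_add_sliceOut hE s) hempty
  calc _ ≤ ∫⁻ s, (Z.indicator (fun s => (1 + 2 ^ (d + 2)) * mn s) s +
        Y.indicator (sliceVol d) s) := lintegral_mono_ae hpw
    _ = (1 + 2 ^ (d + 2)) * (∫⁻ s in Z, mn s) + ∫⁻ s in Y, sliceVol d s := by
        rw [lintegral_add_left ((hmnm.const_mul _).indicator hZ), lintegral_indicator hZ,
          lintegral_indicator hY, lintegral_const_mul _ hmnm]
    _ ≤ (1 + 2 ^ (d + 2)) * ENNReal.ofReal A +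
        ENNReal.ofReal (2 * ballConst d * r₀ ^ (d + 2)) := by
        gcongr
        exact lintegral_sliceVol_polar_le d hr₀
    _ = ENNReal.ofReal (halfSpaceConst d * δ) := by
        have h2 : (1 + 2 ^ (d + 2) : ℝ≥0∞) = ENNReal.ofReal (1 + 2 ^ (d + 2)) := by
          rw [ENNReal.ofReal_add zero_le_one (by positivity), ENNReal.ofReal_one,
            ENNReal.ofReal_pow (by norm_num), ENNReal.ofReal_ofNat]
        rw [h2, ← ENNReal.ofReal_mul (by positivity),
          ← ENNReal.ofReal_add (by positivity) (by positivity), mul_assoc 2, hr₀q, hωq]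
        congr 1
        simp only [A, halfSpaceConst]; ring

/-! ### The nonlocal perimeter as an integral over pairs of points -/

/-- The pairs of a point of `E` and a point of its complement, not both outside `Ω`. -/
def pairRegion {n : ℕ} (Ω E : Set (Euc n)) : Set (Euc n × Euc n) :=
  {p | p.1 ∈ E ∧ p.2 ∉ E ∧ (p.1 ∈ Ω ∨ p.2 ∈ Ω)}

/-- The kernel as a function of pairs of points. -/
def pairKernel {n : ℕ} (K : Euc n → ℝ) (p : Euc n × Euc n) : ℝ≥0∞ := ENNReal.ofReal (K (p.1 - p.2))

lemma IsKernel.measurable {n : ℕ} {K Ks : Euc n → ℝ} (hK : IsKernel K Ks) : Measurable K :=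
  measurable_of_continuousOn_compl_singleton 0 hK.differentiable.continuousOn

lemma measurable_pairKernel {n : ℕ} {K : Euc n → ℝ} (hK : Measurable K) :
    Measurable (pairKernel K) :=
  (hK.comp (measurable_fst.sub measurable_snd)).ennreal_ofReal

lemma measurableSet_pairRegion {n : ℕ} {Ω E : Set (Euc n)} (hΩ : MeasurableSet Ω)
    (hE : MeasurableSet E) : MeasurableSet (pairRegion Ω E) :=
  (measurable_fst hE).inter ((measurable_snd hE.compl).inter
    ((measurable_fst hΩ).union (measurable_snd hΩ)))

lemma interaction_eq {n : ℕ} {K : Euc n → ℝ} (hK : Measurable K) {A B : Set (Euc n)} :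
    interaction K A B = ∫⁻ p in A ×ˢ B, pairKernel K p := by
  rw [Measure.volume_eq_prod, ← Measure.prod_restrict, lintegral_prod _
    (measurable_pairKernel hK).aemeasurable]
  rfl

lemma perKIn_eq {n : ℕ} {K : Euc n → ℝ} (hK : Measurable K) {Ω E : Set (Euc n)}
    (hΩ : MeasurableSet Ω) (hE : MeasurableSet E) :
    perKIn K Ω E = ∫⁻ p in pairRegion Ω E, pairKernel K p := by
  rw [perKIn, interaction_eq hK, interaction_eq hK, interaction_eq hK,
    ← lintegral_union ((hE.inter hΩ).prod (hE.compl.diff hΩ)),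
    ← lintegral_union ((hE.diff hΩ).prod (hE.compl.inter hΩ))]
  · congr 2
    ext ⟨x, y⟩
    simp only [pairRegion, mem_union, mem_prod, mem_inter_iff, mem_sdiff, mem_compl_iff,
      mem_ofPred_eq]
    tauto
  · rw [Set.disjoint_left]
    rintro ⟨x, y⟩ (⟨h1, h2⟩ | ⟨h1, h2⟩) ⟨h3, h4⟩ <;> exact h3.2 h1.2
  · rw [Set.disjoint_left]
    rintro ⟨x, y⟩ ⟨h1, h2⟩ ⟨h3, h4⟩
    exact h4.2 h2.2

lemma perK_eq {n : ℕ} {K : Euc n → ℝ} (hK : Measurable K) {E : Set (Euc n)} :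
    perK K E = ∫⁻ p in E ×ˢ Eᶜ, pairKernel K p := interaction_eq hK

lemma lintegral_compl_prod_eq_perK {n : ℕ} {K : Euc n → ℝ} (hK : Measurable K)
    (heven : ∀ z, K (-z) = K z) {E : Set (Euc n)} :
    ∫⁻ p in Eᶜ ×ˢ E, pairKernel K p = perK K E := by
  rw [perK_eq hK]
  have h := (Measure.measurePreserving_swap (μ := (volume : Measure (Euc n)))
    (ν := (volume : Measure (Euc n)))).setLIntegral_comp_preimage_emb
    (MeasurableEquiv.prodComm (α := Euc n) (β := Euc n)).measurableEmbedding (pairKernel K) (E ×ˢ Eᶜ)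
  rw [Measure.volume_eq_prod, ← h]
  have h1 : (Prod.swap ⁻¹' (E ×ˢ Eᶜ) : Set (Euc n × Euc n)) = Eᶜ ×ˢ E := by
    ext ⟨x, y⟩; simp
  have h2 : ∀ p : Euc n × Euc n, pairKernel K p.swap = pairKernel K p := fun p => by
    simp only [pairKernel, Prod.fst_swap, Prod.snd_swap]
    rw [← heven, neg_sub]
  rw [h1]
  simp only [h2]

/-- The pairs of a point of `E \ F` and a point of `F \ E`. -/
def diffPairs {n : ℕ} (E F : Set (Euc n)) : Set (Euc n × Euc n) := (E \ F) ×ˢ (F \ E)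

/-- Submodularity of the nonlocal perimeter. -/
lemma lintegral_pairRegion_union_add_inter {n : ℕ} {f : Euc n × Euc n → ℝ≥0∞} (hf : Measurable f)
    {Ω E F : Set (Euc n)} (hΩ : MeasurableSet Ω) (hE : MeasurableSet E) (hF : MeasurableSet F)
    (hEF : F \ Ω = E \ Ω) :
    (∫⁻ p in pairRegion Ω (E ∪ F), f p) + (∫⁻ p in pairRegion Ω (E ∩ F), f p) +
      (∫⁻ p in diffPairs E F, f p) + (∫⁻ p in diffPairs F E, f p) ≤
    (∫⁻ p in pairRegion Ω E, f p) + ∫⁻ p in pairRegion Ω F, f p := by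
  have hm := fun A hA => measurableSet_pairRegion (n := n) (E := A) hΩ hA
  have h1 : MeasurableSet (diffPairs E F) := (hE.diff hF).prod (hF.diff hE)
  have h2 : MeasurableSet (diffPairs F E) := (hF.diff hE).prod (hE.diff hF)
  rw [← lintegral_indicator (hm _ (hE.union hF)), ← lintegral_indicator (hm _ (hE.inter hF)),
    ← lintegral_indicator (hm _ hE), ← lintegral_indicator (hm _ hF), ← lintegral_indicator h1,
    ← lintegral_indicator h2,
    ← lintegral_add_right _ (hf.indicator (hm _ (hE.inter hF))),
    ← lintegral_add_right _ (hf.indicator (hm _ hF)), ← lintegral_add_right _ (hf.indicator h1),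
    ← lintegral_add_right _ (hf.indicator h2)]
  refine lintegral_mono fun p => ?_
  obtain ⟨x, y⟩ := p
  have hx : x ∉ Ω → (x ∈ F ↔ x ∈ E) := fun hx =>
    ⟨fun h => ((hEF.le : F \ Ω ⊆ E \ Ω) ⟨h, hx⟩).1, fun h => ((hEF.ge : E \ Ω ⊆ F \ Ω) ⟨h, hx⟩).1⟩
  have hy : y ∉ Ω → (y ∈ F ↔ y ∈ E) := fun hx =>
    ⟨fun h => ((hEF.le : F \ Ω ⊆ E \ Ω) ⟨h, hx⟩).1, fun h => ((hEF.ge : E \ Ω ⊆ F \ Ω) ⟨h, hx⟩).1⟩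
  -- The inequality is pointwise. A pair between `E \ F` and `F \ E` contributes to the energy of
  -- `E` or of `F` but to neither the union nor the intersection. Since the sets agree off `Ω`, such
  -- a pair lies in `Ω × Ω` and is really counted.
  by_cases a1 : x ∈ E <;> by_cases a2 : x ∈ F <;> by_cases a3 : y ∈ E <;> by_cases a4 : y ∈ F <;>
    by_cases a5 : x ∈ Ω <;> by_cases a6 : y ∈ Ω <;>
    simp_all [pairRegion, diffPairs, indicator]

/-- A minimizer has no more energy in a smaller ball than the ball itself. -/
lemma IsMinimizer.lintegral_pairRegion_le {n : ℕ} {K : Euc n → ℝ} (hK : Measurable K)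
    (heven : ∀ z, K (-z) = K z) {R : ℝ} {E : Set (Euc n)} (hE : MeasurableSet E)
    (hmin : IsMinimizer K (Metric.ball 0 R) E) {ρ : ℝ} (hρ : ρ ≤ R) :
    ∫⁻ p in pairRegion (Metric.ball 0 ρ) E, pairKernel K p ≤ perK K (Metric.ball 0 ρ) := by
  set B := Metric.ball (0 : Euc n) ρ
  have hB : MeasurableSet B := measurableSet_ball
  have hBR : B ⊆ Metric.ball 0 R := Metric.ball_subset_ball hρ
  -- The competitor empties the smaller ball, so the pairs it has there join the complement of the
  -- ball to the ball.
  set F := E \ B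
  have hF : MeasurableSet F := hE.diff hB
  have h1 := hmin.minimal F hF.nullMeasurableSet (by
    ext x
    simp only [F, mem_sdiff]
    exact ⟨fun h => ⟨h.1.1, h.2⟩, fun h => ⟨⟨h.1, fun hb => h.2 (hBR hb)⟩, h.2⟩⟩)
  have hfin := hmin.finite
  rw [perKIn_eq hK measurableSet_ball hE] at h1 hfin
  rw [perKIn_eq hK measurableSet_ball hF] at h1
  -- the pairs outside the smaller ball
  set T : Set (Euc n × Euc n) := {p | p.1 ∉ B ∧ p.2 ∉ B}
  have hT : MeasurableSet T := (measurable_fst hB.compl).inter (measurable_snd hB.compl)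
  have hsplit : ∀ A : Set (Euc n), ∫⁻ p in pairRegion (Metric.ball 0 R) A, pairKernel K p =
      (∫⁻ p in pairRegion (Metric.ball 0 R) A ∩ T, pairKernel K p) +
        ∫⁻ p in pairRegion B A, pairKernel K p := by
    intro A
    rw [← lintegral_inter_add_sdiff _ _ hT]
    congr 2
    have : pairRegion (Metric.ball 0 R) A \ T = pairRegion B A := by
      ext p
      simp only [pairRegion, T, mem_sdiff, mem_ofPred_eq]
      constructor
      · rintro ⟨⟨h1, h2, h3⟩, h4⟩
        exact ⟨h1, h2, by tauto⟩
      · rintro ⟨h1, h2, h3⟩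
        refine ⟨⟨h1, h2, h3.imp (fun h => hBR h) (fun h => hBR h)⟩, by tauto⟩
    rw [this]
  have hsame : pairRegion (Metric.ball 0 R) F ∩ T = pairRegion (Metric.ball 0 R) E ∩ T := by
    ext p
    simp only [pairRegion, T, F, mem_inter_iff, mem_sdiff, mem_ofPred_eq]
    tauto
  rw [hsplit E, hsplit F, hsame] at h1
  rw [hsplit E] at hfin
  -- Pairs with both points outside `B` are the same for `E` and `F`, and their energy is finite, so
  -- it cancels.
  have h2 := (ENNReal.add_le_add_iff_left (ne_top_of_le_ne_top hfin le_self_add)).1 h1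
  refine h2.trans ?_
  rw [← lintegral_compl_prod_eq_perK hK heven]
  refine lintegral_mono_set ?_
  rintro p ⟨h3, h4, h5⟩
  refine ⟨h3.2, h5.resolve_left h3.2⟩

/-! ### Cutoff functions and the perturbations of the identity that they generate -/

/-- A cutoff function between the ball of radius `2` and the ball of radius `R` whose slope at
distance `ρ` from the origin is at most `M ρ`. -/
structure IsCutoff {n : ℕ} (φ : Euc n → ℝ) (M : ℝ → ℝ) (R : ℝ) : Prop where
  differentiable : Differentiable ℝ φ
  one : ∀ x, ‖x‖ ≤ 2 → φ x = 1
  zero : ∀ x, R ≤ ‖x‖ → φ x = 0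
  lip : ∀ x y, |φ x - φ y| ≤ M (min ‖x‖ ‖y‖) * ‖x - y‖
  continuous : Continuous M
  antitone : Antitone M
  nonneg : ∀ ρ, 0 ≤ M ρ

/-- The translation by `t v`, cut off by `φ`. -/
def perturb {n : ℕ} (φ : Euc n → ℝ) (v : Euc n) (t : ℝ) (x : Euc n) : Euc n := x + (t * φ x) • v

namespace IsCutoff

variable {n : ℕ} {φ : Euc n → ℝ} {M : ℝ → ℝ} {R : ℝ}

lemma norm_fderiv_le (h : IsCutoff φ M R) (x : Euc n) : ‖fderiv ℝ φ x‖ ≤ M ‖x‖ := by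
  refine le_of_forall_gt_imp_ge_of_dense fun c hc => ?_
  refine norm_fderiv_le_of_lip' ℝ ((h.nonneg _).trans hc.le) ?_
  have hcont : Continuous fun y : Euc n => M (min ‖y‖ ‖x‖) :=
    h.continuous.comp (continuous_norm.min continuous_const)
  have hx : M (min ‖x‖ ‖x‖) < c := by rwa [min_self]
  filter_upwards [hcont.continuousAt.eventually (gt_mem_nhds hx)] with y hy
  exact (h.lip y x).trans (by gcongr)

lemma lip_zero (h : IsCutoff φ M R) (x y : Euc n) : |φ x - φ y| ≤ M 0 * ‖x - y‖ :=
  (h.lip x y).trans (mul_le_mul_of_nonneg_right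
    (h.antitone (le_min (norm_nonneg _) (norm_nonneg _))) (norm_nonneg _))

/-- The perturbation differs from the identity by a map with Lipschitz constant at most one half,
hence it is a homeomorphism. -/
lemma approximatesLinearOn (h : IsCutoff φ M R) {v : Euc n} (hv : ‖v‖ = 1) {t : ℝ}
    (ht : |t| * M 0 ≤ 1 / 2) :
    ApproximatesLinearOn (perturb φ v t) (ContinuousLinearEquiv.refl ℝ (Euc n) : Euc n →L[ℝ] Euc n)
      univ (1 / 2 : NNReal) := by
  intro x _ y _
  have e : perturb φ v t x - perturb φ v t y -
      (ContinuousLinearEquiv.refl ℝ (Euc n) : Euc n →L[ℝ] Euc n) (x - y) =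
      (t * (φ x - φ y)) • v := by
    simp only [perturb, ContinuousLinearEquiv.coe_coe, ContinuousLinearEquiv.refl_apply]
    rw [mul_sub, sub_smul]; abel
  rw [e, norm_smul, hv, mul_one, Real.norm_eq_abs, abs_mul]
  have h1 := h.lip_zero x y
  have : ((1 / 2 : NNReal) : ℝ) = 1 / 2 := by simp
  rw [this]
  calc |t| * |φ x - φ y| ≤ |t| * (M 0 * ‖x - y‖) := by gcongr
    _ = |t| * M 0 * ‖x - y‖ := by ring
    _ ≤ _ := by gcongr

/-- The perturbation of the identity as a homeomorphism. -/
def toHomeo (h : IsCutoff φ M R) {v : Euc n} (hv : ‖v‖ = 1) {t : ℝ}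
    (ht : |t| * M 0 ≤ 1 / 2) : Euc n ≃ₜ Euc n :=
  (h.approximatesLinearOn hv ht).toHomeomorph _ (by
    right
    have : Nontrivial (Euc n) := ⟨⟨v, 0, fun h0 => by simp [h0] at hv⟩⟩
    have h1 : ‖((ContinuousLinearEquiv.refl ℝ (Euc n)).symm : Euc n →L[ℝ] Euc n)‖₊ = 1 :=
      ContinuousLinearMap.nnnorm_id
    rw [h1, inv_one]
    exact NNReal.half_lt_self one_ne_zero)

lemma perturb_of_le_two (h : IsCutoff φ M R) (v : Euc n) (t : ℝ) {x : Euc n} (hx : ‖x‖ ≤ 2) :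
    perturb φ v t x = x + t • v := by
  rw [perturb, h.one x hx, mul_one]

lemma perturb_of_le_norm (h : IsCutoff φ M R) (v : Euc n) (t : ℝ) {x : Euc n} (hx : R ≤ ‖x‖) :
    perturb φ v t x = x := by
  rw [perturb, h.zero x hx, mul_zero, zero_smul, add_zero]

lemma perturb_mem_ball_iff (h : IsCutoff φ M R) {v : Euc n} (hv : ‖v‖ = 1) {t : ℝ}
    (ht : |t| * M 0 ≤ 1 / 2) (x : Euc n) :
    perturb φ v t x ∈ Metric.ball (0 : Euc n) R ↔ x ∈ Metric.ball (0 : Euc n) R := by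
  simp only [mem_ball_zero_iff]
  constructor
  · intro h1
    by_contra! h2
    rw [h.perturb_of_le_norm v t h2] at h1
    linarith
  · intro h1
    by_contra! h2
    have h3 := h.perturb_of_le_norm v t h2
    have h4 : perturb φ v t x = x := (h.toHomeo hv ht).injective h3
    rw [h4] at h2
    linarith

lemma hasFDerivAt_perturb (h : IsCutoff φ M R) (v : Euc n) (t : ℝ) (x : Euc n) :
    HasFDerivAt (perturb φ v t)
      (ContinuousLinearMap.id ℝ (Euc n) + (t • fderiv ℝ φ x).smulRight v) x := by
  have h1 := ((h.differentiable x).hasFDerivAt.const_mul t).smul_const v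
  exact (hasFDerivAt_id x).add h1

/-- The derivative is a rank-one perturbation of the identity, that is, a transvection. -/
lemma det_perturb (v : Euc n) (t : ℝ) (x : Euc n) :
    (ContinuousLinearMap.id ℝ (Euc n) + (t • fderiv ℝ φ x).smulRight v).det =
      1 + t * fderiv ℝ φ x v := by
  have : ((ContinuousLinearMap.id ℝ (Euc n) + (t • fderiv ℝ φ x).smulRight v :
      Euc n →L[ℝ] Euc n) : Euc n →ₗ[ℝ] Euc n) =
      LinearMap.transvection ((t • fderiv ℝ φ x : Euc n →L[ℝ] ℝ) : Euc n →ₗ[ℝ] ℝ) v := by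
    ext1 y
    simp [LinearMap.transvection.apply]
  rw [ContinuousLinearMap.det, this, LinearMap.transvection.det]
  simp

lemma abs_fderiv_le (h : IsCutoff φ M R) {v : Euc n} (hv : ‖v‖ = 1) (x : Euc n) :
    |fderiv ℝ φ x v| ≤ M ‖x‖ := by
  have := (fderiv ℝ φ x).le_opNorm v
  rw [hv, mul_one] at this
  exact this.trans (h.norm_fderiv_le x)

/-- Change of variables in the nonlocal perimeter. -/
lemma lintegral_pairRegion_image (h : IsCutoff φ M R) {v : Euc n} (hv : ‖v‖ = 1) {t : ℝ}
    (ht : |t| * M 0 ≤ 1 / 2) {E : Set (Euc n)} (hE : MeasurableSet E) (f : Euc n × Euc n → ℝ≥0∞) :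
    ∫⁻ p in pairRegion (Metric.ball 0 R) (perturb φ v t '' E), f p =
      ∫⁻ p in pairRegion (Metric.ball 0 R) E,
        ENNReal.ofReal ((1 + t * fderiv ℝ φ p.1 v) * (1 + t * fderiv ℝ φ p.2 v)) *
          f (perturb φ v t p.1, perturb φ v t p.2) := by
  have hinj : Function.Injective (perturb φ v t) := (h.toHomeo hv ht).injective
  have hsurj : Function.Surjective (perturb φ v t) := (h.toHomeo hv ht).surjective
  have himg : pairRegion (Metric.ball 0 R) (perturb φ v t '' E) =
      Prod.map (perturb φ v t) (perturb φ v t) '' pairRegion (Metric.ball 0 R) E := by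
    ext ⟨x', y'⟩
    obtain ⟨x, rfl⟩ := hsurj x'
    obtain ⟨y, rfl⟩ := hsurj y'
    have h1 : (perturb φ v t x, perturb φ v t y) = Prod.map (perturb φ v t) (perturb φ v t) (x, y) :=
      rfl
    rw [h1, (hinj.prodMap hinj).mem_set_image]
    simp only [pairRegion, mem_ofPred_eq, Prod.map_fst, Prod.map_snd, hinj.mem_set_image,
      h.perturb_mem_ball_iff hv ht]
  set D : Euc n → Euc n →L[ℝ] Euc n := fun x =>
    ContinuousLinearMap.id ℝ (Euc n) + (t • fderiv ℝ φ x).smulRight v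
  have hder : ∀ p ∈ pairRegion (Metric.ball 0 R) E, HasFDerivWithinAt
      (Prod.map (perturb φ v t) (perturb φ v t)) ((D p.1).prodMap (D p.2))
      (pairRegion (Metric.ball 0 R) E) p := fun p _ =>
    (HasFDerivAt.prodMap p (h.hasFDerivAt_perturb v t p.1)
      (h.hasFDerivAt_perturb v t p.2)).hasFDerivWithinAt
  have : (volume : Measure (Euc n × Euc n)).IsAddHaarMeasure :=
    Measure.prod.instIsAddHaarMeasure volume volume
  rw [himg, lintegral_image_eq_lintegral_abs_det_fderiv_mul volume
    (measurableSet_pairRegion measurableSet_ball hE) hder (hinj.prodMap hinj).injOn]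
  refine lintegral_congr fun p => ?_
  have hJ : ∀ x, 0 ≤ 1 + t * fderiv ℝ φ x v := by
    intro x
    have h1 : |t * fderiv ℝ φ x v| ≤ 1 / 2 := by
      rw [abs_mul]
      exact le_trans (mul_le_mul_of_nonneg_left ((h.abs_fderiv_le hv x).trans
        (h.antitone (norm_nonneg x))) (abs_nonneg t)) ht
    linarith [(abs_le.1 h1).1]
  have hdet : ((D p.1).prodMap (D p.2)).det = (1 + t * fderiv ℝ φ p.1 v) * (1 + t * fderiv ℝ φ p.2 v)
      := by
    rw [← det_perturb, ← det_perturb]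
    exact LinearMap.det_prodMap (D p.1 : Euc n →ₗ[ℝ] Euc n) (D p.2 : Euc n →ₗ[ℝ] Euc n)
  rw [hdet, abs_of_nonneg (mul_nonneg (hJ _) (hJ _))]
  rfl

end IsCutoff

/-! ### Second order estimates for the kernel -/

namespace IsKernel

variable {n : ℕ} {K Ks : Euc n → ℝ}

lemma hasDerivAt_line (hK : IsKernel K Ks) (z v : Euc n) {s : ℝ} (hs : z + s • v ≠ 0) :
    HasDerivAt (fun u : ℝ => K (z + u • v)) (fderiv ℝ K (z + s • v) v) s := by
  have h1 : HasFDerivAt K (fderiv ℝ K (z + s • v)) (z + s • v) :=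
    (hK.differentiable.differentiableAt (isOpen_compl_singleton.mem_nhds hs)).hasFDerivAt
  have h2 : HasDerivAt (fun u : ℝ => z + u • v) v s := by
    simpa using ((hasDerivAt_id s).smul_const v).const_add z
  exact h1.comp_hasDerivAt s h2

lemma hasDerivAt_fderiv_line (hK : IsKernel K Ks) (z v : Euc n) {s : ℝ} (hs : z + s • v ≠ 0) :
    HasDerivAt (fun u : ℝ => fderiv ℝ K (z + u • v) v)
      (fderiv ℝ (fderiv ℝ K) (z + s • v) v v) s := by
  have h1 : HasFDerivAt (fderiv ℝ K) (fderiv ℝ (fderiv ℝ K) (z + s • v)) (z + s • v) :=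
    (hK.differentiable_fderiv.differentiableAt
      (isOpen_compl_singleton.mem_nhds hs)).hasFDerivAt
  have h2 : HasDerivAt (fun u : ℝ => z + u • v) v s := by
    simpa using ((hasDerivAt_id s).smul_const v).const_add z
  have h3 := h1.comp_hasDerivAt s h2
  simpa using h3.clm_apply (hasDerivAt_const s v)

/-- The mean value inequality is applied twice along the segment, first to the directional
derivative and then to `K` minus its linear part. It needs no continuity of the second derivative.
The bound on `s` keeps the segment in the ball where the second derivative is controlled, and away
from 0. -/
lemma abs_taylor_le (hK : IsKernel K Ks) {z v : Euc n} (hz : z ≠ 0) (hv : ‖v‖ = 1) {s : ℝ}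
    (hs : |s| ≤ ‖z‖ / 2) :
    |K (z + s • v) - K z - s * fderiv ℝ K z v| ≤ Ks z / ‖z‖ ^ 2 * s ^ 2 := by
  have hz' : 0 < ‖z‖ := norm_pos_iff.2 hz
  set B := Ks z / ‖z‖ ^ 2
  have hdist : ∀ u : ℝ, |u| ≤ |s| → ‖z + u • v - z‖ ≤ ‖z‖ / 2 := by
    intro u hu
    rw [add_sub_cancel_left, norm_smul, hv, mul_one, Real.norm_eq_abs]
    exact hu.trans hs
  have hne : ∀ u : ℝ, |u| ≤ |s| → z + u • v ≠ 0 := by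
    intro u hu h0
    have := hdist u hu
    rw [h0, zero_sub, norm_neg] at this
    linarith
  have hsecond : ∀ u : ℝ, |u| ≤ |s| → ‖fderiv ℝ (fderiv ℝ K) (z + u • v) v v‖ ≤ B := by
    intro u hu
    rw [le_div_iff₀ (by positivity), mul_comm]
    exact hK.second_deriv_le z hz v hv _ (hdist u hu)
  have hmem : ∀ u : ℝ, u ∈ Icc (-|s|) |s| ↔ |u| ≤ |s| := fun u => abs_le.symm
  have h0 : (0 : ℝ) ∈ Icc (-|s|) |s| := by simp
  have hfirst : ∀ u : ℝ, |u| ≤ |s| → ‖fderiv ℝ K (z + u • v) v - fderiv ℝ K z v‖ ≤ B * |s| := by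
    intro u hu
    have := (convex_Icc (-|s|) |s|).norm_image_sub_le_of_norm_hasDerivWithin_le
      (f := fun u : ℝ => fderiv ℝ K (z + u • v) v)
      (fun x hx => (hK.hasDerivAt_fderiv_line z v (hne x ((hmem x).1 hx))).hasDerivWithinAt)
      (fun x hx => hsecond x ((hmem x).1 hx)) h0 ((hmem u).2 hu)
    simp only [zero_smul, add_zero, sub_zero] at this
    refine this.trans ?_
    have hB : 0 ≤ B := (norm_nonneg _).trans (hsecond u hu)
    rw [Real.norm_eq_abs]
    gcongr
  have hfinal := (convex_Icc (-|s|) |s|).norm_image_sub_le_of_norm_hasDerivWithin_le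
      (f := fun u : ℝ => K (z + u • v) - u * fderiv ℝ K z v)
      (f' := fun u : ℝ => fderiv ℝ K (z + u • v) v - 1 * fderiv ℝ K z v)
      (fun x hx => ((hK.hasDerivAt_line z v (hne x ((hmem x).1 hx))).sub
        ((hasDerivAt_id x).mul_const _)).hasDerivWithinAt)
      (fun x hx => by simpa using hfirst x ((hmem x).1 hx)) h0 ((hmem s).2 le_rfl)
  simp only [zero_smul, add_zero, sub_zero, zero_mul, Real.norm_eq_abs] at hfinal
  rw [mul_assoc, abs_mul_abs_self] at hfinal
  rw [sub_right_comm, sq]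
  exact hfinal

/-- The second order estimate for the integrand of the perturbed energies. -/
lemma add_perturbed_le (hK : IsKernel K Ks) {z v : Euc n} (hz : z ≠ 0) (hv : ‖v‖ = 1)
    {t m Δ a b : ℝ} (ht : 0 ≤ t) (hm : 0 ≤ m) (htm : t * m ≤ 1 / 2) (hΔ : |Δ| ≤ m * ‖z‖)
    (ha : |a| ≤ m) (hb : |b| ≤ m) :
    (1 + t * a) * (1 + t * b) * K (z + (t * Δ) • v) +
      (1 - t * a) * (1 - t * b) * K (z - (t * Δ) • v) ≤
      2 * K z + t ^ 2 * (m ^ 2 * (9 * Ks z + 2 * K z)) := by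
  have hz' : 0 < ‖z‖ := norm_pos_iff.2 hz
  have hτ : |t * Δ| ≤ t * m * ‖z‖ := by
    rw [abs_mul, abs_of_nonneg ht, mul_assoc]
    gcongr
  have hτ2 : |t * Δ| ≤ ‖z‖ / 2 := hτ.trans (by nlinarith)
  have h1 := hK.abs_taylor_le hz hv hτ2
  have h2 := hK.abs_taylor_le hz hv (s := -(t * Δ)) (by rwa [abs_neg])
  rw [neg_smul, ← sub_eq_add_neg] at h2
  have hp := hK.first_deriv_le z hz v hv
  have hk := hK.nonneg z hz
  have hks : 0 ≤ Ks z := (by positivity : 0 ≤ ‖z‖ * |fderiv ℝ K z v|).trans hp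
  set k := K z
  set p := fderiv ℝ K z v
  set τ := t * Δ
  set q := t * m
  have hq : 0 ≤ q := mul_nonneg ht hm
  have hB : Ks z / ‖z‖ ^ 2 * τ ^ 2 ≤ q ^ 2 * Ks z := by
    have : τ ^ 2 ≤ (q * ‖z‖) ^ 2 := sq_le_sq' (abs_le.1 hτ).1 (abs_le.1 hτ).2
    calc Ks z / ‖z‖ ^ 2 * τ ^ 2 ≤ Ks z / ‖z‖ ^ 2 * (q * ‖z‖) ^ 2 := by gcongr
      _ = _ := by field_simp
  rw [neg_sq] at h2
  have hτp : |τ * p| ≤ q * Ks z := by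
    rw [abs_mul]
    calc |τ| * |p| ≤ q * ‖z‖ * |p| := by gcongr
      _ = q * (‖z‖ * |p|) := by ring
      _ ≤ _ := by gcongr
  have hta : |t * a| ≤ q := by rw [abs_mul, abs_of_nonneg ht]; exact mul_le_mul_of_nonneg_left ha ht
  have htb : |t * b| ≤ q := by rw [abs_mul, abs_of_nonneg ht]; exact mul_le_mul_of_nonneg_left hb ht
  set α := t * a
  set β := t * b
  have e1 := abs_le.1 (h1.trans hB)
  have e2 := abs_le.1 (h2.trans hB)
  have e3 : α * β ≤ q ^ 2 := by
    calc α * β ≤ |α| * |β| := by rw [← abs_mul]; exact le_abs_self _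
      _ ≤ q * q := by gcongr
      _ = _ := by ring
  have e4 : τ * p * (α + β) ≤ 2 * q ^ 2 * Ks z := by
    calc τ * p * (α + β) ≤ |τ * p| * |α + β| := by rw [← abs_mul]; exact le_abs_self _
      _ ≤ q * Ks z * (q + q) := by
        gcongr
        exact (abs_add_le _ _).trans (by linarith)
      _ = _ := by ring
  have f1 := abs_le.1 (hta.trans htm)
  have f2 := abs_le.1 (htb.trans htm)
  have g1 : (1 + α) * (1 + β) ≤ 9 / 4 := by nlinarith
  have g2 : (1 - α) * (1 - β) ≤ 9 / 4 := by nlinarith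
  have g3 : 0 ≤ (1 + α) * (1 + β) := mul_nonneg (by linarith) (by linarith)
  have g4 : 0 ≤ (1 - α) * (1 - β) := mul_nonneg (by linarith) (by linarith)
  have hqk : 0 ≤ q ^ 2 * Ks z := by positivity
  -- Expanding around `z`, the sum equals `2 k + 2 k α β + 2 τ p (α + β)` plus the two weighted
  -- Taylor remainders; the first-order terms have cancelled. The coefficient of `q² Ks` is `4 + 2 *
  -- (9 / 4)`, which is at most 9.
  have i1 : (1 + α) * (1 + β) * (K (z + τ • v) - k - τ * p) ≤ 9 / 4 * (q ^ 2 * Ks z) :=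
    (mul_le_mul_of_nonneg_left e1.2 g3).trans (mul_le_mul_of_nonneg_right g1 hqk)
  have i2 : (1 - α) * (1 - β) * (K (z - τ • v) - k - -τ * p) ≤ 9 / 4 * (q ^ 2 * Ks z) :=
    (mul_le_mul_of_nonneg_left e2.2 g4).trans (mul_le_mul_of_nonneg_right g2 hqk)
  have i3 : k * (α * β) ≤ k * q ^ 2 := mul_le_mul_of_nonneg_left e3 hk
  have : t ^ 2 * (m ^ 2 * (9 * Ks z + 2 * k)) = 9 * (q ^ 2 * Ks z) + 2 * (k * q ^ 2) := by
    simp only [q]; ring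
  rw [this]
  linarith

end IsKernel

/-! ### The constant in the derivative bounds cannot be small -/

namespace IsKernel

variable {n : ℕ} {K : Euc n → ℝ} {C₁ R₀ : ℝ}

lemma hasDerivAt_ray (hK : IsKernel K (kernelStar K C₁ R₀)) {e : Euc n} (he : ‖e‖ = 1) {r : ℝ}
    (hr : 0 < r) : HasDerivAt (fun u : ℝ => K (u • e)) (fderiv ℝ K (r • e) e) r := by
  have h : r • e ≠ 0 := by
    rw [← norm_pos_iff, norm_smul, he, mul_one, Real.norm_eq_abs]; positivity
  simpa using hK.hasDerivAt_line 0 e (s := r) (by simpa using h)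

lemma mul_abs_deriv_ray_le (hK : IsKernel K (kernelStar K C₁ R₀)) {e : Euc n} (he : ‖e‖ = 1) {r : ℝ}
    (hr : 0 < r) :
    r * |fderiv ℝ K (r • e) e| ≤ C₁ * (K (r • e) + if r < R₀ then 1 else 0) := by
  have hn : ‖r • e‖ = r := by rw [norm_smul, he, mul_one, Real.norm_eq_abs, abs_of_pos hr]
  have h : r • e ≠ 0 := by rw [← norm_pos_iff, hn]; exact hr
  have := hK.first_deriv_le _ h e he
  rw [hn] at this
  refine this.trans_eq ?_
  simp [kernelStar, indicator, hn]

/-- On `[1, R₀]` the bound `|K'| ≤ C₁ (K + 1)` along the ray makes `(K + 1) e^{C₁ r}` nondecreasing.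
Starting from `K ≥ 1` at distance 1, a small `C₁ R₀` cannot bring `K` below one half. -/
lemma half_le_ray (hK : IsKernel K (kernelStar K C₁ R₀)) (hC : 0 < C₁) (hR : 2 ≤ R₀)
    (hCR : 4 * R₀ * C₁ < 1) {e : Euc n} (he : ‖e‖ = 1) : 1 / 2 ≤ K (R₀ • e) := by
  set G : ℝ → ℝ := fun u => K (u • e)
  have hpos : ∀ r, 0 < r → 0 ≤ G r := fun r hr => hK.nonneg _ (by
    rw [← norm_pos_iff, norm_smul, he, mul_one, Real.norm_eq_abs]; positivity)
  have hder : ∀ r, 0 < r → HasDerivAt (fun u => (G u + 1) * Real.exp (C₁ * u))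
      (fderiv ℝ K (r • e) e * Real.exp (C₁ * r) + (G r + 1) * (Real.exp (C₁ * r) * (C₁ * 1))) r :=
    fun r hr => ((hK.hasDerivAt_ray he hr).add_const 1).mul
      (((hasDerivAt_id r).const_mul C₁).exp)
  have hmono : MonotoneOn (fun u => (G u + 1) * Real.exp (C₁ * u)) (Icc 1 R₀) := by
    refine monotoneOn_of_hasDerivWithinAt_nonneg (convex_Icc 1 R₀)
      (fun x hx => (hder x (by linarith [hx.1])).continuousAt.continuousWithinAt)
      (fun x hx => (hder x ?_).hasDerivWithinAt) ?_
    · rw [interior_Icc] at hx; linarith [hx.1]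
    · intro x hx
      rw [interior_Icc] at hx
      have hx0 : 0 < x := by linarith [hx.1]
      have h1 := hK.mul_abs_deriv_ray_le he hx0
      rw [if_pos hx.2] at h1
      have h2 := neg_abs_le (fderiv ℝ K (x • e) e)
      have h3 := abs_nonneg (fderiv ℝ K (x • e) e)
      have h4 : |fderiv ℝ K (x • e) e| ≤ x * |fderiv ℝ K (x • e) e| := by nlinarith [hx.1]
      have h5 : 0 ≤ fderiv ℝ K (x • e) e + C₁ * (G x + 1) := by
        simp only [G]; linarith
      have := mul_nonneg h5 (Real.exp_pos (C₁ * x)).le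
      linarith
  have h1 := hmono ⟨le_rfl, by linarith⟩ ⟨by linarith, le_rfl⟩ (by linarith : (1 : ℝ) ≤ R₀)
  have hG1 : 1 ≤ G 1 := by
    refine hK.one_le _ ?_ ?_
    · rw [one_smul, ← norm_pos_iff, he]; norm_num
    · rw [one_smul, he]; norm_num
  have h2 : (G R₀ + 1) * Real.exp (C₁ * R₀) ≥ 2 * Real.exp (C₁ * 1) := by
    refine le_trans ?_ h1
    have := Real.exp_pos (C₁ * 1)
    simp only
    nlinarith
  have h3 : Real.exp (C₁ * 1) = Real.exp (C₁ * R₀) * Real.exp (C₁ * 1 - C₁ * R₀) := by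
    rw [← Real.exp_add]; congr 1; ring
  have h4 : C₁ * 1 - C₁ * R₀ + 1 ≤ Real.exp (C₁ * 1 - C₁ * R₀) := Real.add_one_le_exp _
  have h5 : 3 / 4 ≤ Real.exp (C₁ * 1 - C₁ * R₀) := by linarith
  have h6 : G R₀ + 1 ≥ 2 * Real.exp (C₁ * 1 - C₁ * R₀) := by
    rw [h3] at h2
    have := Real.exp_pos (C₁ * R₀)
    nlinarith
  change 1 / 2 ≤ G R₀
  linarith

/-- Beyond `R₀` the bound reads `r |K'| ≤ C₁ K ≤ K`, so `r K` is nondecreasing along rays. -/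
lemma inv_le_of_small (hK : IsKernel K (kernelStar K C₁ R₀)) (hC : 0 < C₁) (hR : 2 ≤ R₀)
    (hCR : 4 * R₀ * C₁ < 1) {z : Euc n} (hz : R₀ ≤ ‖z‖) : 1 / (2 * ‖z‖) ≤ K z := by
  have hz0 : 0 < ‖z‖ := by linarith
  set e : Euc n := ‖z‖⁻¹ • z
  have he : ‖e‖ = 1 := by
    rw [norm_smul, norm_inv, norm_norm, inv_mul_cancel₀ hz0.ne']
  have hze : ‖z‖ • e = z := by rw [smul_smul, mul_inv_cancel₀ hz0.ne', one_smul]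
  set G : ℝ → ℝ := fun u => K (u • e)
  have hpos : ∀ r, 0 < r → 0 ≤ G r := fun r hr => hK.nonneg _ (by
    rw [← norm_pos_iff, norm_smul, he, mul_one, Real.norm_eq_abs]; positivity)
  have hder : ∀ r, 0 < r → HasDerivAt (fun u => u * G u)
      (1 * G r + r * fderiv ℝ K (r • e) e) r :=
    fun r hr => (hasDerivAt_id r).mul (hK.hasDerivAt_ray he hr)
  have hmono : MonotoneOn (fun u => u * G u) (Ici R₀) := by
    refine monotoneOn_of_hasDerivWithinAt_nonneg (convex_Ici R₀)
      (fun x hx => (hder x (by linarith [mem_Ici.1 hx])).continuousAt.continuousWithinAt)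
      (fun x hx => (hder x ?_).hasDerivWithinAt) ?_
    · rw [interior_Ici] at hx; linarith [mem_Ioi.1 hx]
    · intro x hx
      rw [interior_Ici] at hx
      have hx := mem_Ioi.1 hx
      have hx0 : 0 < x := by linarith
      have h1 := hK.mul_abs_deriv_ray_le he hx0
      rw [if_neg (not_lt.2 hx.le), add_zero] at h1
      have h2 := neg_abs_le (fderiv ℝ K (x • e) e)
      have h3 : C₁ * G x ≤ 1 * G x := mul_le_mul_of_nonneg_right (by nlinarith) (hpos x hx0)
      have h4 : x * -|fderiv ℝ K (x • e) e| ≤ x * fderiv ℝ K (x • e) e :=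
        mul_le_mul_of_nonneg_left h2 hx0.le
      simp only [G] at h3 ⊢
      linarith
  have h1 := hmono (mem_Ici.2 le_rfl) (mem_Ici.2 hz) hz
  have h2 := hK.half_le_ray hC hR hCR he
  simp only [G, hze] at h1
  rw [div_le_iff₀ (by positivity)]
  nlinarith

/-- Otherwise the kernel would decay too slowly at infinity to be integrable there. -/
lemma one_le_const (hK : IsKernel K (kernelStar K C₁ R₀)) (hn : 2 ≤ n) (hC : 0 < C₁)
    (hR : 2 ≤ R₀) : 1 ≤ 4 * R₀ * C₁ := by
  by_contra! hCR
  have : NeZero n := ⟨by omega⟩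
  set ω := ballConst n
  have hω : 0 < ω := ballConst_pos n
  set f : Euc n → ℝ := fun z => K z * min 1 ‖z‖
  have hf0 : ∀ z, 0 ≤ f z := by
    intro z
    by_cases hz : z = 0
    · simp [f, hz]
    · exact mul_nonneg (hK.nonneg z hz) (le_min zero_le_one (norm_nonneg _))
  set I := ∫ z, f z
  have hI : 0 ≤ I := integral_nonneg hf0
  -- Chebyshev at level `1 / (2 M)` yields `M ω / 4 ≤ I`, because `f` exceeds this level on `B_M`
  -- outside `B_{R₀}` and `M² ≤ M^n` for `n ≥ 2`. The second entry of the maximum contradicts this.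
  set M := max (2 * R₀) (4 * (I + 1) / ω)
  have hM : 2 * R₀ ≤ M := le_max_left _ _
  have hM0 : 0 < M := by linarith
  have h1 := mul_meas_ge_le_integral_of_nonneg (Filter.Eventually.of_forall hf0) hK.integrable
    (1 / (2 * M))
  have hball : ∀ r : ℝ, 0 < r → volume.real (Metric.ball (0 : Euc n) r) = r ^ n * ω := by
    intro r hr
    rw [Measure.real, volume_ball_eq _ hr, ENNReal.toReal_ofReal (by positivity)]
  have hsub : Metric.ball (0 : Euc n) M ⊆ {x | 1 / (2 * M) ≤ f x} ∪ Metric.ball (0 : Euc n) R₀ := by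
    intro z hz
    rw [mem_ball_zero_iff] at hz
    by_cases hz' : ‖z‖ < R₀
    · exact Or.inr (mem_ball_zero_iff.2 hz')
    · left
      push Not at hz'
      have h2 := hK.inv_le_of_small hC hR hCR hz'
      have h3 : f z = K z := by
        simp only [f]; rw [min_eq_left (by linarith), mul_one]
      rw [mem_ofPred_eq, h3]
      refine le_trans ?_ h2
      have : 0 < ‖z‖ := by linarith
      gcongr
  have hfin : volume {x | 1 / (2 * M) ≤ f x} ≠ ∞ :=
    (hK.integrable.measure_ge_lt_top (by positivity)).ne
  have h2 : M ^ n * ω ≤ volume.real {x | 1 / (2 * M) ≤ f x} + R₀ ^ n * ω := by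
    rw [← hball M hM0, ← hball R₀ (by linarith)]
    refine (measureReal_mono hsub ?_).trans (measureReal_union_le _ _)
    exact measure_union_ne_top hfin measure_ball_lt_top.ne
  have h3 : M * M ≤ M ^ n := by
    rw [← sq]; exact pow_le_pow_right₀ (by linarith) hn
  have h4 : 2 * R₀ ^ n ≤ M ^ n := by
    calc 2 * R₀ ^ n ≤ 2 ^ n * R₀ ^ n := by
          gcongr
          calc (2 : ℝ) = 2 ^ 1 := by norm_num
            _ ≤ 2 ^ n := pow_le_pow_right₀ (by norm_num) (by omega)
      _ = (2 * R₀) ^ n := by rw [mul_pow]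
      _ ≤ _ := by gcongr
  have h5 : M * M * ω / 2 ≤ volume.real {x | 1 / (2 * M) ≤ f x} := by nlinarith
  have h6 : M * ω / 4 ≤ I := by
    refine le_trans ?_ h1
    calc M * ω / 4 = 1 / (2 * M) * (M * M * ω / 2) := by field_simp; norm_num
      _ ≤ _ := by gcongr
  have h7 : 4 * (I + 1) / ω ≤ M := le_max_right _ _
  rw [div_le_iff₀ hω] at h7
  linarith

end IsKernel

/-! ### The energy estimate for minimizers -/

/-- The error term in the comparison of a set with its perturbations. -/
def cutoffEnergy {n : ℕ} (K : Euc n → ℝ) (R₀ : ℝ) (M : ℝ → ℝ) (R : ℝ) (E : Set (Euc n)) : ℝ≥0∞ :=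
  ∫⁻ p in pairRegion (Metric.ball 0 R) E, ENNReal.ofReal (M (min ‖p.1‖ ‖p.2‖) ^ 2 *
    (K (p.1 - p.2) + (Metric.ball (0 : Euc n) R₀).indicator (fun _ => 1) (p.1 - p.2)))

section

variable {n : ℕ} {K : Euc n → ℝ} {C₁ R₀ R : ℝ} {φ : Euc n → ℝ} {M : ℝ → ℝ} {E : Set (Euc n)}
  {v : Euc n} {t : ℝ}

lemma IsCutoff.measurableSet_image (h : IsCutoff φ M R) (hv : ‖v‖ = 1) (ht : |t| * M 0 ≤ 1 / 2)
    (hE : MeasurableSet E) : MeasurableSet (perturb φ v t '' E) :=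
  (h.toHomeo hv ht).toMeasurableEquiv.measurableSet_image.2 hE

lemma IsCutoff.image_diff_ball (h : IsCutoff φ M R) (hv : ‖v‖ = 1) (ht : |t| * M 0 ≤ 1 / 2) :
    perturb φ v t '' E \ Metric.ball 0 R = E \ Metric.ball 0 R := by
  have hinj : Function.Injective (perturb φ v t) := (h.toHomeo hv ht).injective
  ext x
  simp only [mem_sdiff]
  refine and_congr_left fun hx => ?_
  have hx' : perturb φ v t x = x := h.perturb_of_le_norm v t (by simpa using hx)
  conv_lhs => rw [← hx']
  exact hinj.mem_set_image

/-- After the change of variables both perturbed energies live on the same pairs as that of `E`, and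
the pointwise second order estimate `IsKernel.add_perturbed_le` applies. -/
lemma IsCutoff.perturbed_energy_add_le (h : IsCutoff φ M R) (hK : IsKernel K (kernelStar K C₁ R₀))
    (hC : 0 < C₁) (hR₀ : 0 ≤ R₀) (hCR : 1 ≤ 4 * R₀ * C₁) (hv : ‖v‖ = 1) (ht0 : 0 ≤ t)
    (ht : t * M 0 ≤ 1 / 2) (hE : MeasurableSet E) :
    (∫⁻ p in pairRegion (Metric.ball 0 R) (perturb φ v t '' E), pairKernel K p) +
      (∫⁻ p in pairRegion (Metric.ball 0 R) (perturb φ v (-t) '' E), pairKernel K p) ≤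
    2 * (∫⁻ p in pairRegion (Metric.ball 0 R) E, pairKernel K p) +
      ENNReal.ofReal (t ^ 2 * ((9 + 8 * R₀) * C₁)) * cutoffEnergy K R₀ M R E := by
  have ht1 : |t| * M 0 ≤ 1 / 2 := by rwa [abs_of_nonneg ht0]
  have ht2 : |-t| * M 0 ≤ 1 / 2 := by rwa [abs_neg]
  rw [h.lintegral_pairRegion_image hv ht1 hE, h.lintegral_pairRegion_image hv ht2 hE,
    cutoffEnergy, ← lintegral_const_mul' _ _ ENNReal.ofReal_ne_top,
    ← lintegral_const_mul' _ _ (by norm_num), ← lintegral_add_left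
      ((measurable_pairKernel hK.measurable).const_mul 2)]
  refine (le_lintegral_add _ _).trans ?_
  refine setLIntegral_mono' (measurableSet_pairRegion measurableSet_ball hE) fun p hp => ?_
  obtain ⟨x, y⟩ := p
  have hxy : x ≠ y := fun hxy => hp.2.1 (hxy ▸ hp.1)
  have hz : x - y ≠ 0 := sub_ne_zero.2 hxy
  have hz0 : 0 < ‖x - y‖ := norm_pos_iff.2 hz
  simp only [pairKernel]
  set m := M (min ‖x‖ ‖y‖)
  have hm0 : 0 ≤ m := h.nonneg _
  have hmM : m ≤ M 0 := h.antitone (le_min (norm_nonneg _) (norm_nonneg _))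
  have htm : t * m ≤ 1 / 2 := (mul_le_mul_of_nonneg_left hmM ht0).trans ht
  have ha : |fderiv ℝ φ x v| ≤ m := (h.abs_fderiv_le hv x).trans (h.antitone (min_le_left _ _))
  have hb : |fderiv ℝ φ y v| ≤ m := (h.abs_fderiv_le hv y).trans (h.antitone (min_le_right _ _))
  set a := fderiv ℝ φ x v
  set b := fderiv ℝ φ y v
  have hta : |t * a| ≤ 1 / 2 := by
    rw [abs_mul, abs_of_nonneg ht0]; exact (mul_le_mul_of_nonneg_left ha ht0).trans htm
  have htb : |t * b| ≤ 1 / 2 := by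
    rw [abs_mul, abs_of_nonneg ht0]; exact (mul_le_mul_of_nonneg_left hb ht0).trans htm
  have ha' := abs_le.1 hta
  have hb' := abs_le.1 htb
  have e1 : perturb φ v t x - perturb φ v t y = x - y + (t * (φ x - φ y)) • v := by
    simp only [perturb]; rw [mul_sub, sub_smul]; abel
  have e2 : perturb φ v (-t) x - perturb φ v (-t) y = x - y - (t * (φ x - φ y)) • v := by
    simp only [perturb]; rw [mul_sub, sub_smul, neg_mul, neg_mul, neg_smul, neg_smul]; abel
  have hne1 : x - y + (t * (φ x - φ y)) • v ≠ 0 := by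
    rw [← e1, sub_ne_zero]
    exact fun h' => hxy ((h.toHomeo hv ht1).injective h')
  have hne2 : x - y - (t * (φ x - φ y)) • v ≠ 0 := by
    rw [← e2, sub_ne_zero]
    exact fun h' => hxy ((h.toHomeo hv ht2).injective h')
  have main := hK.add_perturbed_le hz hv ht0 hm0 htm (h.lip x y) ha hb
  have p1 : 0 ≤ (1 + t * a) * (1 + t * b) := mul_nonneg (by linarith) (by linarith)
  have p2 : 0 ≤ (1 + -t * a) * (1 + -t * b) := mul_nonneg (by linarith) (by linarith)
  have k0 := hK.nonneg _ hz
  have χ0 : (0 : ℝ) ≤ (Metric.ball (0 : Euc n) R₀).indicator (fun _ => 1) (x - y) :=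
    indicator_nonneg (fun _ _ => zero_le_one) _
  have e4 : 2 * ENNReal.ofReal (K (x - y)) = ENNReal.ofReal (2 * K (x - y)) := by
    rw [ENNReal.ofReal_mul (by norm_num), ENNReal.ofReal_ofNat]
  rw [e1, e2, ← ENNReal.ofReal_mul p1, ← ENNReal.ofReal_mul p2,
    ← ENNReal.ofReal_add (mul_nonneg p1 (hK.nonneg _ hne1)) (mul_nonneg p2 (hK.nonneg _ hne2)),
    ← ENNReal.ofReal_mul (by positivity), e4, ← ENNReal.ofReal_add (by positivity) (by positivity)]
  refine ENNReal.ofReal_le_ofReal ?_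
  have e3 : (1 + -t * a) * (1 + -t * b) = (1 - t * a) * (1 - t * b) := by ring
  rw [e3]
  refine main.trans ?_
  rw [kernelStar]
  set k := K (x - y)
  set χ := (Metric.ball (0 : Euc n) R₀).indicator (fun _ => (1 : ℝ)) (x - y)
  -- The term `2 k` comes from the Jacobians and carries no factor `C₁`; the lower bound on `4 R₀
  -- C₁` absorbs it.
  have : 9 * (C₁ * (k + χ)) + 2 * k ≤ (9 + 8 * R₀) * C₁ * (k + χ) := by
    have i1 : k * 1 ≤ k * (4 * R₀ * C₁) := mul_le_mul_of_nonneg_left hCR k0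
    have i2 : 0 ≤ R₀ * C₁ * χ := by positivity
    linarith
  calc 2 * k + t ^ 2 * (m ^ 2 * (9 * (C₁ * (k + χ)) + 2 * k)) ≤
      2 * k + t ^ 2 * (m ^ 2 * ((9 + 8 * R₀) * C₁ * (k + χ))) := by gcongr
    _ = _ := by ring

/-- Submodularity and minimality against `E ∪ F` and `E ∩ F` show that the energy of `F` exceeds
that of `E` by at least the interaction of `E \ F` with `F \ E`. Since `F'` has at least the energy
of `E`, the second order bound on the sum limits this excess. -/
lemma IsMinimizer.lintegral_diffPairs_le (hmin : IsMinimizer K (Metric.ball 0 R) E)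
    (h : IsCutoff φ M R) (hK : IsKernel K (kernelStar K C₁ R₀))
    (hC : 0 < C₁) (hR₀ : 0 ≤ R₀) (hCR : 1 ≤ 4 * R₀ * C₁) (hv : ‖v‖ = 1) (ht0 : 0 ≤ t)
    (ht : t * M 0 ≤ 1 / 2) (hE : MeasurableSet E) :
    ∫⁻ p in diffPairs E (perturb φ v t '' E), pairKernel K p ≤
      ENNReal.ofReal (t ^ 2 * ((9 + 8 * R₀) * C₁)) * cutoffEnergy K R₀ M R E := by
  have ht1 : |t| * M 0 ≤ 1 / 2 := by rwa [abs_of_nonneg ht0]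
  have ht2 : |-t| * M 0 ≤ 1 / 2 := by rwa [abs_neg]
  have hmeas := hK.measurable
  set W : Set (Euc n) → ℝ≥0∞ := fun A => ∫⁻ p in pairRegion (Metric.ball 0 R) A, pairKernel K p
  have hle : ∀ A, MeasurableSet A → A \ Metric.ball 0 R = E \ Metric.ball 0 R → W E ≤ W A := by
    intro A hA hAE
    have := hmin.minimal A hA.nullMeasurableSet hAE
    rwa [perKIn_eq hmeas measurableSet_ball hE, perKIn_eq hmeas measurableSet_ball hA] at this
  have hfin : W E ≠ ∞ := by
    have := hmin.finite
    rwa [perKIn_eq hmeas measurableSet_ball hE] at this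
  have hF := h.measurableSet_image hv ht1 hE
  have hF' := h.measurableSet_image hv ht2 hE
  have hd := h.image_diff_ball (E := E) hv ht1
  have hd' := h.image_diff_ball (E := E) hv ht2
  have hsum := h.perturbed_energy_add_le hK hC hR₀ hCR hv ht0 ht hE
  set F := perturb φ v t '' E
  set F' := perturb φ v (-t) '' E
  have hsub := lintegral_pairRegion_union_add_inter (measurable_pairKernel hmeas)
    (measurableSet_ball (x := (0 : Euc n)) (ε := R)) hE hF hd
  have h1 : W E ≤ W (E ∪ F) := hle _ (hE.union hF) (by rw [union_sdiff_distrib, hd, union_self])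
  have h2 : W E ≤ W (E ∩ F) := hle _ (hE.inter hF) (by
    have : (E ∩ F) \ Metric.ball 0 R = E \ Metric.ball 0 R ∩ (F \ Metric.ball 0 R) := by
      ext x; simp only [mem_sdiff, mem_inter_iff]; tauto
    rw [this, hd, inter_self])
  have h3 : W E ≤ W F' := hle _ hF' hd'
  set D := ∫⁻ p in diffPairs E F, pairKernel K p
  have h4 : W E + D ≤ W F := by
    have : W E + (W E + D) ≤ W E + W F := by
      calc W E + (W E + D) = W E + W E + D := (add_assoc _ _ _).symm
        _ ≤ W (E ∪ F) + W (E ∩ F) + D := by gcongr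
        _ ≤ _ := le_self_add
        _ ≤ _ := hsub
    exact (ENNReal.add_le_add_iff_left hfin).1 this
  have h5 : 2 * W E + D ≤ 2 * W E + ENNReal.ofReal (t ^ 2 * ((9 + 8 * R₀) * C₁)) *
      cutoffEnergy K R₀ M R E := by
    refine le_trans ?_ hsum
    calc 2 * W E + D = (W E + D) + W E := by ring
      _ ≤ _ := add_le_add h4 h3
  exact (ENNReal.add_le_add_iff_left (ENNReal.mul_ne_top (by norm_num) hfin)).1 h5

/-- On `B_2` the perturbation is the translation by `t v`. Jumps along `t v` thus end in `E \ F` and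
jumps along `-(t v)` start in `F \ E`, always inside the unit ball, where two points are at distance
less than 2 and `K ≥ 1`. -/
lemma upJump_mul_upJump_le (h : IsCutoff φ M R) {Ks : Euc n → ℝ} (hK : IsKernel K Ks)
    (hv : ‖v‖ = 1) (ht0 : 0 ≤ t) (ht1 : t ≤ 1) (ht : t * M 0 ≤ 1 / 2) (hE : MeasurableSet E) :
    upJump E 1 (t • v) * upJump E 1 (-(t • v)) ≤
      ∫⁻ p in diffPairs E (perturb φ v t '' E), pairKernel K p := by
  have ht' : |t| * M 0 ≤ 1 / 2 := by rwa [abs_of_nonneg ht0]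
  have hF := h.measurableSet_image hv ht' hE
  have hmem : ∀ x ∈ Metric.ball (0 : Euc n) 1, x ∈ perturb φ v t '' E ↔ x - t • v ∈ E := by
    intro x hx
    rw [mem_ball_zero_iff] at hx
    have hnorm : ‖x - t • v‖ ≤ 2 := by
      refine (norm_sub_le _ _).trans ?_
      rw [norm_smul, hv, Real.norm_eq_abs, abs_of_nonneg ht0]
      linarith
    have h1 : perturb φ v t (x - t • v) = x := by
      rw [h.perturb_of_le_two v t hnorm, sub_add_cancel]
    have hinj : Function.Injective (perturb φ v t) := (h.toHomeo hv ht').injective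
    conv_lhs => rw [← h1]
    exact hinj.mem_set_image
  set F := perturb φ v t '' E
  set B := Metric.ball (0 : Euc n) 1
  have hBm : MeasurableSet B := measurableSet_ball
  have h1 : upJump E 1 (t • v) ≤ volume (B ∩ (E \ F)) := by
    rw [← measure_preimage_add_right volume (t • v) (B ∩ (E \ F))]
    refine measure_mono fun x hx => ?_
    exact ⟨hx.2.1, hx.2.2.2, by rw [hmem _ hx.2.1, add_sub_cancel_right]; exact hx.2.2.1⟩
  have h2 : upJump E 1 (-(t • v)) ≤ volume (B ∩ (F \ E)) := by
    refine measure_mono fun x hx => ?_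
    refine ⟨hx.1, ?_, hx.2.2.1⟩
    rw [hmem _ hx.1, sub_eq_add_neg]
    exact hx.2.2.2
  calc upJump E 1 (t • v) * upJump E 1 (-(t • v)) ≤
      volume (B ∩ (E \ F)) * volume (B ∩ (F \ E)) := mul_le_mul' h1 h2
    _ = volume ((B ∩ (E \ F)) ×ˢ (B ∩ (F \ E))) := by
      rw [Measure.volume_eq_prod, Measure.prod_prod]
    _ = ∫⁻ _ in (B ∩ (E \ F)) ×ˢ (B ∩ (F \ E)), 1 := (setLIntegral_one _).symm
    _ ≤ ∫⁻ p in (B ∩ (E \ F)) ×ˢ (B ∩ (F \ E)), pairKernel K p := by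
      refine setLIntegral_mono' ((hBm.inter (hE.diff hF)).prod (hBm.inter (hF.diff hE)))
        fun p hp => ?_
      obtain ⟨x, y⟩ := p
      obtain ⟨⟨hx, hx1, -⟩, hy, -, hy1⟩ := hp
      simp only [B, mem_ball_zero_iff] at hx hy hx1 hy1
      rw [pairKernel, ← ENNReal.ofReal_one]
      refine ENNReal.ofReal_le_ofReal (hK.one_le _ ?_ ?_)
      · exact sub_ne_zero.2 fun hxy => hy1 ((show x = y from hxy) ▸ hx1)
      · exact (norm_sub_le _ _).trans_lt (by simp only; linarith)
    _ ≤ _ := lintegral_mono_set (prod_mono inter_subset_right inter_subset_right)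

/-- The energy estimate bounds the jumps of a minimizer. -/
lemma IsMinimizer.oneSidedJumps (hmin : IsMinimizer K (Metric.ball 0 R) E)
    (h : IsCutoff φ M R) (hK : IsKernel K (kernelStar K C₁ R₀))
    (hC : 0 < C₁) (hR₀ : 0 ≤ R₀) (hCR : 1 ≤ 4 * R₀ * C₁) (hE : MeasurableSet E) {δ : ℝ}
    (hδ : 0 ≤ δ)
    (hQ : ENNReal.ofReal ((9 + 8 * R₀) * C₁) * cutoffEnergy K R₀ M R E ≤ ENNReal.ofReal (δ ^ 2)) :
    OneSidedJumps E δ := by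
  have hM := h.nonneg 0
  -- The threshold ensures `t ≤ 1` and `t * M 0 ≤ 1 / 2`; the added 1 avoids a division by zero.
  refine ⟨min 1 (1 / (2 * (M 0 + 1))), by positivity, fun w hw => ?_⟩
  by_cases hw0 : w = 0
  · left
    have : jumpSet (Metric.ball (0 : Euc n) 1) E w = ∅ := by
      ext x; simp [jumpSet, hw0]
    rw [upJump, this, measure_empty]
    exact zero_le
  set t := ‖w‖
  have ht0 : 0 < t := norm_pos_iff.2 hw0
  set v := t⁻¹ • w
  have hv : ‖v‖ = 1 := by rw [norm_smul, norm_inv, norm_norm, inv_mul_cancel₀ ht0.ne']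
  have hwv : w = t • v := by rw [smul_smul, mul_inv_cancel₀ ht0.ne', one_smul]
  have ht : t * M 0 ≤ 1 / 2 := by
    have := hw.trans (min_le_right _ _)
    rw [le_div_iff₀ (by positivity)] at this
    linarith
  have h1 := (upJump_mul_upJump_le h hK hv ht0.le (hw.trans (min_le_left _ _)) ht hE).trans
    (hmin.lintegral_diffPairs_le h hK hC hR₀ hCR hv ht0.le ht hE)
  rw [← hwv, ENNReal.ofReal_mul (by positivity), mul_assoc] at h1
  have h2 : upJump E 1 w * upJump E 1 (-w) ≤ ENNReal.ofReal (δ * t) * ENNReal.ofReal (δ * t) := by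
    refine h1.trans ((mul_le_mul_right hQ _).trans_eq ?_)
    rw [← ENNReal.ofReal_mul (by positivity), ← ENNReal.ofReal_mul (by positivity)]
    congr 1; ring
  -- A product bounded by `(δ t)²` has a factor bounded by `δ t`.
  by_contra! hcon
  exact absurd h2 (not_le.2 (ENNReal.mul_lt_mul hcon.1 hcon.2))

end

/-! ### Comparison of interactions of different ranges -/

/-- The pairs of points of `G` that jump into `A`. -/
def jumpPairs {n : ℕ} (G A : Set (Euc n)) : Set (Euc n × Euc n) :=
  {p | p.1 ∈ G ∧ p.2 ∈ G ∧ p.1 ∉ A ∧ p.2 ∈ A}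

section

variable {n : ℕ} {G A : Set (Euc n)}

lemma measurableSet_jumpPairs (hG : MeasurableSet G) (hA : MeasurableSet A) :
    MeasurableSet (jumpPairs G A) :=
  (measurable_fst hG).inter ((measurable_snd hG).inter
    ((measurable_fst hA.compl).inter (measurable_snd hA)))

lemma measurable_volume_jumpSet (hG : MeasurableSet G) (hA : MeasurableSet A) :
    Measurable fun w => volume (jumpSet G A w) := by
  have h1 : Measurable fun q : Euc n × Euc n => q.2 := measurable_snd
  have h2 : Measurable fun q : Euc n × Euc n => q.2 + q.1 := measurable_snd.add measurable_fst
  have h3 : MeasurableSet {q : Euc n × Euc n | q.2 ∈ jumpSet G A q.1} :=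
    (h1 hG).inter ((h2 hG).inter ((h1 hA.compl).inter (h2 hA)))
  exact measurable_measure_prodMk_left h3

lemma lintegral_jumpPairs (hG : MeasurableSet G) (hA : MeasurableSet A) {f : Euc n → ℝ≥0∞}
    (hf : Measurable f) :
    ∫⁻ p in jumpPairs G A, f (p.1 - p.2) = ∫⁻ w, f (-w) * volume (jumpSet G A w) := by
  have hP := measurableSet_jumpPairs hG hA
  have hg : Measurable ((jumpPairs G A).indicator fun p : Euc n × Euc n => f (p.1 - p.2)) :=
    (hf.comp (measurable_fst.sub measurable_snd)).indicator hP
  rw [← lintegral_indicator hP, Measure.volume_eq_prod, lintegral_prod _ hg.aemeasurable]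
  have h1 : ∀ x : Euc n, ∫⁻ y, (jumpPairs G A).indicator (fun p => f (p.1 - p.2)) (x, y) =
      ∫⁻ w, (jumpPairs G A).indicator (fun p => f (p.1 - p.2)) (x, x + w) := fun x =>
    (lintegral_add_left_eq_self
      (fun y => (jumpPairs G A).indicator (fun p => f (p.1 - p.2)) (x, y)) x).symm
  simp only [h1]
  have hm : Measurable fun q : Euc n × Euc n =>
      (jumpPairs G A).indicator (fun p => f (p.1 - p.2)) (q.1, q.1 + q.2) :=
    hg.comp (measurable_fst.prodMk (measurable_fst.add measurable_snd))
  rw [lintegral_lintegral_swap hm.aemeasurable]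
  refine lintegral_congr fun w => ?_
  rw [← lintegral_indicator_one (measurableSet_jumpSet hG hA w), ← lintegral_const_mul _
    (measurable_one.indicator (measurableSet_jumpSet hG hA w))]
  refine lintegral_congr fun x => ?_
  by_cases hx : x ∈ jumpSet G A w
  · rw [indicator_of_mem hx, indicator_of_mem (show (x, x + w) ∈ jumpPairs G A from hx)]
    simp
  · rw [indicator_of_notMem hx, indicator_of_notMem (show (x, x + w) ∉ jumpPairs G A from hx),
      mul_zero]

/-- The kernel of the interactions of range `r`. -/
def ballKernel (n : ℕ) (r : ℝ) : Euc n → ℝ := (Metric.ball (0 : Euc n) r).indicator fun _ => 1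

lemma measurable_ballKernel (n : ℕ) (r : ℝ) : Measurable (ballKernel n r) :=
  measurable_const.indicator measurableSet_ball

lemma lintegral_jumpPairs_ballKernel (hG : MeasurableSet G) (hA : MeasurableSet A) (r : ℝ) :
    ∫⁻ p in jumpPairs G A, pairKernel (ballKernel n r) p =
      ∫⁻ w in Metric.ball 0 r, volume (jumpSet G A w) := by
  rw [show ∫⁻ p in jumpPairs G A, pairKernel (ballKernel n r) p = _ from
    lintegral_jumpPairs hG hA (measurable_ballKernel n r).ennreal_ofReal,
    ← lintegral_indicator measurableSet_ball]
  refine lintegral_congr fun w => ?_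
  by_cases hw : w ∈ Metric.ball (0 : Euc n) r
  · have hw' : -w ∈ Metric.ball (0 : Euc n) r := by simpa using hw
    rw [indicator_of_mem hw, ballKernel, indicator_of_mem hw', ENNReal.ofReal_one, one_mul]
  · have hw' : -w ∉ Metric.ball (0 : Euc n) r := by simpa using hw
    rw [indicator_of_notMem hw, ballKernel, indicator_of_notMem hw', ENNReal.ofReal_zero, zero_mul]

/-- Halving `k` times costs `2^k` and the substitution costs `2^{k n}`. Convexity of `G` is
essential for the halving. -/
lemma lintegral_volume_jumpSet_le (hGc : Convex ℝ G) (hG : MeasurableSet G) (hA : MeasurableSet A)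
    {r ρ : ℝ} {k : ℕ} (hr : r ≤ ρ * 2 ^ k) :
    ∫⁻ w in Metric.ball 0 r, volume (jumpSet G A w) ≤
      2 ^ (k * (n + 1)) * ∫⁻ w in Metric.ball 0 ρ, volume (jumpSet G A w) := by
  have hm := (measurable_volume_jumpSet hG hA).indicator
    (measurableSet_ball (x := (0 : Euc n)) (ε := ρ))
  have hmk : Measurable fun w : Euc n => (Metric.ball (0 : Euc n) ρ).indicator
      (fun w => volume (jumpSet G A w)) ((1 / 2 : ℝ) ^ k • w) := hm.comp (measurable_const_smul _)
  have h1 : ∫⁻ w in Metric.ball 0 r, volume (jumpSet G A w) ≤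
      ∫⁻ w, 2 ^ k * (Metric.ball (0 : Euc n) ρ).indicator
        (fun w => volume (jumpSet G A w)) ((1 / 2 : ℝ) ^ k • w) := by
    rw [← lintegral_indicator measurableSet_ball]
    refine lintegral_mono fun w => ?_
    dsimp only
    by_cases hw : w ∈ Metric.ball (0 : Euc n) r
    · rw [indicator_of_mem hw, indicator_of_mem]
      · exact measure_jumpSet_le_two_pow volume hGc A w k
      · rw [mem_ball_zero_iff] at hw ⊢
        rw [norm_smul, Real.norm_of_nonneg (by positivity), one_div, inv_pow,
          inv_mul_lt_iff₀ (by positivity)]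
        linarith
    · rw [indicator_of_notMem hw]; exact zero_le
  refine h1.trans ?_
  rw [lintegral_const_mul _ hmk]
  have h2 : ∫⁻ w, (Metric.ball (0 : Euc n) ρ).indicator (fun w => volume (jumpSet G A w))
      ((1 / 2 : ℝ) ^ k • w) = 2 ^ (k * n) * ∫⁻ w in Metric.ball 0 ρ, volume (jumpSet G A w) := by
    rw [← lintegral_indicator measurableSet_ball,
      ← lintegral_map hm (measurable_const_smul _), Measure.map_addHaar_smul _ (by positivity),
      lintegral_smul_measure, finrank_euclideanSpace, Fintype.card_fin]
    congr 1
    rw [abs_of_nonneg (by positivity), one_div, inv_pow, inv_pow, inv_inv, ← pow_mul,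
      ENNReal.ofReal_pow (by norm_num), ENNReal.ofReal_ofNat]
  rw [h2, ← mul_assoc, ← pow_add]
  exact le_of_eq (by congr 2; ring)

/-- Interactions of range `r` reduce to range 2, where `K ≥ 1`. This handles the term of range `R₀`
in `K^*`. -/
lemma lintegral_jumpPairs_ballKernel_le {K Ks : Euc n → ℝ} (hK : IsKernel K Ks) (hGc : Convex ℝ G)
    (hG : MeasurableSet G) (hA : MeasurableSet A) {r : ℝ} {k : ℕ} (hr : r ≤ 2 * 2 ^ k) :
    ∫⁻ p in jumpPairs G A, pairKernel (ballKernel n r) p ≤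
      2 ^ (k * (n + 1)) * ∫⁻ p in jumpPairs G A, pairKernel K p := by
  rw [lintegral_jumpPairs_ballKernel hG hA]
  refine (lintegral_volume_jumpSet_le hGc hG hA hr).trans ?_
  rw [← lintegral_jumpPairs_ballKernel hG hA]
  gcongr 1
  refine setLIntegral_mono' (measurableSet_jumpPairs hG hA) fun p hp => ?_
  refine ENNReal.ofReal_le_ofReal ?_
  have hne : p.1 - p.2 ≠ 0 := sub_ne_zero.2 fun h => hp.2.2.1 (h ▸ hp.2.2.2)
  by_cases h2 : p.1 - p.2 ∈ Metric.ball (0 : Euc n) 2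
  · rw [ballKernel, indicator_of_mem h2]
    exact hK.one_le _ hne (mem_ball_zero_iff.1 h2)
  · rw [ballKernel, indicator_of_notMem h2]
    exact hK.nonneg _ hne

/-- In a ball, a minimizer has no more energy of finite range than the ball itself. -/
lemma IsMinimizer.lintegral_pairRegion_add_ballKernel_le {K Ks : Euc n → ℝ} (hK : IsKernel K Ks)
    {R : ℝ} {E : Set (Euc n)} (hE : MeasurableSet E)
    (hmin : IsMinimizer K (Metric.ball 0 R) E) {ρ : ℝ} (hρ : ρ ≤ R) {r : ℝ} {k : ℕ}
    (hr : r ≤ 2 * 2 ^ k) :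
    ∫⁻ p in pairRegion (Metric.ball 0 ρ) E, (pairKernel K p + pairKernel (ballKernel n r) p) ≤
      (1 + 3 * 2 ^ (k * (n + 1))) * perK K (Metric.ball 0 ρ) := by
  set B := Metric.ball (0 : Euc n) ρ
  have hB : MeasurableSet B := measurableSet_ball
  set P := perK K B
  set c : ℝ≥0∞ := 2 ^ (k * (n + 1))
  have hW := hmin.lintegral_pairRegion_le hK.measurable hK.even hE hρ
  have h1 : ∫⁻ p in jumpPairs B Eᶜ, pairKernel (ballKernel n r) p ≤ c * P := by
    refine (lintegral_jumpPairs_ballKernel_le hK (convex_ball 0 ρ) hB hE.compl hr).trans ?_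
    gcongr 1
    refine (lintegral_mono_set ?_).trans hW
    exact fun p hp => ⟨not_not.1 hp.2.2.1, hp.2.2.2, Or.inl hp.1⟩
  have h2 : ∫⁻ p in jumpPairs univ B, pairKernel (ballKernel n r) p ≤ c * P := by
    refine (lintegral_jumpPairs_ballKernel_le hK convex_univ MeasurableSet.univ hB hr).trans ?_
    gcongr 1
    refine le_of_le_of_eq ?_ (lintegral_compl_prod_eq_perK hK.measurable hK.even)
    exact lintegral_mono_set fun p hp => ⟨hp.2.2.1, hp.2.2.2⟩
  have h3 : ∫⁻ p in jumpPairs univ Bᶜ, pairKernel (ballKernel n r) p ≤ c * P := by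
    refine (lintegral_jumpPairs_ballKernel_le hK convex_univ MeasurableSet.univ hB.compl hr).trans ?_
    gcongr 1
    rw [show P = _ from perK_eq hK.measurable]
    exact lintegral_mono_set fun p hp => ⟨not_not.1 hp.2.2.1, hp.2.2.2⟩
  -- Halving needs a convex container: `B` for pairs inside it, and the whole space for pairs that
  -- cross its boundary, which are enlarged to all crossing pairs of `B`. Each of the three families
  -- has `K`-energy at most `P`.
  have hsub : pairRegion B E ⊆ jumpPairs B Eᶜ ∪ jumpPairs univ B ∪ jumpPairs univ Bᶜ := by
    rintro ⟨x, y⟩ ⟨h1, h2, h3⟩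
    simp only [jumpPairs, mem_union, mem_ofPred_eq, mem_univ, mem_compl_iff] at h1 h2 h3 ⊢
    tauto
  rw [lintegral_add_left (measurable_pairKernel hK.measurable)]
  calc _ ≤ P + ((c * P + c * P) + c * P) := by
        refine add_le_add hW ((lintegral_mono_set hsub).trans ?_)
        exact (lintegral_union_le _ _ _).trans
          (add_le_add ((lintegral_union_le _ _ _).trans (add_le_add h1 h2)) h3)
    _ = _ := by ring

end

/-! ### Linear and logarithmic cutoff functions -/

lemma exists_abs_smoothTransition_sub_le : ∃ L : ℝ, 0 < L ∧ ∀ a b : ℝ,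
    |Real.smoothTransition a - Real.smoothTransition b| ≤ L * |a - b| := by
  have hd : Differentiable ℝ Real.smoothTransition :=
    (Real.smoothTransition.contDiff (n := 1)).differentiable (by norm_num)
  have hc : Continuous (deriv Real.smoothTransition) :=
    (Real.smoothTransition.contDiff (n := 1)).continuous_deriv (by norm_num)
  have hs : HasCompactSupport (deriv Real.smoothTransition) := by
    refine HasCompactSupport.intro (isCompact_Icc (a := (0 : ℝ)) (b := 1)) fun x hx => ?_
    rw [mem_Icc, not_and_or, not_le, not_le] at hx
    rcases hx with hx | hx
    · have : Real.smoothTransition =ᶠ[nhds x] fun _ => 0 := by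
        filter_upwards [Iio_mem_nhds hx] with y hy
        exact Real.smoothTransition.zero_of_nonpos (mem_Iio.1 hy).le
      rw [this.deriv_eq, deriv_const]
    · have : Real.smoothTransition =ᶠ[nhds x] fun _ => 1 := by
        filter_upwards [Ioi_mem_nhds hx] with y hy
        exact Real.smoothTransition.one_of_one_le (mem_Ioi.1 hy).le
      rw [this.deriv_eq, deriv_const]
  obtain ⟨L, hL⟩ := hs.exists_bound_of_continuous hc
  have hL0 : 0 ≤ L := (norm_nonneg _).trans (hL 0)
  refine ⟨L + 1, by linarith, fun a b => ?_⟩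
  have := convex_univ.norm_image_sub_le_of_norm_deriv_le (fun x _ => hd x) (fun x _ => hL x)
    (mem_univ b) (mem_univ a)
  rw [Real.norm_eq_abs, Real.norm_eq_abs] at this
  exact this.trans (by gcongr; linarith)

/-- The Lipschitz constant of the transition function. -/
def transitionConst : ℝ := exists_abs_smoothTransition_sub_le.choose

lemma transitionConst_pos : 0 < transitionConst := exists_abs_smoothTransition_sub_le.choose_spec.1

lemma abs_smoothTransition_sub_le (a b : ℝ) :
    |Real.smoothTransition a - Real.smoothTransition b| ≤ transitionConst * |a - b| :=
  exists_abs_smoothTransition_sub_le.choose_spec.2 a b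

/-- A radial function with profile `ℓ` gives a cutoff function. -/
lemma isCutoff_smoothTransition (n : ℕ) {ℓ m : ℝ → ℝ} {R : ℝ}
    (hd : ∀ ρ, 1 < ρ → DifferentiableAt ℝ ℓ ρ) (h2 : ∀ ρ, 0 ≤ ρ → ρ ≤ 2 → ℓ ρ ≤ 1 / 2)
    (hR : ∀ ρ, R ≤ ρ → 1 ≤ ℓ ρ) (hl : ∀ a b, 0 ≤ a → a ≤ b → |ℓ a - ℓ b| ≤ m a * (b - a))
    (hc : Continuous m) (ha : Antitone m) (h0 : ∀ ρ, 0 ≤ m ρ) :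
    IsCutoff (fun x : Euc n => Real.smoothTransition (2 - 2 * ℓ ‖x‖))
      (fun ρ => 2 * transitionConst * m ρ) R := by
  have hL := transitionConst_pos
  have hone : ∀ x : Euc n, ‖x‖ ≤ 2 → Real.smoothTransition (2 - 2 * ℓ ‖x‖) = 1 := fun x hx =>
    Real.smoothTransition.one_of_one_le (by linarith [h2 _ (norm_nonneg x) hx])
  refine ⟨fun x => ?_, hone, fun x hx => Real.smoothTransition.zero_of_nonpos
    (by linarith [hR _ hx]), ?_, hc.const_mul _, fun a b hab => ?_, fun ρ => ?_⟩
  · by_cases hx : ‖x‖ < 2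
    · have : (fun x : Euc n => Real.smoothTransition (2 - 2 * ℓ ‖x‖)) =ᶠ[nhds x] fun _ => 1 := by
        filter_upwards [continuous_norm.continuousAt.eventually (gt_mem_nhds hx)] with y hy
        exact hone y hy.le
      exact this.differentiableAt_iff.2 (differentiableAt_const _)
    · have hx0 : x ≠ 0 := by rintro rfl; simp at hx
      have h1 : DifferentiableAt ℝ (fun x : Euc n => ‖x‖) x :=
        (contDiffAt_norm ℝ hx0 (n := 1)).differentiableAt (by norm_num)
      have h3 : DifferentiableAt ℝ (fun x : Euc n => 2 - 2 * ℓ ‖x‖) x :=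
        ((DifferentiableAt.comp x (hd ‖x‖ (by linarith)) h1).const_mul 2).const_sub 2
      exact DifferentiableAt.comp x ((Real.smoothTransition.contDiff (n := 1)).differentiable
        (by norm_num) _) h3
  · have key : ∀ x y : Euc n, ‖x‖ ≤ ‖y‖ →
        |Real.smoothTransition (2 - 2 * ℓ ‖x‖) - Real.smoothTransition (2 - 2 * ℓ ‖y‖)| ≤
          2 * transitionConst * m ‖x‖ * ‖x - y‖ := by
      intro x y hxy
      refine (abs_smoothTransition_sub_le _ _).trans ?_
      have e : (2 - 2 * ℓ ‖x‖) - (2 - 2 * ℓ ‖y‖) = -(2 * (ℓ ‖x‖ - ℓ ‖y‖)) := by ring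
      rw [e, abs_neg, abs_mul, abs_of_pos (zero_lt_two' ℝ)]
      have h3 := hl _ _ (norm_nonneg x) hxy
      have h4 : ‖y‖ - ‖x‖ ≤ ‖x - y‖ := by rw [norm_sub_rev]; exact norm_sub_norm_le _ _
      calc transitionConst * (2 * |ℓ ‖x‖ - ℓ ‖y‖|) ≤
          transitionConst * (2 * (m ‖x‖ * (‖y‖ - ‖x‖))) := by gcongr
        _ ≤ transitionConst * (2 * (m ‖x‖ * ‖x - y‖)) := by
          have := h0 ‖x‖
          gcongr
        _ = _ := by ring
    intro x y
    rcases le_total ‖x‖ ‖y‖ with hxy | hxy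
    · rw [min_eq_left hxy]; exact key x y hxy
    · rw [min_eq_right hxy, abs_sub_comm, norm_sub_rev]; exact key y x hxy
  · have := ha hab
    gcongr
  · have := h0 ρ
    positivity

/-- The linear cutoff function. -/
lemma isCutoff_linear (n : ℕ) {R : ℝ} (hR : 4 ≤ R) :
    IsCutoff (fun x : Euc n => Real.smoothTransition (2 - 2 * (‖x‖ / R)))
      (fun _ => 2 * transitionConst * (1 / R)) R := by
  have hR0 : 0 < R := by linarith
  refine isCutoff_smoothTransition n (ℓ := fun ρ => ρ / R) (m := fun _ => 1 / R)
    (fun ρ _ => by fun_prop) (fun ρ _ h => ?_) (fun ρ h => ?_) (fun a b _ hab => ?_)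
    continuous_const antitone_const fun _ => by positivity
  · rw [div_le_iff₀ hR0]; linarith
  · rwa [le_div_iff₀ hR0, one_mul]
  · rw [← sub_div, abs_div, abs_of_pos hR0, abs_sub_comm, abs_of_nonneg (sub_nonneg.2 hab)]
    exact le_of_eq (by ring)

/-- The logarithmic cutoff function. -/
lemma isCutoff_log (n : ℕ) {R : ℝ} (hR : 4 ≤ R) :
    IsCutoff (fun x : Euc n => Real.smoothTransition
        (2 - 2 * (Real.log (max ‖x‖ 1) / Real.log R)))
      (fun ρ => 2 * transitionConst * (1 / (Real.log R * max ρ 1))) R := by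
  have hlog : 0 < Real.log R := Real.log_pos (by linarith)
  have hmax : ∀ ρ : ℝ, 0 < max ρ 1 := fun ρ => lt_max_of_lt_right one_pos
  refine isCutoff_smoothTransition n (ℓ := fun ρ => Real.log (max ρ 1) / Real.log R)
    (m := fun ρ => 1 / (Real.log R * max ρ 1))
    (fun ρ h => ?_) (fun ρ _ h => ?_) (fun ρ h => ?_) (fun a b ha hab => ?_) ?_
    (fun a b hab => ?_) fun ρ => ?_
  · have : (fun ρ => Real.log (max ρ 1) / Real.log R) =ᶠ[nhds ρ] fun ρ => Real.log ρ / Real.log R := by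
      filter_upwards [Ioi_mem_nhds h] with y hy
      rw [max_eq_left (mem_Ioi.1 hy).le]
    rw [this.differentiableAt_iff]
    exact (Real.differentiableAt_log (by linarith)).div_const _
  · rw [div_le_iff₀ hlog]
    have h1 : Real.log (max ρ 1) ≤ Real.log 2 :=
      Real.log_le_log (hmax ρ) (max_le h (by norm_num))
    have h2 : Real.log 4 ≤ Real.log R := Real.log_le_log (by norm_num) hR
    have h3 : Real.log 4 = 2 * Real.log 2 := by
      rw [show (4 : ℝ) = 2 ^ 2 by norm_num, Real.log_pow]; norm_num
    linarith
  · rw [le_div_iff₀ hlog, one_mul]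
    exact Real.log_le_log (by linarith) (h.trans (le_max_left _ _))
  · have h1 : max a 1 ≤ max b 1 := max_le_max hab le_rfl
    have h2 := Real.log_le_log (hmax a) h1
    rw [← sub_div, abs_div, abs_of_pos hlog, abs_sub_comm, abs_of_nonneg (sub_nonneg.2 h2),
      div_le_iff₀ hlog, ← Real.log_div (hmax b).ne' (hmax a).ne']
    -- The inequality `log x ≤ x - 1` at the ratio of the endpoints gives the slope at the inner
    -- radius.
    have h3 := Real.log_le_sub_one_of_pos (div_pos (hmax b) (hmax a))
    refine h3.trans ?_
    have h4 : max b 1 - max a 1 ≤ b - a := by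
      rcases le_total a 1 with h | h
      · rw [max_eq_right h]
        rcases le_total b 1 with h' | h'
        · rw [max_eq_right h']; linarith
        · rw [max_eq_left h']; linarith
      · rw [max_eq_left h, max_eq_left (h.trans hab)]
    have := hmax a
    calc max b 1 / max a 1 - 1 = (max b 1 - max a 1) / max a 1 := by field_simp
      _ ≤ (b - a) / max a 1 := by gcongr
      _ = _ := by field_simp
  · exact continuous_const.div (continuous_const.mul (continuous_id.max continuous_const))
      fun ρ => (mul_pos hlog (hmax ρ)).ne'
  · have := hmax a
    dsimp only
    gcongr
  · have := hmax ρ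
    positivity

/-! ### The error term is controlled by the flatness rate -/

/-- The constant in the comparison of interactions of range `r ≤ 2 * 2 ^ k` with those of the
kernel. -/
def rangeConst (n k : ℕ) : ℝ≥0∞ := 1 + 3 * 2 ^ (k * (n + 1))

lemma rangeConst_ne_top (n k : ℕ) : rangeConst n k ≠ ∞ :=
  ENNReal.add_ne_top.2 ⟨ENNReal.one_ne_top, ENNReal.mul_ne_top (by norm_num) (by simp)⟩

lemma energyDensityRoot_sq {n : ℕ} (K : Euc n → ℝ) (C₁ ρ : ℝ) :
    energyDensityRoot K C₁ ρ ^ 2 =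
      ENNReal.ofReal C₁ * perK K (Metric.ball 0 ρ) / ENNReal.ofReal (ρ ^ 2) := by
  rw [energyDensityRoot, ← ENNReal.rpow_natCast, ← ENNReal.rpow_mul]
  norm_num

section

variable {n : ℕ} {K : Euc n → ℝ} {C₁ R₀ R : ℝ} {M : ℝ → ℝ} {E : Set (Euc n)} {k : ℕ}

lemma cutoffEnergy_eq {Ks : Euc n → ℝ} (hK : IsKernel K Ks) (hE : MeasurableSet E) :
    cutoffEnergy K R₀ M R E = ∫⁻ p in pairRegion (Metric.ball 0 R) E,
      ENNReal.ofReal (M (min ‖p.1‖ ‖p.2‖) ^ 2) *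
        (pairKernel K p + pairKernel (ballKernel n R₀) p) := by
  refine setLIntegral_congr_fun (measurableSet_pairRegion measurableSet_ball hE) fun p hp => ?_
  have hne : p.1 - p.2 ≠ 0 := sub_ne_zero.2 fun h => hp.2.1 (h ▸ hp.1)
  rw [ENNReal.ofReal_mul (sq_nonneg _), ENNReal.ofReal_add (hK.nonneg _ hne)
    (indicator_nonneg (fun _ _ => zero_le_one) _)]
  rfl

lemma ofReal_mul_perK_eq (c : ℝ) {ρ : ℝ} (hρ : 0 < ρ) :
    ENNReal.ofReal C₁ * (ENNReal.ofReal ((c * (1 / ρ)) ^ 2) * perK K (Metric.ball 0 ρ)) =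
      ENNReal.ofReal (c ^ 2) * energyDensityRoot K C₁ ρ ^ 2 := by
  rw [energyDensityRoot_sq, mul_pow, div_pow, one_pow, ENNReal.ofReal_mul (sq_nonneg c),
    one_div, ENNReal.ofReal_inv_of_pos (by positivity), div_eq_mul_inv]
  ring

lemma cutoffEnergy_linear_le {Ks : Euc n → ℝ} (hK : IsKernel K Ks) (hE : MeasurableSet E)
    (hmin : IsMinimizer K (Metric.ball 0 R) E) (hR : 0 < R) (hk : R₀ ≤ 2 * 2 ^ k) (c : ℝ) :
    ENNReal.ofReal C₁ * cutoffEnergy K R₀ (fun _ => c * (1 / R)) R E ≤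
      ENNReal.ofReal (c ^ 2) * rangeConst n k * energyDensityRoot K C₁ R ^ 2 := by
  rw [cutoffEnergy_eq hK hE, lintegral_const_mul' _ _ ENNReal.ofReal_ne_top]
  have h := hmin.lintegral_pairRegion_add_ballKernel_le hK hE le_rfl hk
  calc _ ≤ ENNReal.ofReal C₁ * (ENNReal.ofReal ((c * (1 / R)) ^ 2) *
        (rangeConst n k * perK K (Metric.ball 0 R))) := by gcongr; exact h
    _ = rangeConst n k * (ENNReal.ofReal C₁ *
        (ENNReal.ofReal ((c * (1 / R)) ^ 2) * perK K (Metric.ball 0 R))) := by ring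
    _ = _ := by rw [ofReal_mul_perK_eq c hR]; ring

/-- The dyadic radius just above `r`, truncated at `R`, is comparable to `max r 1`, so the slope of
the logarithmic cutoff at `r` can be expressed through it. -/
lemma exists_layer {r : ℝ} {N : ℕ} (hr : r < R) (hN : R ≤ 2 ^ N) :
    ∃ j ∈ Finset.range (N + 1), r < min (2 ^ j) R ∧ min (2 ^ j) R ≤ 2 * max r 1 := by
  by_cases h1 : r < 1
  · refine ⟨0, by simp, ?_, ?_⟩
    · simp [h1, hr]
    · rw [max_eq_right h1.le]
      exact (min_le_left _ _).trans (by norm_num)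
  · push Not at h1
    obtain ⟨m, hm1, hm2⟩ := exists_nat_pow_near h1 (one_lt_two (α := ℝ))
    have hmN : m < N := (pow_lt_pow_iff_right₀ (one_lt_two (α := ℝ))).1
      ((hm1.trans_lt hr).trans_le hN)
    refine ⟨m + 1, by simpa using hmN, lt_min hm2 hr, (min_le_left _ _).trans ?_⟩
    rw [max_eq_left h1, pow_succ]
    linarith

lemma exists_two_pow_ge_of_four_le (hR : 4 ≤ R) :
    ∃ N : ℕ, R ≤ 2 ^ N ∧ ((N + 1 : ℕ) : ℝ) ≤ 3 * Real.log R := by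
  have h2 := Real.log_two_gt_d9
  have h4 : 2 * Real.log 2 ≤ Real.log R := by
    have : Real.log (2 ^ 2) ≤ Real.log R := Real.log_le_log (by norm_num) (by linarith)
    rw [Real.log_pow] at this
    exact_mod_cast this
  refine ⟨⌈Real.log R / Real.log 2⌉₊, ?_, ?_⟩
  · have := Nat.le_ceil (Real.log R / Real.log 2)
    rw [div_le_iff₀ (by linarith), ← Real.log_pow] at this
    exact (Real.log_le_log_iff (by linarith) (by positivity)).1 this
  · have h1 := Nat.ceil_lt_add_one (show 0 ≤ Real.log R / Real.log 2 from
      div_nonneg (by linarith) (by linarith))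
    -- The constant 3 uses `log 2 > 2 / 3` for the quotient and `2 ≤ 3 / 2 * log R`, from `R ≥ 4`,
    -- for the two roundings.
    have h3 : Real.log R / Real.log 2 ≤ 3 / 2 * Real.log R := by
      rw [div_le_iff₀ (by linarith)]
      nlinarith
    push_cast
    linarith

/-- Each layer contributes at most `(2 c / log R)²` times the squared supremum, up to the range
constant. With at most `3 log R` layers, one power of `log R` is gained and the factor is `12 c²`.
-/
lemma cutoffEnergy_log_le {Ks : Euc n → ℝ} (hK : IsKernel K Ks) (hE : MeasurableSet E)
    (hmin : IsMinimizer K (Metric.ball 0 R) E) (hR : 4 ≤ R) (hk : R₀ ≤ 2 * 2 ^ k) {c : ℝ}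
    (hc : 0 ≤ c) :
    ENNReal.ofReal C₁ * cutoffEnergy K R₀ (fun ρ => c * (1 / (Real.log R * max ρ 1))) R E ≤
      ENNReal.ofReal (12 * c ^ 2) * rangeConst n k * (ENNReal.ofReal (1 / Real.sqrt (Real.log R)) *
        ⨆ ρ ∈ Icc (1 : ℝ) R, energyDensityRoot K C₁ ρ) ^ 2 := by
  have hlog : 0 < Real.log R := Real.log_pos (by linarith)
  obtain ⟨N, hN, hN3⟩ := exists_two_pow_ge_of_four_le hR
  set T := ⨆ ρ ∈ Icc (1 : ℝ) R, energyDensityRoot K C₁ ρ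
  set ρ : ℕ → ℝ := fun j => min (2 ^ j) R
  have hρ1 : ∀ j, 1 ≤ ρ j := fun j => le_min (one_le_pow₀ (by norm_num)) (by linarith)
  have hρR : ∀ j, ρ j ≤ R := fun j => min_le_right _ _
  set b : ℝ := 2 * c / Real.log R
  set g : Euc n × Euc n → ℝ≥0∞ := fun p => pairKernel K p + pairKernel (ballKernel n R₀) p
  have hg : Measurable g := (measurable_pairKernel hK.measurable).add
    (measurable_pairKernel (measurable_ballKernel n R₀))
  have hreg : ∀ r, MeasurableSet (pairRegion (Metric.ball (0 : Euc n) r) E) := fun r =>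
    measurableSet_pairRegion measurableSet_ball hE
  have hmaster : cutoffEnergy K R₀ (fun ρ => c * (1 / (Real.log R * max ρ 1))) R E ≤
      ∑ j ∈ Finset.range (N + 1), ENNReal.ofReal ((b * (1 / ρ j)) ^ 2) *
        ∫⁻ p in pairRegion (Metric.ball 0 (ρ j)) E, g p := by
    have e : ∀ j, ENNReal.ofReal ((b * (1 / ρ j)) ^ 2) *
        ∫⁻ p in pairRegion (Metric.ball 0 (ρ j)) E, g p =
        ∫⁻ p, (pairRegion (Metric.ball 0 (ρ j)) E).indicator
          (fun p => ENNReal.ofReal ((b * (1 / ρ j)) ^ 2) * g p) p := fun j => by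
      rw [lintegral_indicator (hreg _), lintegral_const_mul _ hg]
    simp only [e]
    rw [← lintegral_finsetSum _ fun j _ => (hg.const_mul _).indicator (hreg (ρ j)),
      cutoffEnergy_eq hK hE, ← lintegral_indicator (hreg R)]
    refine lintegral_mono fun p => ?_
    by_cases hp : p ∈ pairRegion (Metric.ball (0 : Euc n) R) E
    swap
    · rw [indicator_of_notMem hp]; exact zero_le
    rw [indicator_of_mem hp]
    have hr : min ‖p.1‖ ‖p.2‖ < R := by
      rcases hp.2.2 with h | h
      · exact (min_le_left _ _).trans_lt (mem_ball_zero_iff.1 h)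
      · exact (min_le_right _ _).trans_lt (mem_ball_zero_iff.1 h)
    obtain ⟨j, hj, hj1, hj2⟩ := exists_layer hr hN
    have hpj : p ∈ pairRegion (Metric.ball (0 : Euc n) (ρ j)) E := by
      refine ⟨hp.1, hp.2.1, ?_⟩
      rw [mem_ball_zero_iff, mem_ball_zero_iff]
      exact min_lt_iff.1 hj1
    refine le_trans ?_ (Finset.single_le_sum (f := fun j =>
      (pairRegion (Metric.ball 0 (ρ j)) E).indicator
        (fun p => ENNReal.ofReal ((b * (1 / ρ j)) ^ 2) * g p) p) (fun _ _ => zero_le) hj)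
    dsimp only
    rw [indicator_of_mem hpj]
    refine mul_le_mul' (ENNReal.ofReal_le_ofReal ?_) le_rfl
    have hmax : 0 < max (min ‖p.1‖ ‖p.2‖) 1 := lt_max_of_lt_right one_pos
    have hρ0 : 0 < ρ j := by linarith [hρ1 j]
    have : c * (1 / (Real.log R * max (min ‖p.1‖ ‖p.2‖) 1)) ≤ b * (1 / ρ j) := by
      rw [show b * (1 / ρ j) = c * (1 / (Real.log R * (ρ j / 2))) by simp only [b]; field_simp]
      gcongr
      change min _ _ ≤ _ at hj2
      simp only [ρ]
      linarith
    gcongr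
  have hterm : ∀ j, ENNReal.ofReal C₁ * (ENNReal.ofReal ((b * (1 / ρ j)) ^ 2) *
      ∫⁻ p in pairRegion (Metric.ball 0 (ρ j)) E, g p) ≤
      ENNReal.ofReal (b ^ 2) * rangeConst n k * T ^ 2 := by
    intro j
    have h := hmin.lintegral_pairRegion_add_ballKernel_le hK hE (hρR j) hk
    have hT : energyDensityRoot K C₁ (ρ j) ≤ T :=
      le_iSup₂ (f := fun ρ (_ : ρ ∈ Icc (1 : ℝ) R) => energyDensityRoot K C₁ ρ) (ρ j)
        ⟨hρ1 j, hρR j⟩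
    calc _ ≤ ENNReal.ofReal C₁ * (ENNReal.ofReal ((b * (1 / ρ j)) ^ 2) *
          (rangeConst n k * perK K (Metric.ball 0 (ρ j)))) := by gcongr; exact h
      _ = rangeConst n k * (ENNReal.ofReal C₁ *
          (ENNReal.ofReal ((b * (1 / ρ j)) ^ 2) * perK K (Metric.ball 0 (ρ j)))) := by ring
      _ = rangeConst n k * (ENNReal.ofReal (b ^ 2) * energyDensityRoot K C₁ (ρ j) ^ 2) := by
        rw [ofReal_mul_perK_eq b (by linarith [hρ1 j])]
      _ ≤ rangeConst n k * (ENNReal.ofReal (b ^ 2) * T ^ 2) := by gcongr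
      _ = _ := by ring
  calc _ ≤ ∑ j ∈ Finset.range (N + 1), ENNReal.ofReal C₁ * (ENNReal.ofReal ((b * (1 / ρ j)) ^ 2) *
        ∫⁻ p in pairRegion (Metric.ball 0 (ρ j)) E, g p) := by
        rw [← Finset.mul_sum]; gcongr
    _ ≤ ∑ _j ∈ Finset.range (N + 1), ENNReal.ofReal (b ^ 2) * rangeConst n k * T ^ 2 :=
        Finset.sum_le_sum fun j _ => hterm j
    _ = ENNReal.ofReal ((N + 1 : ℕ) * b ^ 2) * rangeConst n k * T ^ 2 := by
        rw [Finset.sum_const, Finset.card_range, nsmul_eq_mul, ENNReal.ofReal_mul (by positivity),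
          ENNReal.ofReal_natCast]
        ring
    _ ≤ ENNReal.ofReal (12 * c ^ 2 * (1 / Real.sqrt (Real.log R)) ^ 2) * rangeConst n k * T ^ 2 := by
        refine mul_le_mul' (mul_le_mul' (ENNReal.ofReal_le_ofReal ?_) le_rfl) le_rfl
        rw [div_pow (1 : ℝ), Real.sq_sqrt hlog.le, one_pow]
        calc ((N + 1 : ℕ) : ℝ) * b ^ 2 ≤ 3 * Real.log R * b ^ 2 := by gcongr
          _ = _ := by simp only [b]; field_simp; ring
    _ = _ := by
        rw [ENNReal.ofReal_mul (by positivity), ENNReal.ofReal_pow (by positivity), mul_pow]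
        ring

/-- The constant in the bound for the jumps of a minimizer by the flatness rate. -/
def jumpConst (n k : ℕ) (R₀ : ℝ) : ℝ≥0∞ :=
  ENNReal.ofReal (9 + 8 * R₀) *
    (ENNReal.ofReal (12 * (2 * transitionConst) ^ 2) * rangeConst n k)

lemma jumpConst_ne_top (n k : ℕ) (R₀ : ℝ) : jumpConst n k R₀ ≠ ∞ :=
  ENNReal.mul_ne_top ENNReal.ofReal_ne_top
    (ENNReal.mul_ne_top ENNReal.ofReal_ne_top (rangeConst_ne_top n k))

/-- The jumps of a minimizer are bounded by the flatness rate. -/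
lemma IsMinimizer.oneSidedJumps_of_rate_le (hK : IsKernel K (kernelStar K C₁ R₀))
    (hE : MeasurableSet E) (hmin : IsMinimizer K (Metric.ball 0 R) E) (hn : 2 ≤ n) (hC : 0 < C₁)
    (hR₀ : 2 ≤ R₀) (hR : 4 ≤ R) (hk : R₀ ≤ 2 * 2 ^ k) {δ : ℝ} (hδ : 0 ≤ δ)
    (h : jumpConst n k R₀ * flatnessRate K C₁ R ^ 2 ≤ ENNReal.ofReal (δ ^ 2)) :
    OneSidedJumps E δ := by
  have hCR := hK.one_le_const hn hC hR₀
  have hL := transitionConst_pos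
  set c := 2 * transitionConst
  have hc : 0 ≤ c := by positivity
  have key : ∀ Q : ℝ≥0∞, ENNReal.ofReal C₁ * Q ≤
      ENNReal.ofReal (12 * c ^ 2) * rangeConst n k * flatnessRate K C₁ R ^ 2 →
      ENNReal.ofReal ((9 + 8 * R₀) * C₁) * Q ≤ ENNReal.ofReal (δ ^ 2) := by
    intro Q hQ
    refine le_trans ?_ h
    rw [ENNReal.ofReal_mul (by positivity), mul_assoc, jumpConst, mul_assoc]
    gcongr
  -- The linear or the logarithmic cutoff is used according to which term realises the minimum.
  rcases min_choice (energyDensityRoot K C₁ R) (ENNReal.ofReal (1 / Real.sqrt (Real.log R)) *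
    ⨆ ρ ∈ Icc (1 : ℝ) R, energyDensityRoot K C₁ ρ) with hmn | hmn
  · refine hmin.oneSidedJumps (isCutoff_linear n hR) hK hC (by linarith) hCR hE hδ (key _ ?_)
    rw [flatnessRate, hmn]
    refine (cutoffEnergy_linear_le hK hE hmin (by linarith) hk c).trans ?_
    refine mul_le_mul' (mul_le_mul' (ENNReal.ofReal_le_ofReal ?_) le_rfl) le_rfl
    nlinarith [sq_nonneg c]
  · refine hmin.oneSidedJumps (isCutoff_log n hR) hK hC (by linarith) hCR hE hδ (key _ ?_)
    rw [flatnessRate, hmn]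
    exact cutoffEnergy_log_le hK hE hmin hR hk hc

end

/-! ### The flatness rate is positive and finite -/

section

variable {n : ℕ} {K Ks : Euc n → ℝ}

/-- The perimeter of the ball is the integral of `K w` against the volume of the points that the
translation by `w` moves out, which is of order `min 1 ‖w‖`. -/
lemma IsKernel.perK_ball_le (hK : IsKernel K Ks) (hn : 1 ≤ n) {ρ : ℝ} (hρ : 1 ≤ ρ) :
    perK K (Metric.ball 0 ρ) ≤
      ENNReal.ofReal (n * (ρ ^ n * ballConst n)) * ∫⁻ z, ENNReal.ofReal (K z * min 1 ‖z‖) := by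
  have : NeZero n := ⟨by omega⟩
  have hρ0 : 0 < ρ := by linarith
  have hω := ballConst_pos n
  set B := Metric.ball (0 : Euc n) ρ
  have hB : MeasurableSet B := measurableSet_ball
  set c := (n : ℝ) * (ρ ^ n * ballConst n)
  have hc : 0 ≤ c := by positivity
  have h1 : perK K B ≤ ∫⁻ p in jumpPairs univ Bᶜ, pairKernel K p := by
    rw [perK_eq hK.measurable]
    exact lintegral_mono_set fun p hp => ⟨mem_univ _, mem_univ _, not_not.2 hp.1, hp.2⟩
  refine h1.trans ?_
  rw [show ∫⁻ p in jumpPairs univ Bᶜ, pairKernel K p = _ from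
    lintegral_jumpPairs MeasurableSet.univ hB.compl hK.measurable.ennreal_ofReal,
    ← lintegral_const_mul' _ _ ENNReal.ofReal_ne_top]
  refine lintegral_mono fun w => ?_
  dsimp only
  have hvol : volume (jumpSet univ Bᶜ w) ≤ ENNReal.ofReal (c * min 1 ‖w‖) := by
    rcases le_total 1 ‖w‖ with hw | hw
    · rw [min_eq_left hw, mul_one]
      refine (measure_mono (t := B) fun x hx => not_not.1 hx.2.2.1).trans ?_
      rw [volume_ball_eq _ hρ0]
      refine ENNReal.ofReal_le_ofReal (le_mul_of_one_le_left (by positivity) ?_)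
      exact_mod_cast hn
    · rw [min_eq_right hw]
      refine (measure_mono fun x hx => ?_).trans ((volume_ball_shift_diff_le ρ hρ0 w).trans
        (ENNReal.ofReal_le_ofReal ?_))
      · exact ⟨not_not.1 hx.2.2.1, hx.2.2.2⟩
      · change c * (‖w‖ / ρ) ≤ _
        gcongr
        exact div_le_self (norm_nonneg _) hρ
  rw [hK.even]
  calc ENNReal.ofReal (K w) * volume (jumpSet univ Bᶜ w) ≤
      ENNReal.ofReal (K w) * ENNReal.ofReal (c * min 1 ‖w‖) := by gcongr
    _ = _ := by
      have hm : 0 ≤ min 1 ‖w‖ := le_min zero_le_one (norm_nonneg _)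
      rw [← ENNReal.ofReal_mul' (mul_nonneg hc hm), ← ENNReal.ofReal_mul hc]
      congr 1; ring

/-- Two balls of radius one half touch the sphere at the same point from inside and from outside;
their points are less than 2 apart, where `K ≥ 1`. -/
lemma IsKernel.perK_ball_pos (hK : IsKernel K Ks) (hn : 1 ≤ n) {ρ : ℝ} (hρ : 1 ≤ ρ) :
    0 < perK K (Metric.ball 0 ρ) := by
  obtain ⟨e, he⟩ : ∃ e : Euc n, ‖e‖ = 1 := ⟨EuclideanSpace.single ⟨0, hn⟩ 1, by simp⟩
  set A := Metric.ball ((ρ - 1 / 2) • e) (1 / 2)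
  set A' := Metric.ball ((ρ + 1 / 2) • e) (1 / 2)
  have hA : ∀ x ∈ A, ‖x - (ρ - 1 / 2) • e‖ < 1 / 2 := fun x hx => mem_ball_iff_norm.1 hx
  have hA' : ∀ x ∈ A', ‖x - (ρ + 1 / 2) • e‖ < 1 / 2 := fun x hx => mem_ball_iff_norm.1 hx
  have hn1 : ‖(ρ - 1 / 2) • e‖ = ρ - 1 / 2 := by
    rw [norm_smul, he, mul_one, Real.norm_of_nonneg (by linarith)]
  have hn2 : ‖(ρ + 1 / 2) • e‖ = ρ + 1 / 2 := by
    rw [norm_smul, he, mul_one, Real.norm_of_nonneg (by linarith)]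
  have hsub : A ×ˢ A' ⊆ Metric.ball (0 : Euc n) ρ ×ˢ (Metric.ball (0 : Euc n) ρ)ᶜ := by
    rintro ⟨x, y⟩ ⟨hx, hy⟩
    have h1 := hA x hx
    have h2 := hA' y hy
    refine ⟨mem_ball_zero_iff.2 ?_, fun h => ?_⟩
    · have := norm_le_norm_add_norm_sub' x ((ρ - 1 / 2) • e)
      simp only at this ⊢
      linarith
    · have h3 := mem_ball_zero_iff.1 h
      have := norm_le_norm_add_norm_sub' ((ρ + 1 / 2) • e) y
      rw [norm_sub_rev] at this
      simp only at this h3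
      linarith
  have hpos : 0 < volume A * volume A' :=
    ENNReal.mul_pos (Metric.measure_ball_pos _ _ (by norm_num)).ne'
      (Metric.measure_ball_pos _ _ (by norm_num)).ne'
  refine hpos.trans_le ?_
  rw [perK_eq hK.measurable]
  calc volume A * volume A' = volume (A ×ˢ A') := by
        rw [Measure.volume_eq_prod, Measure.prod_prod]
    _ = ∫⁻ _ in A ×ˢ A', 1 := (setLIntegral_one _).symm
    _ ≤ ∫⁻ p in A ×ˢ A', pairKernel K p := by
      refine setLIntegral_mono' (measurableSet_ball.prod measurableSet_ball) fun p hp => ?_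
      have hp' := hsub hp
      obtain ⟨x, y⟩ := p
      rw [pairKernel, ← ENNReal.ofReal_one]
      refine ENNReal.ofReal_le_ofReal (hK.one_le _ ?_ ?_)
      · exact sub_ne_zero.2 fun h => hp'.2 ((show x = y from h) ▸ hp'.1)
      · have h1 := hA x hp.1
        have h2 := hA' y hp.2
        have e1 : x - y = (x - (ρ - 1 / 2) • e) - (y - (ρ + 1 / 2) • e) - e := by
          module
        change ‖x - y‖ < 2
        rw [e1]
        refine (norm_sub_le _ _).trans_lt ?_
        have := norm_sub_le (x - (ρ - 1 / 2) • e) (y - (ρ + 1 / 2) • e)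
        linarith
    _ ≤ _ := lintegral_mono_set hsub

lemma IsKernel.exists_flatnessRate_eq (hK : IsKernel K Ks) (hn : 1 ≤ n) {C₁ R : ℝ} (hC : 0 < C₁)
    (hR : 4 ≤ R) : ∃ r : ℝ, 0 < r ∧ flatnessRate K C₁ R = ENNReal.ofReal r := by
  have hω := ballConst_pos n
  set I := ∫⁻ z, ENNReal.ofReal (K z * min 1 ‖z‖)
  have hI : I ≠ ∞ := hK.integrable.lintegral_lt_top.ne
  have hlog : 0 < Real.log R := Real.log_pos (by linarith)
  have hfin : energyDensityRoot K C₁ R ≠ ∞ := by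
    refine ENNReal.rpow_ne_top_of_nonneg (by norm_num) (ENNReal.div_ne_top ?_ ?_)
    · exact ENNReal.mul_ne_top ENNReal.ofReal_ne_top (ne_top_of_le_ne_top
        (ENNReal.mul_ne_top ENNReal.ofReal_ne_top hI) (hK.perK_ball_le hn (by linarith)))
    · exact (ENNReal.ofReal_pos.2 (by positivity)).ne'
  have hpos : 0 < energyDensityRoot K C₁ R := by
    refine ENNReal.rpow_pos_of_nonneg (ENNReal.div_pos ?_ ENNReal.ofReal_ne_top) (by norm_num)
    exact (ENNReal.mul_pos (by simpa using hC) (hK.perK_ball_pos hn (by linarith)).ne').ne'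
  have h1 : flatnessRate K C₁ R ≠ ∞ := ne_top_of_le_ne_top hfin (min_le_left _ _)
  have h2 : 0 < flatnessRate K C₁ R := by
    refine lt_min hpos (ENNReal.mul_pos ?_ ?_)
    · have : 0 < 1 / Real.sqrt (Real.log R) := by positivity
      simpa using this
    · refine (hpos.trans_le ?_).ne'
      exact le_iSup₂ (f := fun ρ (_ : ρ ∈ Icc (1 : ℝ) R) => energyDensityRoot K C₁ ρ) R
        ⟨by linarith, le_rfl⟩
  exact ⟨(flatnessRate K C₁ R).toReal, ENNReal.toReal_pos h2.ne' h1, (ENNReal.ofReal_toReal h1).symm⟩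

end

/-! ### Invariance under modifications on null sets -/

lemma interaction_congr_ae {n : ℕ} (K : Euc n → ℝ) {A A' B B' : Set (Euc n)} (hA : A =ᵐ[volume] A')
    (hB : B =ᵐ[volume] B') : interaction K A B = interaction K A' B' := by
  rw [interaction, interaction, setLIntegral_congr hA]
  exact lintegral_congr fun x => setLIntegral_congr hB

lemma perKIn_congr_ae {n : ℕ} (K : Euc n → ℝ) (Ω : Set (Euc n)) {E E' : Set (Euc n)}
    (h : E =ᵐ[volume] E') : perKIn K Ω E = perKIn K Ω E' := by
  have hc := h.compl
  rw [perKIn, perKIn,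
    interaction_congr_ae K (h.inter (ae_eq_refl Ω)) (hc.inter (ae_eq_refl Ω)),
    interaction_congr_ae K (h.inter (ae_eq_refl Ω)) (hc.diff (ae_eq_refl Ω)),
    interaction_congr_ae K (h.diff (ae_eq_refl Ω)) (hc.inter (ae_eq_refl Ω))]

/-- A competitor for `E'` agrees with `E` outside `Ω` only almost everywhere. Replacing its outer
part by that of `E` changes a null set and makes it an exact competitor. -/
lemma IsMinimizer.congr_ae {n : ℕ} {K : Euc n → ℝ} {Ω E E' : Set (Euc n)}
    (hmin : IsMinimizer K Ω E) (h : E =ᵐ[volume] E') :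
    IsMinimizer K Ω E' := by
  refine ⟨hmin.measurable.congr h, ?_, fun F hF hFE => ?_⟩
  · rw [← perKIn_congr_ae K Ω h]; exact hmin.finite
  · rw [← perKIn_congr_ae K Ω h]
    have h1 : ((F ∩ Ω) ∪ (E \ Ω) : Set (Euc n)) =ᵐ[volume] F := by
      have h2 : ((F ∩ Ω) ∪ (E \ Ω) : Set (Euc n)) =ᵐ[volume] ((F ∩ Ω) ∪ (E' \ Ω) : Set (Euc n)) :=
        (ae_eq_refl _).union (h.diff (ae_eq_refl Ω))
      rwa [← hFE, inter_union_sdiff] at h2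
    refine (hmin.minimal ((F ∩ Ω) ∪ (E \ Ω)) (hF.congr h1.symm) ?_).trans_eq
      (perKIn_congr_ae K Ω h1)
    ext x
    simp only [mem_sdiff, mem_union, mem_inter_iff]
    tauto

lemma image_ae_eq_image {n : ℕ} (f : Euc n →L[ℝ] Euc n) (hf : Function.Injective f)
    {E E' : Set (Euc n)} (h : E =ᵐ[volume] E') : (f '' E : Set (Euc n)) =ᵐ[volume] f '' E' := by
  rw [← measure_symmDiff_eq_zero_iff] at h ⊢
  rw [← image_symmDiff hf, Measure.addHaar_image_continuousLinearMap, h, mul_zero]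

lemma CloseToHalfSpace.congr_ae {d : ℕ} {E E' : Set (Euc (d + 1))} {ε : ℝ}
    (h : CloseToHalfSpace E ε) (hE : E =ᵐ[volume] E') : CloseToHalfSpace E' ε := by
  obtain ⟨t, ht, h⟩ := h
  refine ⟨t, ht, le_of_eq_of_le (measure_congr ?_) h⟩
  exact ((hE.symm.diff (ae_eq_refl _)).union ((ae_eq_refl _).diff hE.symm)).inter (ae_eq_refl _)

lemma SubgraphOutsideSmallSet.congr_ae {d : ℕ} {E E' : Set (Euc (d + 1))} {ε : ℝ}
    (h : SubgraphOutsideSmallSet E ε) (hE : E =ᵐ[volume] E') : SubgraphOutsideSmallSet E' ε := by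
  obtain ⟨B, g, h1, h2, h3, h4, h5, h6⟩ := h
  exact ⟨B, g, h1, h2, h3, h4, h5,
    ((hE.symm.inter (ae_eq_refl _)).diff (ae_eq_refl _)).trans h6⟩

lemma StretchedPerBound.congr_ae {d : ℕ} {E E' : Set (Euc (d + 1))} {ε M : ℝ} (hε : 0 < ε)
    (h : StretchedPerBound E ε M) (hE : E =ᵐ[volume] E') : StretchedPerBound E' ε M := by
  have h1 : (stretch ε '' E : Set (Euc (d + 1))) =ᵐ[volume] stretch ε '' E' :=
    image_ae_eq_image (stretchCLM d ε) (stretch_injective hε.ne') hE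
  have : classicalPer (stretch ε '' Metric.ball 0 1) (stretch ε '' E') =
      classicalPer (stretch ε '' Metric.ball 0 1) (stretch ε '' E) := by
    simp only [classicalPer, setIntegral_congr_set h1]
  rw [StretchedPerBound, this]
  exact h

lemma CloseToHalfSpace.mono {d : ℕ} {E : Set (Euc (d + 1))} {ε ε' : ℝ}
    (h : CloseToHalfSpace E ε) (hε : ε ≤ ε') : CloseToHalfSpace E ε' := by
  obtain ⟨t, ht, h⟩ := h
  exact ⟨t, ht, h.trans (ENNReal.ofReal_le_ofReal hε)⟩

/-! ### Flatness of minimizers -/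

/-- Small jumps imply flatness. -/
lemma OneSidedJumps.exists_rotation_flat {d : ℕ} (hd : 0 < d) {E : Set (Euc (d + 1))} {δ ε : ℝ}
    (hE : MeasurableSet E) (hδ : 0 < δ) (h : OneSidedJumps E δ) (hδε : δ ≤ ε)
    (hε : halfSpaceConst d * δ ≤ ε) :
    ∃ U : Euc (d + 1) ≃ₗᵢ[ℝ] Euc (d + 1),
      LinearMap.det (U.toLinearEquiv : Euc (d + 1) →ₗ[ℝ] Euc (d + 1)) = 1 ∧
      CloseToHalfSpace (U '' E) ε ∧ SubgraphOutsideSmallSet (U '' E) ε ∧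
      StretchedPerBound (U '' E) ε ((2 * d + 2 + sphereConst (d + 1)) * max 1 ε) := by
  obtain ⟨U, hU, h1, h2⟩ := h.exists_rotation hd hE hδ.le
  have hs := sphereConst_nonneg (d + 1)
  have hUE : MeasurableSet (U '' E) :=
    U.toHomeomorph.toMeasurableEquiv.measurableSet_image.2 hE
  have hfin : ∀ v, _root_.upVar (U '' E) v ≤ ENNReal.ofReal ((δ + sphereConst (d + 1)) * ‖v‖) :=
    fun v => by
      rw [upVar_image]
      simpa using h.upVar_le hE hδ.le (U.symm v)
  have hneg : _root_.upVar (U '' E) (-EuclideanSpace.single (Fin.last d) 1) ≤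
      ENNReal.ofReal (δ + sphereConst (d + 1)) := by
    simpa using hfin (-EuclideanSpace.single (Fin.last d) 1)
  refine ⟨U, hU, ?_, ?_, ?_⟩
  · exact (closeToHalfSpace_of_upVar_le hd hUE hδ
      (upVar_join_zero_le (by positivity) hfin hδ.le h1) h2).mono hε
  · exact subgraphOutsideSmallSet_of_upVar_le hUE (h2.trans (ENNReal.ofReal_le_ofReal hδε))
  · exact stretchedPerBound_of_upVar_le hUE hδ.le (hδ.trans_le hδε) hδε hs h1 h2 hneg

end

/-! ### Choice of constants and conclusion -/

theorem mainTheorem10 (d : ℕ) (hd : d + 1 = 2 ∨ d + 1 = 3) :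
    ∃ C₀ : ℝ, 0 < C₀ ∧ ∀ R₀ : ℝ, 2 ≤ R₀ → ∃ C : ℝ, 0 < C ∧
      ∀ (K : EuclideanSpace ℝ (Fin (d + 1)) → ℝ) (C₁ : ℝ), 0 < C₁ →
        IsKernel K (kernelStar K C₁ R₀) →
        ∀ R : ℝ, 4 ≤ R → ∀ E : Set (EuclideanSpace ℝ (Fin (d + 1))),
          IsMinimizer K (Metric.ball 0 R) E →
          ∃ ε : ℝ, 0 < ε ∧ ENNReal.ofReal ε = ENNReal.ofReal C * flatnessRate K C₁ R ∧
            ∃ U : EuclideanSpace ℝ (Fin (d + 1)) ≃ₗᵢ[ℝ] EuclideanSpace ℝ (Fin (d + 1)),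
              LinearMap.det (U.toLinearEquiv : EuclideanSpace ℝ (Fin (d + 1)) →ₗ[ℝ]
                EuclideanSpace ℝ (Fin (d + 1))) = 1 ∧
              CloseToHalfSpace (U '' E) ε ∧
              SubgraphOutsideSmallSet (U '' E) ε ∧
              StretchedPerBound (U '' E) ε (C₀ * max 1 ε) := by
  have hd0 : 0 < d := by omega
  have hs := sphereConst_nonneg (d + 1)
  refine ⟨2 * d + 2 + sphereConst (d + 1), by positivity, fun R₀ hR₀ => ?_⟩
  obtain ⟨k, hk⟩ := pow_unbounded_of_one_lt R₀ (one_lt_two (α := ℝ))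
  have hk : R₀ ≤ 2 * 2 ^ k := by
    have : (0 : ℝ) < 2 ^ k := by positivity
    linarith
  set J := (jumpConst (d + 1) k R₀).toReal
  have hJ0 : 0 ≤ J := ENNReal.toReal_nonneg
  have hJ : jumpConst (d + 1) k R₀ = ENNReal.ofReal J :=
    (ENNReal.ofReal_toReal (jumpConst_ne_top _ _ _)).symm
  refine ⟨(J + 1) * max 1 (halfSpaceConst d), by positivity, fun K C₁ hC₁ hK R hR E hE => ?_⟩
  obtain ⟨r, hr0, hr⟩ := hK.exists_flatnessRate_eq (by omega) hC₁ hR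
  refine ⟨(J + 1) * max 1 (halfSpaceConst d) * r, by positivity, ?_, ?_⟩
  · rw [hr, ← ENNReal.ofReal_mul (by positivity)]
  -- Minimality and all three conclusions ignore null sets, so a Borel representative is used.
  obtain ⟨E', -, hE'm, hE'⟩ := hE.measurable.exists_measurable_superset_ae_eq
  have hmin := hE.congr_ae hE'.symm
  -- Taking `J + 1` instead of the square root of `J` suffices, since `J ≤ (J + 1)²`, and it is
  -- positive even if `J` vanishes.
  have hδ : 0 < (J + 1) * r := by positivity
  have hjump : OneSidedJumps E' ((J + 1) * r) := by
    refine hmin.oneSidedJumps_of_rate_le hK hE'm (by omega) hC₁ hR₀ hR hk hδ.le ?_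
    rw [hJ, hr, ← ENNReal.ofReal_pow hr0.le, ← ENNReal.ofReal_mul hJ0, mul_pow]
    refine ENNReal.ofReal_le_ofReal (mul_le_mul_of_nonneg_right ?_ (sq_nonneg r))
    nlinarith
  have hle : ∀ a, a ≤ max 1 (halfSpaceConst d) →
      a * ((J + 1) * r) ≤ (J + 1) * max 1 (halfSpaceConst d) * r := fun a ha => by
    rw [mul_right_comm, mul_comm]; gcongr
  obtain ⟨U, hU, h1, h2, h3⟩ := hjump.exists_rotation_flat hd0 hE'm hδ
    (by simpa using hle 1 (le_max_left _ _)) (hle _ (le_max_right _ _))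
  have hUE : (U '' E' : Set (EuclideanSpace ℝ (Fin (d + 1)))) =ᵐ[volume] U '' E :=
    image_ae_eq_image (U.toContinuousLinearEquiv : _ →L[ℝ] _) U.injective hE'
  exact ⟨U, hU, h1.congr_ae hUE, h2.congr_ae hUE, h3.congr_ae (by positivity) hUE⟩
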